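/- Let $a\ge 0$ and $d\in\{0,1\}$, let $G=O(a+d,a)$ with maximal compact subgroup $K=O(a+d)\times O(a)$, let $e_1,\dots,e_{a+d}$, $f_1,\dots,f_a$ be the standard basis, and let $B=AN\subset SO(a+d,a)$, $A\cong(\mathbb R^\times)^a$, be the Borel subgroup stabilizing the isotropic flag $\langle e_1+f_1,\dots,e_j+f_j\rangle$, $1\le j\le a$. Put $M=K\cap B$ and let $\mathfrak a\cong\mathbb R^a$ be the split Cartan subspace in which the element $x$ acts on $e_j\pm f_j$ by $\pm x_j$. The normalizer of $\mathfrak a$ in $K\cap SO(a+d,a)$ acts on $\mathfrak a$ through the Weyl group $W$, which is $W(D_a)$ for $d=0$ and $W(B_a)=\mathbb Z_2^a\rtimes S_a$ for $d=1$; hence for every representation $V$ of $K$ it acts on $V^M$. For representations of $SO(a+d)\times SO(a)$ we use in the same way $M\cap(SO(a+d)\times SO(a))$ (again written $M$) and the normalizer of $\mathfrak a$ in $SO(a+d)\times SO(a)$, which also acts on $\mathfrak a$ through $W$. A representation $V$ of $K$ is quasispherical if it occurs in the spherical principal series $\mathrm{Ind}_B^G\chi$ ($\chi$ an unramified character, i.e.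 a continuous character of $B$ trivial on $M$), in the sense that $\mathrm{Hom}_K(V,\mathrm{Ind}_B^G\chi)\neq0$. For $2r\le m$ let $\mu(1^r,0^l;+)$, resp. $\mu(2^r,0^l;+)$, $r+l=[m/2]$, be the representation of $O(m)$ generated by the highest weight vector in the irreducible representation of $U(m)$ of highest weight $(1^r,0^{m-r})$, resp. $(2^r,0^{m-r})$, the former being contained in $\bigwedge^r\mathbb C^m$ and the latter in $\bigwedge^r\mathbb C^m\otimes\bigwedge^r\mathbb C^m$; $\mu(0;+)$ is the trivial representation. Without sign $+$, $\mu(\cdot)$ is the irreducible representation of $SO(m)$ with the given highest weight (with respect to the standard torus). For partitions $(\alpha)$ of $k$ and $(\beta)$ of $l$, $k+l=a$, let $\sigma[(\alpha),(\beta)]$ be the representation of $W(B_a)$ induced from the representation of $(S_k\times S_l)\ltimes\mathbb Z_2^a$ which is $\sigma(\alpha)\otimes\sigma(\beta)$ on $S_k\times S_l$, trivial on the first $k$ and sign on the last $l$ factors $\mathbb Z_2$ (here $\sigma((k))$ is trivial); its restriction to $W(D_a)$ is denoted in the same way. If $a=2k$, the restriction of $\sigma[(k),(k)]$ to $W(D_a)$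 is the sum of two irreducible representations, $\sigma[(k),(k)]_{I}$, which contains the trivial representation of $S_a$, and $\sigma[(k),(k)]_{II}$, which contains the trivial representation of the conjugate of $S_a$ by the sign change in the last coordinate. **(1) $G=O(a,a)$.** The following representations of $K$ are quasispherical, and the representation of $W(D_a)$ on $V^M$ is as indicated: $$\mu(0;+)\otimes\mu(2^r,0^l;+)\ \leftrightarrow\ \sigma[(r,a-r),(0)],\qquad \mu(1^k,0^l;+)\otimes\mu(1^k,0^l;+)\ \leftrightarrow\ \sigma[(a-k),(k)],$$ for all $0\le r,k\le[a/2]$. If $a=2k$ with $k\ge1$, then for the representations of $SO(a)\times SO(a)$ and all signs $s,t\in\{\pm1\}$ the representation of $W(D_a)$ on $V^M$ is $$\mu(0)\otimes\mu(2^{k-1},2s)\ \leftrightarrow\ \sigma[(k,k),(0)],$$ $$\mu(1^{k-1},s)\otimes\mu(1^{k-1},t)\ \leftrightarrow\ \begin{cases}\sigma[(k),(k)]_{I}& \text{if } st=(-1)^k,\\ \sigma[(k),(k)]_{II}&\text{if } st=-(-1)^k.\end{cases}$$ **(2) $G=O(a+1,a)$.** The following representations of $K$ are quasispherical, and the representation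 of $W(B_a)$ on $V^M$ is as indicated: $$\mu(0;+)\otimes\mu(2^r,0^l;+)\ \leftrightarrow\ \sigma[(r,a-r),(0)]\quad(0\le r\le[a/2]),$$ $$\mu(1^k,0^{[(a+1)/2]-k};+)\otimes\mu(1^k,0^{[a/2]-k};+)\ \leftrightarrow\ \sigma[(a-k),(k)]\quad(0\le k\le[a/2]),$$ $$\mu(1^{k+1},0^{[(a+1)/2]-k-1};+)\otimes\mu(1^k,0^{[a/2]-k};+)\ \leftrightarrow\ \sigma[(k),(a-k)]\quad(0\le k,\ k+1\le[(a+1)/2]).$$ For the representations of $SO(a+1)\times SO(a)$ and each sign, the representation of $W(B_a)$ on $V^M$ is $$\mu(1^{a/2})\otimes\mu(1^{a/2-1},\pm1)\ \leftrightarrow\ \sigma[(a/2),(a/2)]\quad(a\ge2\text{ even}),$$ $$\mu(1^{(a-1)/2},\pm1)\otimes\mu(1^{(a-1)/2})\ \leftrightarrow\ \sigma[(\tfrac{a-1}2),(\tfrac{a+1}2)]\quad(a\text{ odd}).$$ -/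

import Mathlib

open scoped Matrix TensorProduct

noncomputable section

/-! ### Generalities on representations -/

/-- The subrepresentation generated by a set of vectors. -/
def generatedSubrep {G V : Type*} [Group G] [AddCommMonoid V] [Module ℂ V]
    (ρ : Representation ℂ G V) (S : Set V) : Subrepresentation ρ where
  toSubmodule := Submodule.span ℂ {x | ∃ g : G, ∃ v ∈ S, x = ρ g v}
  apply_mem_toSubmodule g v hv := by
    induction hv using Submodule.span_induction with
    | mem x hx =>
      obtain ⟨h, w, hw, rfl⟩ := hx
      exact Submodule.subset_span ⟨g * h, w, hw, by simp⟩
    | zero => simp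
    | add x y _ _ hx hy => rw [map_add]; exact Submodule.add_mem _ hx hy
    | smul c x _ hx => rw [map_smul]; exact Submodule.smul_mem _ c hx

/-- The external tensor product, a representation of `G₁ × G₂`. -/
def extTensor {G₁ G₂ V₁ V₂ : Type*} [Group G₁] [Group G₂]
    [AddCommMonoid V₁] [Module ℂ V₁] [AddCommMonoid V₂] [Module ℂ V₂]
    (ρ₁ : Representation ℂ G₁ V₁) (ρ₂ : Representation ℂ G₂ V₂) :
    Representation ℂ (G₁ × G₂) (V₁ ⊗[ℂ] V₂) :=
  Representation.tprod (ρ₁.comp (MonoidHom.fst G₁ G₂)) (ρ₂.comp (MonoidHom.snd G₁ G₂))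

/-! ### Representations of the symmetric groups -/

/-- `S_n` permuting the set of all functions `t : Fin n → ℕ`, linearly extended.  A tabloid of
shape `μ` is recorded as the function sending an entry to the row which contains it. -/
def tabloidRep (n : ℕ) : Representation ℂ (Equiv.Perm (Fin n)) ((Fin n → ℕ) →₀ ℂ) where
  toFun π := Finsupp.lmapDomain ℂ ℂ (fun t i => t (π⁻¹ i))
  map_one' := by
    ext t : 2
    simp [Finsupp.mapDomain_single]
  map_mul' π τ := by
    ext t : 2
    simp [Finsupp.lmapDomain_apply, Finsupp.mapDomain_single]

/-- The polytabloid `e_T = ∑ sgn(q) q·{T}` of a bijective tableau `T` of shape `μ`, the sum being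
over the permutations `q` of the entries which preserve the columns of `T`. -/
def polytabloid {n : ℕ} (μ : YoungDiagram) (T : Fin n ≃ μ.cells) : (Fin n → ℕ) →₀ ℂ :=
  ∑ q : Equiv.Perm (Fin n) with ∀ i, (T (q i)).1.2 = (T i).1.2,
    Finsupp.single (fun i => (T (q⁻¹ i)).1.1) (((Equiv.Perm.sign q : ℤ) : ℂ))

/-- The Specht module of `μ` (for `μ` with `n` boxes): the span of the polytabloids.  One row gives
the trivial representation, one column the sign representation. -/
def spechtSubrep (n : ℕ) (μ : YoungDiagram) : Subrepresentation (tabloidRep n) :=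
  generatedSubrep (tabloidRep n) (Set.range fun T : Fin n ≃ μ.cells => polytabloid μ T)

/-- The underlying space of the Specht module. -/
def SpechtSpace (n : ℕ) (μ : YoungDiagram) : Type := (spechtSubrep n μ).toSubmodule

instance (n : ℕ) (μ : YoungDiagram) : AddCommGroup (SpechtSpace n μ) :=
  inferInstanceAs (AddCommGroup (spechtSubrep n μ).toSubmodule)

instance (n : ℕ) (μ : YoungDiagram) : Module ℂ (SpechtSpace n μ) :=
  inferInstanceAs (Module ℂ (spechtSubrep n μ).toSubmodule)

def spechtRep (n : ℕ) (μ : YoungDiagram) :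
    Representation ℂ (Equiv.Perm (Fin n)) (SpechtSpace n μ) :=
  (spechtSubrep n μ).toRepresentation

/-- The Young diagram with (at most) two rows, of lengths `p` and `q` in decreasing order. -/
def twoRow (p q : ℕ) : YoungDiagram :=
  YoungDiagram.ofRowLens [max p q, min p q] (by
    rw [List.sortedGE_iff_pairwise]
    simp)

/-- The Young diagram with one row, of length `p`. -/
def oneRow (p : ℕ) : YoungDiagram := twoRow p 0

/-! ### The Weyl groups of type `B` and `D` and their representations -/

/-- `W(B_n) = ℤ₂ⁿ ⋊ S_n`, the group of signed permutations. -/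
abbrev WB (n : ℕ) : Type := (Fin n → ℤˣ) ⋊[mulAutArrow] Equiv.Perm (Fin n)

/-- The reflection representation of `W(B_n)`: `⟨ε, π⟩` maps `x` to `i ↦ ε_i x_{π⁻¹ i}`. -/
def WB.act {n : ℕ} (w : WB n) (x : Fin n → ℝ) : Fin n → ℝ :=
  fun i => ((w.left i : ℤ) : ℝ) * x (w.right⁻¹ i)

/-- The product of the signs. -/
def signProd (n : ℕ) : WB n →* ℤˣ where
  toFun w := ∏ i, w.left i
  map_one' := by simp
  map_mul' w z := by
    simp only [SemidirectProduct.mul_left, Pi.mul_apply, Finset.prod_mul_distrib]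
    congr 1
    exact Equiv.prod_comp (w.right⁻¹) (fun i => z.left i)

/-- `W(D_n)`: the signed permutations with an even number of signs. -/
def WD (n : ℕ) : Subgroup (WB n) := (signProd n).ker

/-- The inclusion `W(B_k) × W(B_l) → W(B_n)`, `k + l = n`; its image is
`(S_k × S_l) ⋉ ℤ₂ⁿ`, where `S_k` permutes the first `k` and `S_l` the last `l` indices. -/
def pairEmb {k l n : ℕ} (h : k + l = n) : WB k × WB l →* WB n where
  toFun w :=
    ⟨fun i => Sum.elim w.1.left w.2.left ((finSumFinEquiv.trans (finCongr h)).symm i),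
      (finSumFinEquiv.trans (finCongr h)).permCongr (Equiv.Perm.sumCongr w.1.right w.2.right)⟩
  map_one' := by
    ext i
    · simp only [SemidirectProduct.one_left, Prod.fst_one, Prod.snd_one]
      rcases (finSumFinEquiv.trans (finCongr h)).symm i with j | j <;> rfl
    · simp
  map_mul' w z := by
    ext i
    · obtain ⟨j, rfl⟩ := (finSumFinEquiv.trans (finCongr h)).surjective i
      have hact : ∀ (m : ℕ) (π : Equiv.Perm (Fin m)) (F : Fin m → ℤˣ) (x : Fin m),
          (mulAutArrow π F : Fin m → ℤˣ) x = F (π⁻¹ x) := fun _ _ _ _ => rfl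
      have hp : ∀ (p : Equiv.Perm (Fin k ⊕ Fin l)) (x : Fin n),
          ((finSumFinEquiv.trans (finCongr h)).permCongr p)⁻¹ x =
            (finSumFinEquiv.trans (finCongr h))
              (p⁻¹ ((finSumFinEquiv.trans (finCongr h)).symm x)) := fun _ _ => rfl
      have hs : ∀ j, (finSumFinEquiv.trans (finCongr h)).symm
          ((finSumFinEquiv.trans (finCongr h)) j) = j := Equiv.symm_apply_apply _
      rcases j with j | j <;>
        simp only [Prod.fst_mul, Prod.snd_mul, SemidirectProduct.mul_left, Pi.mul_apply, hact, hp,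
          hs] <;> rfl
    · obtain ⟨j, rfl⟩ := (finSumFinEquiv.trans (finCongr h)).surjective i
      rcases j with j | j <;> simp [Equiv.permCongr_apply]

/-- The representation of `S_n` attached to `μ`, extended to `W(B_n)` trivially on `ℤ₂ⁿ`. -/
def inflated (n : ℕ) (μ : YoungDiagram) :
    Representation ℂ (WB n) (SpechtSpace n μ) :=
  (spechtRep n μ).comp SemidirectProduct.rightHom

/-- The representation of `S_n` attached to `μ`, extended to `W(B_n)` by the sign character on each
factor `ℤ₂`. -/
def inflatedSign (n : ℕ) (μ : YoungDiagram) :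
    Representation ℂ (WB n) (SpechtSpace n μ) where
  toFun w := (((signProd n w : ℤ) : ℂ)) • inflated n μ w
  map_one' := by simp
  map_mul' w z := by
    simp only [map_mul, Units.val_mul, Int.cast_mul]
    rw [smul_mul_smul_comm]

/-- The space of `σ(μ) ⊗ σ(ν)`. -/
abbrev PairSpace (k l : ℕ) (μ ν : YoungDiagram) : Type :=
  SpechtSpace k μ ⊗[ℂ] SpechtSpace l ν

/-- The representation of `W(B_k) × W(B_l) = (S_k × S_l) ⋉ ℤ₂ⁿ` which is `σ(μ) ⊗ σ(ν)` on
`S_k × S_l`, trivial on the first `k` and sign on the last `l` factors `ℤ₂`. -/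
def pairRep (k l : ℕ) (μ ν : YoungDiagram) :
    Representation ℂ (WB k × WB l) (PairSpace k l μ ν) :=
  extTensor (inflated k μ) (inflatedSign l ν)

/-- The representation `σ((μ),(ν))` of `W(B_n)`, `n = k + l`, attached to a pair of partitions `μ`
of `k` and `ν` of `l`: induced from the representation above of `(S_k × S_l) ⋉ ℤ₂ⁿ`. -/
def sigmaRep {k l n : ℕ} (h : k + l = n) (μ ν : YoungDiagram) :
    Representation ℂ (WB n)
      (Representation.IndV (k := ℂ) (A := PairSpace k l μ ν) (pairEmb h) (pairRep k l μ ν)) :=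
  Representation.ind (k := ℂ) (A := PairSpace k l μ ν) (pairEmb h) (pairRep k l μ ν)

/-- Restriction to a subgroup of `W(B_n)`. -/
def resTo {n : ℕ} {E : Type*} [AddCommMonoid E] [Module ℂ E] (W : Subgroup (WB n))
    (σ : Representation ℂ (WB n) E) : Representation ℂ W E :=
  σ.comp W.subtype

/-- The sign change in the last coordinate only. -/
def lastSign (n : ℕ) : WB n := ⟨fun i => if i.val + 1 = n then -1 else 1, 1⟩

/-- `σ((k),(k))_I`: the constituent of the restriction of `σ((k),(k))` to `W(D_n)`, `n = 2k`, which
contains the trivial representation of the subgroup `S_n`. -/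
def sigmaI {k n : ℕ} (h : k + k = n) :
    Subrepresentation (resTo (WD n) (sigmaRep h (oneRow k) (oneRow k))) :=
  generatedSubrep _ {x | ∀ π : Equiv.Perm (Fin n),
    sigmaRep h (oneRow k) (oneRow k) (SemidirectProduct.inr π) x = x}

/-- `σ((k),(k))_II`: the constituent of the restriction of `σ((k),(k))` to `W(D_n)`, `n = 2k`, which
contains the trivial representation of `S_n'`, the conjugate of `S_n` by the sign change in the
last coordinate. -/
def sigmaII {k n : ℕ} (h : k + k = n) :
    Subrepresentation (resTo (WD n) (sigmaRep h (oneRow k) (oneRow k))) :=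
  generatedSubrep _ {x | ∀ π : Equiv.Perm (Fin n),
    sigmaRep h (oneRow k) (oneRow k)
      (lastSign n * SemidirectProduct.inr π * (lastSign n)⁻¹) x = x}

/-! ### The groups `O(a+d, a)`; only `d = 0` and `d = 1` will be used -/

/-- The compact orthogonal group `O(n)`. -/
abbrev OO (n : ℕ) : Type := Matrix.orthogonalGroup (Fin n) ℝ

/-- The compact group `SO(n)`, as a subgroup of `O(n)`. -/
def SOsub (n : ℕ) : Subgroup (OO n) where
  carrier := {k | (k : Matrix (Fin n) (Fin n) ℝ).det = 1}
  one_mem' := by simp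
  mul_mem' {x y} hx hy := by
    simp only [Set.mem_ofPred_eq] at hx hy ⊢
    simp [hx, hy]
  inv_mem' {x} hx := by
    simp only [Set.mem_ofPred_eq] at hx ⊢
    have h1 : ((x * x⁻¹ : OO n) : Matrix (Fin n) (Fin n) ℝ).det = 1 := by simp
    have h2 : ((x * x⁻¹ : OO n) : Matrix (Fin n) (Fin n) ℝ).det =
        (x : Matrix (Fin n) (Fin n) ℝ).det * ((x⁻¹ : OO n) : Matrix (Fin n) (Fin n) ℝ).det := by
      rw [← Matrix.det_mul]; rfl
    rw [h2, hx, one_mul] at h1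
    exact h1

/-- The index set of the coordinates of `ℝ^{a+d,a}`. -/
abbrev Idx (a d : ℕ) : Type := Fin (a + d) ⊕ Fin a

/-- The indefinite orthogonal group `O(a+d, a)`. -/
def indefO (a d : ℕ) : Subgroup (GL (Idx a d) ℝ) where
  carrier := {g | (g : Matrix (Idx a d) (Idx a d) ℝ)ᵀ *
      LieAlgebra.Orthogonal.indefiniteDiagonal (Fin (a + d)) (Fin a) ℝ *
      (g : Matrix (Idx a d) (Idx a d) ℝ) =
    LieAlgebra.Orthogonal.indefiniteDiagonal (Fin (a + d)) (Fin a) ℝ}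
  one_mem' := by simp
  mul_mem' {x y} hx hy := by
    simp only [Set.mem_ofPred_eq] at hx hy ⊢
    rw [Units.val_mul, Matrix.transpose_mul]
    calc _ = (y : Matrix (Idx a d) (Idx a d) ℝ)ᵀ *
          ((x : Matrix (Idx a d) (Idx a d) ℝ)ᵀ *
            LieAlgebra.Orthogonal.indefiniteDiagonal (Fin (a + d)) (Fin a) ℝ *
            (x : Matrix (Idx a d) (Idx a d) ℝ)) * (y : Matrix (Idx a d) (Idx a d) ℝ) := by
          simp only [Matrix.mul_assoc]
      _ = _ := by rw [hx, hy]
  inv_mem' {x} hx := by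
    simp only [Set.mem_ofPred_eq] at hx ⊢
    have h1 : (x : Matrix (Idx a d) (Idx a d) ℝ) *
        ((x⁻¹ : GL (Idx a d) ℝ) : Matrix (Idx a d) (Idx a d) ℝ) = 1 := Units.mul_inv x
    have h2 : ((x⁻¹ : GL (Idx a d) ℝ) : Matrix (Idx a d) (Idx a d) ℝ)ᵀ *
        (x : Matrix (Idx a d) (Idx a d) ℝ)ᵀ = 1 := by
      rw [← Matrix.transpose_mul, h1, Matrix.transpose_one]
    conv_lhs => rw [← hx]
    calc _ = (((x⁻¹ : GL (Idx a d) ℝ) : Matrix (Idx a d) (Idx a d) ℝ)ᵀ *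
          (x : Matrix (Idx a d) (Idx a d) ℝ)ᵀ) *
            LieAlgebra.Orthogonal.indefiniteDiagonal (Fin (a + d)) (Fin a) ℝ *
          ((x : Matrix (Idx a d) (Idx a d) ℝ) *
            ((x⁻¹ : GL (Idx a d) ℝ) : Matrix (Idx a d) (Idx a d) ℝ)) := by
          simp only [Matrix.mul_assoc]
      _ = _ := by rw [h1, h2, Matrix.one_mul, Matrix.mul_one]

/-- The maximal compact subgroup `K = O(a+d) × O(a)`. -/
abbrev KK (a d : ℕ) : Type := OO (a + d) × OO a

/-- The block diagonal matrix of an element of `K`. -/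
def blockMat {a d : ℕ} (k : KK a d) : Matrix (Idx a d) (Idx a d) ℝ :=
  Matrix.fromBlocks (k.1 : Matrix (Fin (a + d)) (Fin (a + d)) ℝ) 0 0
    (k.2 : Matrix (Fin a) (Fin a) ℝ)

def blockHom (a d : ℕ) : KK a d →* Matrix (Idx a d) (Idx a d) ℝ where
  toFun := blockMat
  map_one' := by simp [blockMat]
  map_mul' x y := by simp [blockMat, Matrix.fromBlocks_multiply]

/-- The block diagonal embedding of `K` into `O(a+d, a)`. -/
def kEmb (a d : ℕ) : KK a d →* indefO a d :=
  (blockHom a d).toHomUnits.codRestrict (indefO a d) (by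
    intro k
    have h1 : (k.1 : Matrix (Fin (a + d)) (Fin (a + d)) ℝ)ᵀ *
        (k.1 : Matrix (Fin (a + d)) (Fin (a + d)) ℝ) = 1 :=
      (Matrix.mem_orthogonalGroup_iff' _ _).1 k.1.2
    have h2 : (k.2 : Matrix (Fin a) (Fin a) ℝ)ᵀ * (k.2 : Matrix (Fin a) (Fin a) ℝ) = 1 :=
      (Matrix.mem_orthogonalGroup_iff' _ _).1 k.2.2
    change (blockMat k)ᵀ * _ * blockMat k = _
    have h3 : LieAlgebra.Orthogonal.indefiniteDiagonal (Fin (a + d)) (Fin a) ℝ =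
        Matrix.fromBlocks 1 0 0 (-1) := by
      ext i j
      rcases i with i | i <;> rcases j with j | j <;>
        simp [LieAlgebra.Orthogonal.indefiniteDiagonal, Matrix.diagonal_apply, Matrix.one_apply]
      split_ifs <;> simp
    rw [h3]
    simp [blockMat, Matrix.fromBlocks_transpose, Matrix.fromBlocks_multiply, h1, h2])

/-- With `e_1, …, e_{a+d}, f_1, …, f_a` the standard basis, the isotropic vector `e_j + f_j`. -/
def isoVector (a d : ℕ) (j : Fin a) : Idx a d → ℝ :=
  Pi.single (Sum.inl (Fin.castAdd d j)) 1 + Pi.single (Sum.inr j) 1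

/-- The full isotropic flag `F_j = ⟨e_i + f_i : i ≤ j⟩`. -/
def isoFlag (a d : ℕ) (j : Fin a) : Submodule ℝ (Idx a d → ℝ) :=
  Submodule.span ℝ (isoVector a d '' {i | i ≤ j})

/-- The Borel subgroup `B = AN`, with `A ≅ (ℝˣ)ᵃ`: the stabilizer of the full isotropic flag in
`SO(a+d, a)`. -/
def borelSub (a d : ℕ) : Subgroup (indefO a d) where
  carrier := {g | ((g : GL (Idx a d) ℝ) : Matrix (Idx a d) (Idx a d) ℝ).det = 1 ∧
    ∀ j, (isoFlag a d j).map
      (Matrix.mulVecLin ((g : GL (Idx a d) ℝ) : Matrix (Idx a d) (Idx a d) ℝ)) = isoFlag a d j}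
  one_mem' := by simp
  mul_mem' {x y} hx hy := by
    refine ⟨by simp [hx.1, hy.1], fun j => ?_⟩
    have : Matrix.mulVecLin (((x * y : indefO a d) : GL (Idx a d) ℝ) :
        Matrix (Idx a d) (Idx a d) ℝ) =
      (Matrix.mulVecLin ((x : GL (Idx a d) ℝ) : Matrix (Idx a d) (Idx a d) ℝ)).comp
        (Matrix.mulVecLin ((y : GL (Idx a d) ℝ) : Matrix (Idx a d) (Idx a d) ℝ)) := by
      simp [Matrix.mulVecLin_mul]
    rw [this, Submodule.map_comp, hy.2 j, hx.2 j]
  inv_mem' {x} hx := by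
    have h1 : (((x⁻¹ : indefO a d) : GL (Idx a d) ℝ) : Matrix (Idx a d) (Idx a d) ℝ) *
        ((x : GL (Idx a d) ℝ) : Matrix (Idx a d) (Idx a d) ℝ) = 1 := by
      rw [← Units.val_mul, ← Subgroup.coe_mul]; simp
    refine ⟨?_, fun j => ?_⟩
    · have := congrArg Matrix.det h1
      rwa [Matrix.det_mul, hx.1, mul_one, Matrix.det_one] at this
    · conv_lhs => rw [← hx.2 j]
      rw [← Submodule.map_comp, ← Matrix.mulVecLin_mul, h1, Matrix.mulVecLin_one,
        Submodule.map_id]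

/-- `M = K ∩ B`. -/
def Mgrp (a d : ℕ) : Subgroup (KK a d) := (borelSub a d).comap (kEmb a d)

/-! ### Spherical principal series and quasispherical representations of `K` -/

/-- Unramified characters of `B`: continuous and trivial on `K ∩ B`. -/
def IsUnramified {a d : ℕ} (χ : borelSub a d →* ℂˣ) : Prop :=
  Continuous χ ∧ ∀ (k : KK a d) (hk : kEmb a d k ∈ borelSub a d), χ ⟨kEmb a d k, hk⟩ = 1

/-- `f` belongs to the space of the spherical principal series attached to the unramified character
`χ`: it is left `K`-finite and `f (g b) = χ(b)⁻¹ f(g)`.  (The normalizing factor `δ_B^{1/2}` is an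
unramified character and is absorbed in `χ`.) -/
def InPrincipalSeries {a d : ℕ} (χ : borelSub a d →* ℂˣ) (f : indefO a d → ℂ) : Prop :=
  (∀ (g : indefO a d) (b : borelSub a d), f (g * b) = ((χ b)⁻¹ : ℂˣ) * f g) ∧
  FiniteDimensional ℂ (Submodule.span ℂ
    (Set.range fun (k : KK a d) (g : indefO a d) => f ((kEmb a d k)⁻¹ * g)))

/-- A representation of `K` is quasispherical if it occurs in the spherical principal series:
there is a nonzero `K`-homomorphism into it, for every unramified character. -/
def IsQuasispherical {a d : ℕ} {V : Type*} [AddCommMonoid V] [Module ℂ V]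
    (ρ : Representation ℂ (KK a d) V) : Prop :=
  ∀ χ : borelSub a d →* ℂˣ, IsUnramified χ →
    ∃ T : V →ₗ[ℂ] (indefO a d → ℂ), T ≠ 0 ∧ (∀ v, InPrincipalSeries χ (T v)) ∧
      ∀ (k : KK a d) (v : V) (g : indefO a d), T (ρ k v) g = T v ((kEmb a d k)⁻¹ * g)

/-! ### The Weyl group action on `V^M` -/

/-- The element of `𝔞 ≅ ℝᵃ` with coordinates `x`; it maps `e_j ± f_j` to `± x_j (e_j ± f_j)`. -/
def aMat (a d : ℕ) (x : Fin a → ℝ) : Matrix (Idx a d) (Idx a d) ℝ :=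
  Matrix.fromBlocks 0 (Matrix.of fun i j => if i = Fin.castAdd d j then x j else 0)
    (Matrix.of fun j i => if i = Fin.castAdd d j then x j else 0) 0

/-- `k` normalizes `𝔞` and lies in `SO(a+d, a)`. -/
def NormalizesA {a d : ℕ} (k : KK a d) : Prop :=
  (blockMat k).det = 1 ∧ ∀ x, ∃ y, blockMat k * aMat a d x = aMat a d y * blockMat k

/-- The adjoint action of `k` on `𝔞 ≅ ℝᵃ` is the signed permutation `w`. -/
def InducesOnA {a d : ℕ} (k : KK a d) (w : WB a) : Prop :=
  ∀ x, blockMat k * aMat a d x = aMat a d (w.act x) * blockMat k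

/-- Let `Γ` be a group with a homomorphism `j` to `K` (in the applications the inclusion of `K`
itself or of `SO(a+d) × SO(a)`) and `(ρ, V)` a representation of `Γ`.  The assertion is that the
normalizer of `𝔞` in `Γ ∩ SO(a+d, a)` acts on `𝔞` through exactly the group `W`, and that `V^M` is
stable under this normalizer, which acts on it through `W` by a representation isomorphic to
`(σ, E)`; the isomorphism is `Φ : E ≃ V^M ⊆ V`. -/
def CarriesWeylRep {a d : ℕ} {Γ V E : Type*} [Group Γ] [AddCommMonoid V] [Module ℂ V]
    [AddCommMonoid E] [Module ℂ E] (j : Γ →* KK a d) (ρ : Representation ℂ Γ V)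
    (W : Subgroup (WB a)) (σ : Representation ℂ W E) : Prop :=
  (∀ w : W, ∃ γ, NormalizesA (j γ) ∧ InducesOnA (j γ) w) ∧
  ∃ Φ : E →ₗ[ℂ] V, Function.Injective Φ ∧
    (∀ v, v ∈ LinearMap.range Φ ↔ ∀ γ, j γ ∈ Mgrp a d → ρ γ v = v) ∧
    ∀ γ, NormalizesA (j γ) → ∃ w : W, InducesOnA (j γ) w ∧ ∀ x, ρ γ (Φ x) = Φ (σ w x)

/-- The inclusion of `SO(a+d) × SO(a)` in `K`. -/
def soIncl (a d : ℕ) : SOsub (a + d) × SOsub a →* KK a d :=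
  (SOsub (a + d)).subtype.prodMap (SOsub a).subtype

/-! ### The representations `μ(1^r, 0^l)` and `μ(2^r, 0^l)` -/

/-- `⋀^r ℂ^m` as a representation of `O(m)`. -/
def extPowRep (m r : ℕ) : Representation ℂ (OO m) (⋀[ℂ]^r (Fin m → ℂ)) where
  toFun k := exteriorPower.map r
    (Matrix.mulVecLin ((k : Matrix (Fin m) (Fin m) ℝ).map (algebraMap ℝ ℂ)))
  map_one' := by
    have : ((1 : OO m) : Matrix (Fin m) (Fin m) ℝ).map (algebraMap ℝ ℂ) = 1 := by simp
    rw [this, Matrix.mulVecLin_one, exteriorPower.map_id]; rfl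
  map_mul' x y := by
    have : ((x * y : OO m) : Matrix (Fin m) (Fin m) ℝ).map (algebraMap ℝ ℂ) =
        (x : Matrix (Fin m) (Fin m) ℝ).map (algebraMap ℝ ℂ) *
        (y : Matrix (Fin m) (Fin m) ℝ).map (algebraMap ℝ ℂ) := by
      rw [← Matrix.map_mul]; rfl
    rw [this, Matrix.mulVecLin_mul]; exact (exteriorPower.map_comp (n := r)
      (Matrix.mulVecLin ((y : Matrix (Fin m) (Fin m) ℝ).map (algebraMap ℝ ℂ)))
      (Matrix.mulVecLin ((x : Matrix (Fin m) (Fin m) ℝ).map (algebraMap ℝ ℂ))))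

/-- With `e_1, …, e_m` the standard basis of `ℂ^m`, the weight vector `e_{2j+1} + s i e_{2j+2}`
of the standard maximal torus of `SO(m)`. -/
def weightVector (m j : ℕ) (s : ℤˣ) : Fin m → ℂ :=
  fun t => if t.val = 2 * j then 1 else if t.val = 2 * j + 1 then ((s : ℤ) : ℂ) * Complex.I else 0

/-- The weight vector of weight `(1, …, 1, s, 0, …, 0)`, with `r` nonzero entries, in `⋀^r ℂ^m`. -/
def hwWedge (m r : ℕ) (s : ℤˣ) : ⋀[ℂ]^r (Fin m → ℂ) :=
  exteriorPower.ιMulti ℂ r fun j : Fin r => weightVector m j (if j.val + 1 = r then s else 1)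

/-- For `Γ` mapping to `O(m)`: the `Γ`-component of `⋀^r ℂ^m`, the representation
`μ(1^r, 0^{m-r})` of `U(m)`, generated by the vector of weight `(1^{r-1}, s, 0^l)`. -/
def muOne {Γ : Type*} [Group Γ] {m : ℕ} (φ : Γ →* OO m) (r : ℕ) (s : ℤˣ) :
    Subrepresentation ((extPowRep m r).comp φ) :=
  generatedSubrep ((extPowRep m r).comp φ) {hwWedge m r s}

/-- For `Γ` mapping to `O(m)`: the `Γ`-component of `⋀^r ℂ^m ⊗ ⋀^r ℂ^m` generated by the vector of
weight `(2^{r-1}, 2s, 0^l)`; it is contained in the Cartan component `μ(2^r, 0^{m-r})` of `U(m)`. -/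
def muTwo {Γ : Type*} [Group Γ] {m : ℕ} (φ : Γ →* OO m) (r : ℕ) (s : ℤˣ) :
    Subrepresentation (Representation.tprod ((extPowRep m r).comp φ) ((extPowRep m r).comp φ)) :=
  generatedSubrep _ {hwWedge m r s ⊗ₜ[ℂ] hwWedge m r s}

/-- The representation `μ(1^r, 0^l; +)` of `O(m)`, `r + l = [m/2]`. -/
def muOneO (m r : ℕ) : Representation ℂ (OO m) (muOne (MonoidHom.id (OO m)) r 1).toSubmodule :=
  (muOne (MonoidHom.id (OO m)) r 1).toRepresentation

/-- The representation `μ(2^r, 0^l; +)` of `O(m)`, `r + l = [m/2]`. -/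
def muTwoO (m r : ℕ) : Representation ℂ (OO m) (muTwo (MonoidHom.id (OO m)) r 1).toSubmodule :=
  (muTwo (MonoidHom.id (OO m)) r 1).toRepresentation

/-- The representation of `SO(m)` of highest weight `(1^{r-1}, s, 0^l)`, `r + l = [m/2]`; here
`s = 1` unless `m = 2r`. -/
def muOneSO (m r : ℕ) (s : ℤˣ) :
    Representation ℂ (SOsub m) (muOne (SOsub m).subtype r s).toSubmodule :=
  (muOne (SOsub m).subtype r s).toRepresentation

/-- The representation of `SO(m)` of highest weight `(2^{r-1}, 2s, 0^l)`, `r + l = [m/2]`; here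
`s = 1` unless `m = 2r`. -/
def muTwoSO (m r : ℕ) (s : ℤˣ) :
    Representation ℂ (SOsub m) (muTwo (SOsub m).subtype r s).toSubmodule :=
  (muTwo (SOsub m).subtype r s).toRepresentation

/-- `μ_e = μ(0; +) ⊗ μ(2^r, 0^l; +)`, a representation of `K = O(a+d) × O(a)`. -/
def relevantE (a d r : ℕ) :=
  extTensor (Representation.trivial ℂ (OO (a + d)) ℂ) (muTwoO a r)

/-- `μ_o = μ(1^q, 0; +) ⊗ μ(1^k, 0; +)`, a representation of `K = O(a+d) × O(a)`. -/
def relevantO (a d q k : ℕ) := extTensor (muOneO (a + d) q) (muOneO a k)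

end

noncomputable section

/-! ### Criteria for `IsQuasispherical` and `CarriesWeylRep` -/

/-! The group `M` consists of the sign changes `ε` applied simultaneously to `e_1, …, e_a` and `f_1,
…, f_a` (`mem_Mgrp_iff`), and the normalizer of `𝔞` of pairs of signed permutation matrices with the
same permutation (`exists_signedPair_of_normalizesA`). Both act on Plücker coordinates by permuting
indices and inserting signs, so `V^M` can be computed in these coordinates.

Exterior powers: on `μ(1^q) ⊗ μ(1^k)` the product of the minors at index sets `f`, `g` is multiplied
by `ε ∈ M` by a sign, and this character is trivial only if `f` and `g` agree among the first `a`
indices. An `M`-invariant vector is therefore determined by the coefficients at `(L g, g)`, where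
`L` adds nothing or the last index. Signs of reorderings cancel, so these coefficients form a
function on `k`-subsets. Every such function occurs, since sign changes in the first factor alone
separate the subsets and a permuted highest weight vector is nonzero at any prescribed subset
(`symTuples_le`). The resulting action on functions of `k`-subsets is a model of `σ[(p),(k)]`, or of
`σ[(k),(p)]` after a twist by the product of all signs (`exists_model_oneRow`).

The groups `SO`: now `M` contains only even sign changes, which do not distinguish a subset from its
complement. But in middle degree an element of `SO` moves the highest weight vector within one
family of maximal isotropic subspaces, whose complementary minors are proportional
(`minor_complement`). For `SO(a+1) × SO(a)` one factor has even size and this resolves the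
ambiguity. For `SO(2k) × SO(2k)` it gives the functions with `φ(complement) = κ φ`, `κ = s t
(-1)^k`. The constant function lies in the case `κ = 1`, its image under the last sign change in the
case `κ = -1`; these are the constituents I and II (`exists_model_half`).

The representations `μ(2^r)`: all signs are squared in the products of a minor with itself, and
these give functions on `r`-subsets. Isotropy places them in the kernel of the summation onto
`(r-1)`-subsets, and the highest weight vector gives a polytabloid. Since the polytabloids span that
kernel (`kerTuples_le_span`), the image is the Specht module.

Quasisphericity is Frobenius reciprocity: a nonzero `M`-invariant functional suffices, and one of
the above coefficients serves. -/

lemma isQuasispherical_of_functional {a d : ℕ} {V : Type*} [AddCommGroup V] [Module ℂ V]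
    [FiniteDimensional ℂ V] (ρ : Representation ℂ (KK a d) V) (l : V →ₗ[ℂ] ℂ) (hl : l ≠ 0)
    (hM : ∀ k ∈ Mgrp a d, ∀ v, l (ρ k v) = l v) : IsQuasispherical ρ := by
  classical
  intro χ hχ
  -- Two factorizations in `KB` differ by an element of `K ∩ B`, where `χ` is trivial and which
  -- leaves `l` invariant; hence `χ(b)⁻¹ l(k⁻¹ v)` depends only on the product.
  have key : ∀ (k k' : KK a d) (b b' : borelSub a d), kEmb a d k * b = kEmb a d k' * b' →
      ∀ v, ((χ b)⁻¹ : ℂˣ) * l (ρ k⁻¹ v) = ((χ b')⁻¹ : ℂˣ) * l (ρ k'⁻¹ v) := by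
    intro k k' b b' h v
    have h1 : kEmb a d (k'⁻¹ * k) = b' * (b : indefO a d)⁻¹ := by
      rw [map_mul, map_inv, inv_mul_eq_iff_eq_mul, ← mul_assoc, ← h]; group
    have h2 : kEmb a d (k'⁻¹ * k) ∈ borelSub a d := by
      rw [h1]; exact mul_mem b'.2 (inv_mem b.2)
    have h3 := hχ.2 _ h2
    have h4 : (⟨kEmb a d (k'⁻¹ * k), h2⟩ : borelSub a d) = b' * b⁻¹ := Subtype.ext h1
    rw [h4, map_mul, map_inv, mul_inv_eq_one] at h3
    rw [h3]
    congr 1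
    have h5 := hM _ h2 (ρ k⁻¹ v)
    rw [← h5, ← Module.End.mul_apply, ← map_mul]
    simp
  -- The set `KB` is stable under `K` on the left and `B` on the right, so extension by zero
  -- preserves both transformation rules, and the Iwasawa decomposition is not needed.
  let val : V → indefO a d → ℂ := fun v g =>
    if h : ∃ p : KK a d × borelSub a d, g = kEmb a d p.1 * p.2
    then ((χ h.choose.2)⁻¹ : ℂˣ) * l (ρ h.choose.1⁻¹ v) else 0
  have val_mul : ∀ v k (b : borelSub a d),
      val v (kEmb a d k * b) = ((χ b)⁻¹ : ℂˣ) * l (ρ k⁻¹ v) := by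
    intro v k b
    have h : ∃ p : KK a d × borelSub a d, kEmb a d k * (b : indefO a d) = kEmb a d p.1 * p.2 :=
      ⟨(k, b), rfl⟩
    simp only [val, dif_pos h]
    exact (key _ _ _ _ h.choose_spec v).symm
  have val_zero : ∀ v g, (¬ ∃ p : KK a d × borelSub a d, g = kEmb a d p.1 * p.2) → val v g = 0 :=
    fun v g h => dif_neg h
  let T : V →ₗ[ℂ] (indefO a d → ℂ) :=
    { toFun := val
      map_add' := fun x y => by
        ext g
        by_cases h : ∃ p : KK a d × borelSub a d, g = kEmb a d p.1 * p.2
        · obtain ⟨p, rfl⟩ := h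
          simp [val_mul, mul_add]
        · simp [val_zero _ _ h]
      map_smul' := fun c x => by
        ext g
        by_cases h : ∃ p : KK a d × borelSub a d, g = kEmb a d p.1 * p.2
        · obtain ⟨p, rfl⟩ := h
          simp [val_mul]; ring
        · simp [val_zero _ _ h] }
  have hT : ∀ v g, T v g = val v g := fun _ _ => rfl
  have hequiv : ∀ (k : KK a d) (v : V) (g : indefO a d),
      T (ρ k v) g = T v ((kEmb a d k)⁻¹ * g) := by
    intro k v g
    by_cases h : ∃ p : KK a d × borelSub a d, g = kEmb a d p.1 * p.2
    · obtain ⟨p, rfl⟩ := h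
      rw [← mul_assoc, ← map_inv, ← map_mul, hT, hT, val_mul, val_mul, ← Module.End.mul_apply,
        ← map_mul]
      simp
    · rw [hT, hT, val_zero _ _ h, val_zero]
      rintro ⟨p, hp⟩
      refine h ⟨(k * p.1, p.2), ?_⟩
      rw [map_mul, mul_assoc, ← hp, mul_inv_cancel_left]
  refine ⟨T, ?_, ?_, hequiv⟩
  · intro h0
    apply hl
    ext v
    have := congrFun (LinearMap.congr_fun h0 v) (kEmb a d 1 * ((1 : borelSub a d) : indefO a d))
    rw [hT, val_mul] at this
    simpa using this
  · intro v
    refine ⟨?_, ?_⟩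
    · intro g b
      by_cases h : ∃ p : KK a d × borelSub a d, g = kEmb a d p.1 * p.2
      · obtain ⟨p, rfl⟩ := h
        rw [mul_assoc, ← Subgroup.coe_mul, hT, hT, val_mul, val_mul, map_mul, mul_inv]
        push_cast; ring
      · rw [hT, hT, val_zero _ _ h, val_zero, mul_zero]
        rintro ⟨p, hp⟩
        refine h ⟨(p.1, p.2 * b⁻¹), ?_⟩
        rw [Subgroup.coe_mul, ← mul_assoc, ← hp]; simp
    · apply Submodule.finiteDimensional_of_le (S₂ := LinearMap.range T)
      rw [Submodule.span_le]
      rintro _ ⟨k, rfl⟩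
      exact ⟨ρ k v, by ext g; exact hequiv k v g⟩

/-- Averaging over the finite group `M` shows that `c` has the same image on `V^M` as on `V`. As `c`
is injective on `V^M`, the required isomorphism is its inverse composed with `ψ`. So only the image
of `c` on the whole of `V` has to be computed. -/
lemma carriesWeylRep_of_coefficients {a d : ℕ} {Γ V E F : Type*} [Group Γ] [AddCommGroup V]
    [Module ℂ V] [AddCommGroup E] [Module ℂ E] [AddCommGroup F] [Module ℂ F]
    (j : Γ →* KK a d) (ρ : Representation ℂ Γ V)
    (W : Subgroup (WB a)) (σ : Representation ℂ W E) (R : Representation ℂ (WB a) F)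
    (c : V →ₗ[ℂ] F) (ψ : E →ₗ[ℂ] F) (hfin : Finite ((Mgrp a d).comap j))
    (hnormal : ∀ γ, NormalizesA (j γ) → ∀ m ∈ Mgrp a d, (j γ)⁻¹ * m * j γ ∈ Mgrp a d)
    (hsurj : ∀ w : W, ∃ γ, NormalizesA (j γ) ∧ InducesOnA (j γ) w)
    (hnorm : ∀ γ, NormalizesA (j γ) →
      ∃ w : W, InducesOnA (j γ) w ∧ ∀ v, c (ρ γ v) = R w (c v))
    (hM : ∀ γ, j γ ∈ Mgrp a d → ∀ v, c (ρ γ v) = c v)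
    (hinj : ∀ v, (∀ γ, j γ ∈ Mgrp a d → ρ γ v = v) → c v = 0 → v = 0)
    (hψ : Function.Injective ψ) (hψR : ∀ (w : W) x, ψ (σ w x) = R w (ψ x))
    (hrange : LinearMap.range ψ = LinearMap.range c) : CarriesWeylRep j ρ W σ := by
  classical
  refine ⟨hsurj, ?_⟩
  let H := (Mgrp a d).comap j
  have : Fintype H := Fintype.ofFinite _
  let I : Submodule ℂ V := Representation.invariants (ρ.comp H.subtype)
  have hI : ∀ v, v ∈ I ↔ ∀ γ, j γ ∈ Mgrp a d → ρ γ v = v := fun v =>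
    ⟨fun h γ hγ => h ⟨γ, hγ⟩, fun h γ => h γ.1 γ.2⟩
  let cI : I →ₗ[ℂ] F := c.comp I.subtype
  have cI_inj : Function.Injective cI := by
    rw [injective_iff_map_eq_zero]
    intro v hv
    exact Subtype.ext (hinj v ((hI v).1 v.2) hv)
  have : Invertible (Fintype.card H : ℂ) := invertibleOfNonzero (by simp)
  have hav : ∀ v, ∃ v' ∈ I, c v' = c v := by
    intro v
    refine ⟨_, Representation.averageMap_invariant (ρ.comp H.subtype) v, ?_⟩
    have : ∀ γ : H, c (ρ γ v) = c v := fun γ => hM _ γ.2 v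
    simp [Representation.averageMap, GroupAlgebra.average, map_sum, this, Finset.card_univ,
      ← Nat.cast_smul_eq_nsmul ℂ]
  have hmem : ∀ x, ψ x ∈ LinearMap.range cI := by
    intro x
    obtain ⟨v, hv⟩ : ψ x ∈ LinearMap.range c := hrange ▸ ⟨x, rfl⟩
    obtain ⟨v', h1, h2⟩ := hav v
    exact ⟨⟨v', h1⟩, h2.trans hv⟩
  let e : I ≃ₗ[ℂ] LinearMap.range cI := LinearEquiv.ofInjective cI cI_inj
  let Φ : E →ₗ[ℂ] V := I.subtype ∘ₗ e.symm.toLinearMap ∘ₗ (ψ.codRestrict _ hmem)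
  have hΦI : ∀ x, Φ x ∈ I := fun x => (e.symm _).2
  have hΦc : ∀ x, c (Φ x) = ψ x := by
    intro x
    have := congrArg Subtype.val (e.apply_symm_apply (ψ.codRestrict _ hmem x))
    exact this
  have uniq : ∀ v ∈ I, ∀ v' ∈ I, c v = c v' → v = v' := fun v hv v' hv' h =>
    congrArg Subtype.val (@cI_inj ⟨v, hv⟩ ⟨v', hv'⟩ h)
  refine ⟨Φ, ?_, ?_, ?_⟩
  · intro x y hxy
    apply hψ
    rw [← hΦc, ← hΦc, hxy]
  · intro v
    rw [← hI]
    constructor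
    · rintro ⟨x, rfl⟩; exact hΦI x
    · intro hv
      obtain ⟨x, hx⟩ : c v ∈ LinearMap.range ψ := hrange ▸ ⟨v, rfl⟩
      exact ⟨x, uniq _ (hΦI x) _ hv (by rw [hΦc, hx])⟩
  · intro γ hγ
    obtain ⟨w, hw, hc⟩ := hnorm γ hγ
    refine ⟨w, hw, fun x => uniq _ ?_ _ (hΦI _) ?_⟩
    · rw [hI]
      intro m hm
      have h1 : j (γ⁻¹ * m * γ) ∈ Mgrp a d := by
        rw [map_mul, map_mul, map_inv]; exact hnormal γ hγ _ hm
      have h2 := (hI _).1 (hΦI x) _ h1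
      rw [← Module.End.mul_apply, ← map_mul]
      conv_rhs => rw [← h2, ← Module.End.mul_apply, ← map_mul]
      congr 2; group
    · rw [hc, hΦc, hΦc, hψR]

/-! ### Induced representations -/

lemma IndV_mk_mul {G H A : Type*} [Group G] [Group H] [AddCommGroup A] [Module ℂ A] (φ : G →* H)
    (ρ : Representation ℂ G A) (g : G) (h : H) (x : A) :
    Representation.IndV.mk φ ρ (φ g * h) (ρ g x) = Representation.IndV.mk φ ρ h x := by
  have := Representation.Coinvariants.mk_self_apply
    (Representation.tprod ((Representation.leftRegular ℂ H).comp φ) ρ) g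
    (MonoidAlgebra.single h (1 : ℂ) ⊗ₜ[ℂ] x)
  simpa [Representation.IndV.mk] using this

/-- Frobenius reciprocity. By `IndV_mk_mul` the generator `IndV.mk h x` plays the role of `h⁻¹ · x`,
which explains the inverse in its image. -/
lemma exists_ind_lift {G H A F : Type*} [Group G] [Group H] [AddCommGroup A] [Module ℂ A]
    [AddCommGroup F] [Module ℂ F] (φ : G →* H) (ρ : Representation ℂ G A)
    (R : Representation ℂ H F) (l : A →ₗ[ℂ] F) (hl : ∀ g x, l (ρ g x) = R (φ g) (l x)) :
    ∃ ψ : Representation.IndV φ ρ →ₗ[ℂ] F,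
      (∀ h x, ψ (Representation.ind φ ρ h x) = R h (ψ x)) ∧
      ∀ h x, ψ (Representation.IndV.mk φ ρ h x) = R h⁻¹ (l x) := by
  let B : MonoidAlgebra ℂ H →ₗ[ℂ] A →ₗ[ℂ] F :=
    (Finsupp.lift (A →ₗ[ℂ] F) ℂ H fun h => R h⁻¹ ∘ₗ l) ∘ₗ
      (MonoidAlgebra.coeffLinearEquiv ℂ).toLinearMap
  have hB : ∀ h x, B (MonoidAlgebra.single h 1) x = R h⁻¹ (l x) := by
    intro h x; simp [B]
  let ψ : Representation.IndV φ ρ →ₗ[ℂ] F := Representation.Coinvariants.lift _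
    (TensorProduct.lift B) (by
      intro g
      apply TensorProduct.ext
      apply MonoidAlgebra.lhom_ext'
      intro h
      apply LinearMap.ext_ring
      ext x
      simp [hB, hl, Representation.leftRegular, Representation.ofMulAction_single])
  have hψ : ∀ h x, ψ (Representation.IndV.mk φ ρ h x) = R h⁻¹ (l x) := fun h x => by
    simp [ψ, hB]
  refine ⟨ψ, fun h x => ?_, hψ⟩
  have : ψ ∘ₗ Representation.ind φ ρ h = R h ∘ₗ ψ := by
    apply Representation.IndV.hom_ext
    intro h'
    ext x
    change ψ (Representation.ind φ ρ h (Representation.IndV.mk φ ρ h' x)) =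
      R h (ψ (Representation.IndV.mk φ ρ h' x))
    rw [Representation.ind_mk, hψ, hψ]
    simp
  exact LinearMap.congr_fun this x

lemma IndV_span {G H A : Type*} [Group G] [Group H] [AddCommGroup A] [Module ℂ A] (φ : G →* H)
    (ρ : Representation ℂ G A) :
    Submodule.span ℂ {y | ∃ h x, y = Representation.IndV.mk φ ρ h x} = ⊤ := by
  have h0 : (Submodule.span ℂ {y | ∃ h x, y = Representation.IndV.mk φ ρ h x}).mkQ = 0 := by
    apply Representation.IndV.hom_ext
    intro h
    ext x
    simp only [LinearMap.comp_apply, LinearMap.zero_apply]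
    exact (Submodule.Quotient.mk_eq_zero _).2 (Submodule.subset_span ⟨h, x, rfl⟩)
  rw [← Submodule.ker_mkQ (Submodule.span ℂ _), h0, LinearMap.ker_zero]

/-! ### Signed permutation matrices, `M` and the normalizer of `𝔞` -/

/-- The signed permutation matrix sending the basis vector `e_j` to `η (π j) e_{π j}`. -/
def signedPerm {m : ℕ} (η : Fin m → ℤˣ) (π : Equiv.Perm (Fin m)) : OO m :=
  ⟨Matrix.of fun i j => if i = π j then ((η i : ℤ) : ℝ) else 0, by
    rw [Matrix.mem_orthogonalGroup_iff']
    ext i j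
    have h : ∀ x : Fin m, ((η x : ℤ) : ℝ) * ((η x : ℤ) : ℝ) = 1 := fun x => by
      exact_mod_cast Int.units_coe_mul_self (η x)
    simp [Matrix.mul_apply, Matrix.one_apply, h, eq_comm]⟩

lemma signedPerm_apply {m : ℕ} (η : Fin m → ℤˣ) (π : Equiv.Perm (Fin m)) (i j : Fin m) :
    (signedPerm η π : Matrix (Fin m) (Fin m) ℝ) i j = if i = π j then ((η i : ℤ) : ℝ) else 0 := rfl

lemma signedPerm_mul {m : ℕ} (η η' : Fin m → ℤˣ) (π π' : Equiv.Perm (Fin m)) :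
    signedPerm η π * signedPerm η' π' = signedPerm (fun i => η i * η' (π⁻¹ i)) (π * π') := by
  apply Subtype.ext
  ext i j
  change ((signedPerm η π : Matrix (Fin m) (Fin m) ℝ) * signedPerm η' π') i j = _
  simp only [Matrix.mul_apply, signedPerm_apply, Equiv.Perm.mul_apply]
  rw [Finset.sum_eq_single (π' j)]
  · by_cases h : i = π (π' j)
    · simp [h]
    · simp [h]
  · intro l _ hl; simp [hl]
  · simp

lemma det_signedPerm {m : ℕ} (η : Fin m → ℤˣ) (π : Equiv.Perm (Fin m)) :
    (signedPerm η π : Matrix (Fin m) (Fin m) ℝ).det =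
      (((∏ i, η i) * Equiv.Perm.sign π : ℤˣ) : ℤ) := by
  have : (signedPerm η π : Matrix (Fin m) (Fin m) ℝ) =
      Matrix.diagonal (fun i => ((η i : ℤ) : ℝ)) * (π⁻¹).permMatrix ℝ := by
    ext i j
    rw [Matrix.diagonal_mul, signedPerm_apply]
    simp [PEquiv.toMatrix_apply, Equiv.Perm.permMatrix, Equiv.symm_apply_eq, Equiv.Perm.inv_def]
  rw [this, Matrix.det_mul, Matrix.det_diagonal, Matrix.det_permutation, Equiv.Perm.sign_inv]
  push_cast
  simp

/-- The columns have length one, so the only possibly nonzero entry of each is `±1`. -/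
lemma exists_signedPerm_of_support {m : ℕ} (k : OO m) (π : Equiv.Perm (Fin m))
    (h : ∀ i j, i ≠ π j → (k : Matrix (Fin m) (Fin m) ℝ) i j = 0) : ∃ η, k = signedPerm η π := by
  have h1 : (k : Matrix (Fin m) (Fin m) ℝ)ᵀ * (k : Matrix (Fin m) (Fin m) ℝ) = 1 :=
    (Matrix.mem_orthogonalGroup_iff' _ _).1 k.2
  have h2 : ∀ j, (k : Matrix (Fin m) (Fin m) ℝ) (π j) j = 1 ∨
      (k : Matrix (Fin m) (Fin m) ℝ) (π j) j = -1 := by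
    intro j
    have := congrFun (congrFun h1 j) j
    rw [Matrix.mul_apply, Finset.sum_eq_single (π j)] at this
    · simpa using mul_self_eq_one_iff.1 (by simpa using this)
    · intro i _ hi; simp [h i j hi]
    · simp
  refine ⟨fun i => if (k : Matrix (Fin m) (Fin m) ℝ) i (π⁻¹ i) = 1 then 1 else -1, ?_⟩
  apply Subtype.ext
  ext i j
  rw [signedPerm_apply]
  by_cases hij : i = π j
  · subst hij
    rcases h2 j with h3 | h3 <;> simp [h3]
    norm_num
  · simp [hij, h i j hij]

/-- The extension of a permutation of `a` letters to `a + d` letters fixing the last `d`. -/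
def extPerm {a : ℕ} (d : ℕ) (π : Equiv.Perm (Fin a)) : Equiv.Perm (Fin (a + d)) :=
  finSumFinEquiv.permCongr (Equiv.Perm.sumCongr π 1)

@[simp] lemma extPerm_castAdd {a d : ℕ} (π : Equiv.Perm (Fin a)) (i : Fin a) :
    extPerm d π (Fin.castAdd d i) = Fin.castAdd d (π i) := by
  simp [extPerm, Equiv.permCongr_apply]

@[simp] lemma extPerm_natAdd {a d : ℕ} (π : Equiv.Perm (Fin a)) (i : Fin d) :
    extPerm d π (Fin.natAdd a i) = Fin.natAdd a i := by
  simp [extPerm, Equiv.permCongr_apply]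

@[simp] lemma extPerm_one {a d : ℕ} : extPerm d (1 : Equiv.Perm (Fin a)) = 1 := by
  ext i
  refine Fin.addCases (fun i => ?_) (fun i => ?_) i <;> simp

@[simp] lemma extPerm_inv {a d : ℕ} (π : Equiv.Perm (Fin a)) :
    (extPerm d π)⁻¹ = extPerm d π⁻¹ := by
  rw [inv_eq_iff_mul_eq_one]
  ext i
  refine Fin.addCases (fun i => ?_) (fun i => ?_) i <;> simp

@[simp] lemma sign_extPerm {a d : ℕ} (π : Equiv.Perm (Fin a)) :
    Equiv.Perm.sign (extPerm d π) = Equiv.Perm.sign π := by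
  simp [extPerm]

lemma det_blockMat {a d : ℕ} (k : KK a d) : (blockMat k).det =
    (k.1 : Matrix (Fin (a + d)) (Fin (a + d)) ℝ).det * (k.2 : Matrix (Fin a) (Fin a) ℝ).det := by
  simp [blockMat]

lemma intertwines_iff {a d : ℕ} (k : KK a d) (x y : Fin a → ℝ) :
    blockMat k * aMat a d x = aMat a d y * blockMat k ↔
      (∀ i j, k.1.1 (Fin.castAdd d i) (Fin.castAdd d j) * x j = y i * k.2.1 i j) ∧
      (∀ i j, k.1.1 (Fin.natAdd a i) (Fin.castAdd d j) * x j = 0) ∧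
      (∀ i j, k.2.1 i j * x j = y i * k.1.1 (Fin.castAdd d i) (Fin.castAdd d j)) ∧
      (∀ i l, y i * k.1.1 (Fin.castAdd d i) (Fin.natAdd a l) = 0) := by
  have hne : ∀ (i : Fin d) (j : Fin a), Fin.natAdd a i ≠ Fin.castAdd d j := by
    intro i j h
    have := congrArg Fin.val h
    simp at this; omega
  have hne' : ∀ (i : Fin d) (j : Fin a), Fin.castAdd d j ≠ Fin.natAdd a i :=
    fun i j => (hne i j).symm
  have e1 : ∀ i j, ((k.1 : Matrix (Fin (a + d)) (Fin (a + d)) ℝ) *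
      (Matrix.of fun i j => if i = Fin.castAdd d j then x j else 0)) i j =
      k.1.1 i (Fin.castAdd d j) * x j := by
    intro i j; simp [Matrix.mul_apply]
  have e2 : ∀ i j, ((Matrix.of fun (i : Fin (a + d)) (j : Fin a) =>
      if i = Fin.castAdd d j then y j else 0) *
      (k.2 : Matrix (Fin a) (Fin a) ℝ)) (Fin.castAdd d i) j = y i * k.2.1 i j := by
    intro i j; simp [Matrix.mul_apply, (Fin.castAdd_injective a d).eq_iff]
  have e3 : ∀ i j, ((Matrix.of fun (i : Fin (a + d)) (j : Fin a) =>
      if i = Fin.castAdd d j then y j else 0) *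
      (k.2 : Matrix (Fin a) (Fin a) ℝ)) (Fin.natAdd a i) j = 0 := by
    intro i j; simp [Matrix.mul_apply, hne]
  have e4 : ∀ i j, ((k.2 : Matrix (Fin a) (Fin a) ℝ) *
      (Matrix.of fun (j : Fin a) (i : Fin (a + d)) => if i = Fin.castAdd d j then x j else 0))
      i (Fin.castAdd d j) = k.2.1 i j * x j := by
    intro i j; simp [Matrix.mul_apply, (Fin.castAdd_injective a d).eq_iff]
  have e5 : ∀ i j, ((k.2 : Matrix (Fin a) (Fin a) ℝ) *
      (Matrix.of fun (j : Fin a) (i : Fin (a + d)) => if i = Fin.castAdd d j then x j else 0))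
      i (Fin.natAdd a j) = 0 := by
    intro i j; simp [Matrix.mul_apply, hne]
  have e6 : ∀ i j, ((Matrix.of fun (j : Fin a) (i : Fin (a + d)) =>
      if i = Fin.castAdd d j then y j else 0) * (k.1 : Matrix (Fin (a + d)) (Fin (a + d)) ℝ))
      i j = y i * k.1.1 (Fin.castAdd d i) j := by
    intro i j; simp [Matrix.mul_apply]
  rw [blockMat, aMat, aMat, Matrix.fromBlocks_multiply, Matrix.fromBlocks_multiply,
    Matrix.fromBlocks_inj]
  simp only [Matrix.mul_zero, Matrix.zero_mul, add_zero, zero_add, true_and, and_true]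
  constructor
  · rintro ⟨h1, h2⟩
    refine ⟨fun i j => ?_, fun i j => ?_, fun i j => ?_, fun i l => ?_⟩
    · rw [← e1, h1, e2]
    · rw [← e1, h1, e3]
    · rw [← e4, h2, e6]
    · rw [← e6, ← h2, e5]
  · rintro ⟨h1, h2, h3, h4⟩
    constructor
    · ext i j
      refine Fin.addCases (fun i => ?_) (fun i => ?_) i
      · rw [e1, e2, h1]
      · rw [e1, e3, h2]
    · ext i j
      refine Fin.addCases (fun j => ?_) (fun j => ?_) j
      · rw [e4, e6, h3]
      · rw [e5, e6, h4]

/-- The signed permutation matrices of `K` with the same underlying permutation of `a` letters. -/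
def signedPair {a d : ℕ} (η : Fin (a + d) → ℤˣ) (ε : Fin a → ℤˣ) (π : Equiv.Perm (Fin a)) :
    KK a d :=
  (signedPerm η (extPerm d π), signedPerm ε π)

lemma inducesOnA_signedPair {a d : ℕ} (η : Fin (a + d) → ℤˣ) (ε : Fin a → ℤˣ)
    (π : Equiv.Perm (Fin a)) :
    InducesOnA (signedPair η ε π) ⟨fun i => η (Fin.castAdd d i) * ε i, π⟩ := by
  intro x
  have hne : ∀ (i : Fin d) (j : Fin a), Fin.natAdd a i ≠ Fin.castAdd d j := by
    intro i j h
    have := congrArg Fin.val h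
    simp at this; omega
  have hs : ∀ u : ℤˣ, ((u : ℤ) : ℝ) * ((u : ℤ) : ℝ) = 1 := fun u => by
    exact_mod_cast Int.units_coe_mul_self u
  rw [intertwines_iff]
  refine ⟨fun i j => ?_, fun i j => ?_, fun i j => ?_, fun i j => ?_⟩
  · change (signedPerm η (extPerm d π)).1 _ _ * _ = _ * (signedPerm ε π).1 _ _
    simp only [signedPerm_apply, extPerm_castAdd, (Fin.castAdd_injective a d).eq_iff]
    by_cases h : i = π j
    · subst h
      simp only [WB.act, if_true, Units.val_mul, Int.cast_mul,
        show π⁻¹ (π j) = j from π.symm_apply_apply j]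
      linear_combination (-((η (Fin.castAdd d (π j)) : ℤ) : ℝ) * x j) * hs (ε (π j))
    · simp [h]
  · change (signedPerm η (extPerm d π)).1 _ _ * _ = _
    simp [signedPerm_apply, hne]
  · change (signedPerm ε π).1 _ _ * _ = _ * (signedPerm η (extPerm d π)).1 _ _
    simp only [signedPerm_apply, extPerm_castAdd, (Fin.castAdd_injective a d).eq_iff]
    by_cases h : i = π j
    · subst h
      simp only [WB.act, if_true, Units.val_mul, Int.cast_mul,
        show π⁻¹ (π j) = j from π.symm_apply_apply j]
      linear_combination (-((ε (π j) : ℤ) : ℝ) * x j) * hs (η (Fin.castAdd d (π j)))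
    · simp [h]
  · change _ * (signedPerm η (extPerm d π)).1 _ _ = _
    simp [signedPerm_apply, (hne _ _).symm]

lemma det_signedPair {a d : ℕ} (η : Fin (a + d) → ℤˣ) (ε : Fin a → ℤˣ)
    (π : Equiv.Perm (Fin a)) :
    (blockMat (signedPair η ε π)).det = (((∏ i, η i) * ∏ i, ε i : ℤˣ) : ℤ) := by
  have hs : ((Equiv.Perm.sign π : ℤ) : ℝ) * ((Equiv.Perm.sign π : ℤ) : ℝ) = 1 := by
    exact_mod_cast Int.units_coe_mul_self _
  rw [det_blockMat]
  change (signedPerm η (extPerm d π)).1.det * (signedPerm ε π).1.det = _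
  rw [det_signedPerm, det_signedPerm, sign_extPerm]
  simp only [Units.val_mul, Int.cast_mul]
  linear_combination (((∏ i, η i : ℤˣ) : ℤ) : ℝ) * (((∏ i, ε i : ℤˣ) : ℤ) : ℝ) * hs

lemma intCast_units_eq_one {u : ℤˣ} : ((u : ℤ) : ℝ) = 1 ↔ u = 1 := by
  rcases Int.units_eq_one_or u with rfl | rfl
  · simp
  · norm_num

lemma normalizesA_signedPair_iff {a d : ℕ} (η : Fin (a + d) → ℤˣ) (ε : Fin a → ℤˣ)
    (π : Equiv.Perm (Fin a)) :
    NormalizesA (signedPair η ε π) ↔ (∏ i, η i) * ∏ i, ε i = 1 := by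
  rw [NormalizesA, det_signedPair, intCast_units_eq_one]
  exact and_iff_left fun x => ⟨_, inducesOnA_signedPair η ε π x⟩

/-- The relation is tested on the regular element with coordinates `1, 2, …, a`, positive and
distinct. The bound `d ≤ 1` leaves at most one entry in the corner block of the first factor, which
then needs no argument. -/
lemma exists_signedPair_of_normalizesA {a d : ℕ} (hd : d ≤ 1) (k : KK a d) (hk : NormalizesA k) :
    ∃ η ε π, k = signedPair η ε π := by
  obtain ⟨-, hk⟩ := hk
  obtain ⟨y, hy⟩ := hk fun j => (j.val : ℝ) + 1
  rw [intertwines_iff] at hy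
  obtain ⟨hA, hB, hC, hD⟩ := hy
  have hx : ∀ j : Fin a, (0 : ℝ) < (j.val : ℝ) + 1 := fun j => by positivity
  have hrow : ∀ i, ∃ j, k.2.1 i j ≠ 0 := by
    intro i
    by_contra! h
    have h1 := congrFun (congrFun ((Matrix.mem_orthogonalGroup_iff _ _).1 k.2.2) i) i
    simp [Matrix.mul_apply, h] at h1
  have hcol : ∀ j, ∃ i, k.2.1 i j ≠ 0 := by
    intro j
    by_contra! h
    have h1 := congrFun (congrFun ((Matrix.mem_orthogonalGroup_iff' _ _).1 k.2.2) j) j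
    simp [Matrix.mul_apply, h] at h1
  -- Both off-diagonal blocks together give `D_ij x_j² = y_i² D_ij` for `D = k.2`. Hence a row of
  -- `D` has its nonzero entries only in the one column with `x_j² = y_i²`.
  have hsq : ∀ i j, k.2.1 i j ≠ 0 → ((j.val : ℝ) + 1) ^ 2 = y i ^ 2 := by
    intro i j h
    apply mul_left_cancel₀ h
    linear_combination ((j.val : ℝ) + 1) * hC i j + y i * hA i j
  choose r hr using hrow
  have hr' : ∀ i j, k.2.1 i j ≠ 0 → j = r i := by
    intro i j h
    have h1 := (hsq i j h).trans (hsq i _ (hr i)).symm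
    rw [sq_eq_sq₀ (hx _).le (hx _).le] at h1
    exact Fin.ext (by exact_mod_cast add_right_cancel h1)
  have hy0 : ∀ i, y i ≠ 0 := by
    intro i h
    have h1 := hsq i _ (hr i)
    rw [h] at h1
    have := hx (r i)
    nlinarith
  have hbij : Function.Bijective r := by
    rw [← Finite.surjective_iff_bijective]
    intro j
    obtain ⟨i, hi⟩ := hcol j
    exact ⟨i, (hr' i j hi).symm⟩
  let π : Equiv.Perm (Fin a) := (Equiv.ofBijective r hbij)⁻¹
  have hπ : ∀ i j, i = π j ↔ j = r i := by
    intro i j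
    rw [Equiv.Perm.eq_inv_iff_eq]
    exact eq_comm
  obtain ⟨ε, hε⟩ := exists_signedPerm_of_support k.2 π (by
    intro i j hij
    by_contra h
    exact hij ((hπ i j).2 (hr' i j h)))
  obtain ⟨η, hη⟩ := exists_signedPerm_of_support k.1 (extPerm d π) (by
    intro i j
    refine Fin.addCases (fun i => ?_) (fun i => ?_) i <;>
      refine Fin.addCases (fun j => ?_) (fun j => ?_) j
    · rw [extPerm_castAdd, Ne, (Fin.castAdd_injective a d).eq_iff, hπ]
      intro h
      have h1 : k.2.1 i j = 0 := by
        by_contra h2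
        exact h (hr' _ _ h2)
      have h2 := hA i j
      rw [h1, mul_zero, mul_eq_zero] at h2
      exact h2.resolve_right (hx j).ne'
    · intro _
      exact (mul_eq_zero.1 (hD i j)).resolve_left (hy0 i)
    · intro _
      exact (mul_eq_zero.1 (hB i j)).resolve_right (hx j).ne'
    · rw [extPerm_natAdd]
      intro h
      exact absurd (by congr 1; ext; omega) h)
  exact ⟨η, ε, π, Prod.ext hη hε⟩

lemma coe_kEmb {a d : ℕ} (k : KK a d) :
    ((kEmb a d k : GL (Idx a d) ℝ) : Matrix (Idx a d) (Idx a d) ℝ) = blockMat k := rfl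

/-- The element of `M` with diagonal entries `ε`. -/
def diagM {a : ℕ} (d : ℕ) (ε : Fin a → ℤˣ) : KK a d :=
  signedPair (Fin.append ε 1) ε 1

lemma blockMat_mulVec_isoVector {a d : ℕ} (k : KK a d) (j : Fin a) (i : Idx a d) :
    (blockMat k *ᵥ isoVector a d j) i =
      Sum.elim (fun i => k.1.1 i (Fin.castAdd d j)) (fun i => k.2.1 i j) i := by
  rcases i with i | i <;>
    simp [isoVector, Matrix.mulVec_add, blockMat]

lemma mem_isoFlag_apply {a d : ℕ} (j : Fin a) (u : Idx a d → ℝ) (hu : u ∈ isoFlag a d j) :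
    (∀ i, u (Sum.inl (Fin.castAdd d i)) = u (Sum.inr i)) ∧
    (∀ i, j < i → u (Sum.inr i) = 0) ∧ ∀ i, u (Sum.inl (Fin.natAdd a i)) = 0 := by
  have hne : ∀ (i : Fin d) (j : Fin a), Fin.natAdd a i ≠ Fin.castAdd d j := by
    intro i j h
    have := congrArg Fin.val h
    simp at this; omega
  induction hu using Submodule.span_induction with
  | mem x hx =>
    obtain ⟨l, hl, rfl⟩ := hx
    refine ⟨fun i => ?_, fun i hi => ?_, fun i => ?_⟩
    · simp [isoVector, Pi.single_apply, (Fin.castAdd_injective a d).eq_iff]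
    · have : i ≠ l := by rintro rfl; exact absurd hi (not_lt.2 hl)
      simp [isoVector, this]
    · simp [isoVector, hne]
  | zero => simp
  | add x y _ _ hx hy =>
    refine ⟨fun i => ?_, fun i hi => ?_, fun i => ?_⟩
    · simp [hx.1 i, hy.1 i]
    · simp [hx.2.1 i hi, hy.2.1 i hi]
    · simp [hx.2.2 i, hy.2.2 i]
  | smul c x _ hx =>
    refine ⟨fun i => ?_, fun i hi => ?_, fun i => ?_⟩
    · simp [hx.1 i]
    · simp [hx.2.1 i hi]
    · simp [hx.2.2 i]

lemma diagM_mem {a d : ℕ} (ε : Fin a → ℤˣ) : diagM d ε ∈ Mgrp a d := by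
  have hs : ∀ u : ℤˣ, ((u : ℤ) : ℝ) * ((u : ℤ) : ℝ) = 1 := fun u => by
    exact_mod_cast Int.units_coe_mul_self u
  have hv : ∀ i, blockMat (diagM d ε) *ᵥ isoVector a d i =
      ((ε i : ℤ) : ℝ) • isoVector a d i := by
    intro j
    have hne : ∀ (i : Fin d) (j : Fin a), Fin.natAdd a i ≠ Fin.castAdd d j := by
      intro i j h
      have := congrArg Fin.val h
      simp at this; omega
    ext i
    rw [blockMat_mulVec_isoVector]
    rcases i with i | i
    · refine Fin.addCases (fun i => ?_) (fun i => ?_) i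
      · by_cases h : i = j <;>
        simp [diagM, signedPair, signedPerm_apply, isoVector, h,
          (Fin.castAdd_injective a d).eq_iff]
      · simp [diagM, signedPair, signedPerm_apply, isoVector, hne]
    · by_cases h : i = j <;>
        simp [diagM, signedPair, signedPerm_apply, isoVector, h]
  change kEmb a d _ ∈ borelSub a d
  refine ⟨?_, fun j => ?_⟩
  · rw [coe_kEmb, diagM, det_signedPair, intCast_units_eq_one, Fin.prod_univ_add]
    simp [← sq]
  · rw [coe_kEmb, isoFlag, Submodule.map_span]
    apply le_antisymm
    · rw [Submodule.span_le]
      rintro _ ⟨_, ⟨i, hi, rfl⟩, rfl⟩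
      rw [Matrix.mulVecLin_apply, hv]
      exact Submodule.smul_mem _ _ (Submodule.subset_span ⟨i, hi, rfl⟩)
    · rw [Submodule.span_le]
      rintro _ ⟨i, hi, rfl⟩
      have : isoVector a d i =
          ((ε i : ℤ) : ℝ) • Matrix.mulVecLin (blockMat (diagM d ε)) (isoVector a d i) := by
        rw [Matrix.mulVecLin_apply, hv, smul_smul, hs, one_smul]
      rw [this]
      exact Submodule.smul_mem _ _ (Submodule.subset_span ⟨_, ⟨i, hi, rfl⟩, rfl⟩)

lemma mem_Mgrp_iff {a d : ℕ} (hd : d ≤ 1) (k : KK a d) :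
    k ∈ Mgrp a d ↔ ∃ ε, k = diagM d ε := by
  refine ⟨fun h => ?_, ?_⟩
  · obtain ⟨hdet, hflag⟩ : kEmb a d k ∈ borelSub a d := h
    rw [coe_kEmb] at hdet
    have hmem : ∀ j, blockMat k *ᵥ isoVector a d j ∈ isoFlag a d j := by
      intro j
      rw [← hflag j]
      exact ⟨_, Submodule.subset_span ⟨j, le_refl j, rfl⟩, rfl⟩
    have h1 : ∀ i j, k.1.1 (Fin.castAdd d i) (Fin.castAdd d j) = k.2.1 i j := by
      intro i j
      have := (mem_isoFlag_apply j _ (hmem j)).1 i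
      rwa [blockMat_mulVec_isoVector, blockMat_mulVec_isoVector] at this
    have h2 : ∀ i j, j < i → k.2.1 i j = 0 := by
      intro i j hij
      have := (mem_isoFlag_apply j _ (hmem j)).2.1 i hij
      rwa [blockMat_mulVec_isoVector] at this
    have h3 : ∀ i j, k.1.1 (Fin.natAdd a i) (Fin.castAdd d j) = 0 := by
      intro i j
      have := (mem_isoFlag_apply j _ (hmem j)).2.2 i
      rwa [blockMat_mulVec_isoVector] at this
    -- The inverse of a triangular matrix is triangular of the same type; here it is the transpose,
    -- so `k.2` is diagonal.
    have h4 : ∀ i j, i < j → k.2.1 i j = 0 := by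
      have hinv : k.2.1⁻¹ = k.2.1ᵀ := by
        apply Matrix.inv_eq_right_inv
        exact (Matrix.mem_orthogonalGroup_iff _ _).1 k.2.2
      let _ : Invertible k.2.1 := invertibleOfRightInverse _ _
        ((Matrix.mem_orthogonalGroup_iff _ _).1 k.2.2)
      have hb : Matrix.BlockTriangular k.2.1 id := fun i j hij => h2 i j hij
      have hb' := Matrix.blockTriangular_inv_of_blockTriangular hb
      rw [hinv] at hb'
      exact fun i j hij => hb' hij
    obtain ⟨ε, hε⟩ := exists_signedPerm_of_support k.2 1 (by
      intro i j hij
      rcases lt_or_gt_of_ne hij with h | h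
      · exact h4 i j h
      · exact h2 i j h)
    have hε' : ∀ i, k.2.1 i i = ((ε i : ℤ) : ℝ) := by
      intro i; rw [hε, signedPerm_apply]; simp
    have h5 : ∀ i l, k.1.1 (Fin.castAdd d i) (Fin.natAdd a l) = 0 := by
      intro i l
      have := congrFun (congrFun ((Matrix.mem_orthogonalGroup_iff' _ _).1 k.1.2)
        (Fin.castAdd d i)) (Fin.natAdd a l)
      rw [Matrix.mul_apply, Fin.sum_univ_add] at this
      have hne : Fin.castAdd d i ≠ Fin.natAdd a l := by
        intro h
        have := congrArg Fin.val h
        simp at this; omega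
      simp only [Matrix.transpose_apply, h3, zero_mul, Finset.sum_const_zero, add_zero, h1,
        Matrix.one_apply_ne hne] at this
      rw [Finset.sum_eq_single i, hε'] at this
      · refine (mul_eq_zero.1 this).resolve_left (by simp)
      · intro j _ hj
        rcases lt_or_gt_of_ne hj with h | h
        · rw [h4 j i h, zero_mul]
        · rw [h2 j i h, zero_mul]
      · simp
    obtain ⟨η, hη⟩ := exists_signedPerm_of_support k.1 1 (by
      intro i j
      refine Fin.addCases (fun i => ?_) (fun i => ?_) i <;>
        refine Fin.addCases (fun j => ?_) (fun j => ?_) j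
      · intro hij
        rw [h1]
        have hij : i ≠ j := by rintro rfl; exact hij rfl
        rcases lt_or_gt_of_ne hij with h | h
        · exact h4 i j h
        · exact h2 i j h
      · exact fun _ => h5 _ _
      · exact fun _ => h3 _ _
      · intro h
        exact absurd (by simp only [Equiv.Perm.one_apply]; congr 1; ext; omega) h)
    have hk : k = signedPair η ε 1 := Prod.ext (by rw [hη]; simp [signedPair]) hε
    have hηε : ∀ i, η (Fin.castAdd d i) = ε i := by
      intro i
      have := h1 i i
      rw [hε', hη, signedPerm_apply] at this
      simp only [Equiv.Perm.one_apply, if_true] at this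
      exact Units.ext (by exact_mod_cast this)
    refine ⟨ε, ?_⟩
    rw [hk, diagM]
    congr 1
    -- The signs on the `e_i` and `f_i` cancel in the determinant, so for `d = 1` determinant one
    -- forces the sign `1` at the extra basis vector.
    rw [hk, det_signedPair, intCast_units_eq_one, Fin.prod_univ_add] at hdet
    simp only [hηε] at hdet
    rw [mul_right_comm, ← Finset.prod_mul_distrib] at hdet
    simp only [Int.units_mul_self, Finset.prod_const_one, one_mul] at hdet
    ext i
    refine Fin.addCases (fun i => ?_) (fun i => ?_) i
    · rw [Fin.append_left, hηε]
    · rw [Fin.append_right]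
      have : d = 1 := by have := i.pos; omega
      subst this
      rw [Fin.prod_univ_one] at hdet
      rw [Subsingleton.elim i 0, hdet]; rfl
  · rintro ⟨ε, rfl⟩; exact diagM_mem ε

lemma conj_mem_Mgrp {a d : ℕ} (hd : d ≤ 1) (k : KK a d) (hk : NormalizesA k) (m : KK a d)
    (hm : m ∈ Mgrp a d) : k⁻¹ * m * k ∈ Mgrp a d := by
  obtain ⟨η, ε, π, rfl⟩ := exists_signedPair_of_normalizesA hd k hk
  obtain ⟨δ, rfl⟩ := (mem_Mgrp_iff hd m).1 hm
  rw [mem_Mgrp_iff hd]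
  refine ⟨fun i => δ (π i), ?_⟩
  rw [mul_assoc, inv_mul_eq_iff_eq_mul]
  refine Prod.ext ?_ ?_
  · simp only [diagM, signedPair, Prod.fst_mul, signedPerm_mul, extPerm_one, mul_one, one_mul,
      inv_one, extPerm_inv, Equiv.Perm.one_apply]
    congr 1
    ext i
    refine Fin.addCases (fun i => ?_) (fun i => ?_) i <;> simp [mul_comm]
  · simp only [diagM, signedPair, Prod.snd_mul, signedPerm_mul, mul_one, one_mul,
      inv_one, Equiv.Perm.one_apply]
    congr 1
    ext i
    simp [mul_comm]

lemma finite_Mgrp_comap {a d : ℕ} (hd : d ≤ 1) {Γ : Type*} [Group Γ] (j : Γ →* KK a d)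
    (hj : Function.Injective j) : Finite ((Mgrp a d).comap j) := by
  have h : ((Mgrp a d : Set (KK a d))).Finite := by
    apply (Set.finite_range (diagM (a := a) d)).subset
    intro k hk
    obtain ⟨ε, rfl⟩ := (mem_Mgrp_iff hd k).1 hk
    exact ⟨ε, rfl⟩
  exact (h.preimage hj.injOn).to_subtype

/-- Such signs turn a permutation matrix into a matrix of determinant one. -/
lemma exists_prod_eq {a : ℕ} (π : Equiv.Perm (Fin a)) :
    ∃ τ : Fin a → ℤˣ, ∏ i, τ i = Equiv.Perm.sign π := by
  cases a with
  | zero => exact ⟨1, by simp [Subsingleton.elim π 1]⟩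
  | succ a => exact ⟨Fin.cons (Equiv.Perm.sign π) 1, by simp [Fin.prod_univ_succ]⟩

/-- Every element of `W(D_a)` for `d = 0`, and of `W(B_a)` for `d = 1`, is induced by an element
of `SO(a+d) × SO(a)`. -/
lemma exists_induces {a d : ℕ} {Γ : Type*} [Group Γ] (j : Γ →* KK a d)
    (hj : ∀ k : KK a d, k.1.1.det = 1 → k.2.1.det = 1 → ∃ γ, j γ = k) (w : WB a)
    (hw : d = 0 ∧ w ∈ WD a ∨ d = 1) : ∃ γ, NormalizesA (j γ) ∧ InducesOnA (j γ) w := by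
  obtain ⟨τ, hτ⟩ := exists_prod_eq w.right
  have hτ' : (∏ i, τ i) * Equiv.Perm.sign w.right = 1 := by rw [hτ]; exact Int.units_mul_self _
  -- The signs `τ` are put on both factors: they correct the determinants and cancel in the action
  -- on `𝔞`. The product of the signs of `w` is absorbed by the extra coordinate if `d = 1` and is
  -- trivial on `W(D_a)` if `d = 0`.
  have hη : ∏ i, Fin.append (n := d) (fun i => w.left i * τ i) (fun _ => signProd a w) i =
      ∏ i, τ i := by
    rw [Fin.prod_univ_add]
    simp only [Fin.append_left, Fin.append_right, Finset.prod_mul_distrib]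
    have h1 : signProd a w = ∏ i, w.left i := rfl
    rcases hw with ⟨rfl, hw⟩ | rfl
    · have : signProd a w = 1 := hw
      rw [← h1, this]; simp
    · rw [h1]; simp only [Finset.prod_const, Finset.card_univ, Fintype.card_fin, pow_one]
      rw [mul_right_comm, Int.units_mul_self, one_mul]
  let k : KK a d := signedPair
    (Fin.append (n := d) (fun i => w.left i * τ i) (fun _ => signProd a w)) τ w.right
  obtain ⟨γ, hγ⟩ := hj k
    (by change (signedPerm _ _).1.det = 1
        rw [det_signedPerm, sign_extPerm, hη, hτ', intCast_units_eq_one])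
    (by change (signedPerm _ _).1.det = 1
        rw [det_signedPerm, hτ', intCast_units_eq_one])
  refine ⟨γ, ?_⟩
  rw [hγ]
  refine ⟨?_, ?_⟩
  · rw [normalizesA_signedPair_iff, hη, Int.units_mul_self]
  · have := inducesOnA_signedPair
      (Fin.append (n := d) (fun i => w.left i * τ i) (fun _ => signProd a w)) τ w.right
    have h2 : (⟨fun i => Fin.append (n := d) (fun i => w.left i * τ i) (fun _ => signProd a w)
        (Fin.castAdd d i) * τ i, w.right⟩ : WB a) = w := by
      ext i
      · simp [mul_assoc]
      · rfl
    rwa [h2] at this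

/-! ### Minors as functionals on exterior powers -/

/-- The Plücker coordinate attached to the tuple of indices `f`. -/
def minor {m r : ℕ} (f : Fin r → Fin m) : ⋀[ℂ]^r (Fin m → ℂ) →ₗ[ℂ] ℂ :=
  exteriorPower.alternatingMapLinearEquiv
    ((Matrix.detRowAlternating (n := Fin r) (R := ℂ)).compLinearMap (LinearMap.funLeft ℂ ℂ f))

lemma minor_ιMulti {m r : ℕ} (f : Fin r → Fin m) (v : Fin r → Fin m → ℂ) :
    minor f (exteriorPower.ιMulti ℂ r v) = (Matrix.of fun i j => v i (f j)).det := by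
  rw [minor, exteriorPower.alternatingMapLinearEquiv_apply_ιMulti]
  rfl

lemma minor_comp_perm {m r : ℕ} (f : Fin r → Fin m) (σ : Equiv.Perm (Fin r))
    (x : ⋀[ℂ]^r (Fin m → ℂ)) :
    minor (f ∘ σ) x = ((Equiv.Perm.sign σ : ℤ) : ℂ) * minor f x := by
  have : minor (f ∘ σ) = ((Equiv.Perm.sign σ : ℤ) : ℂ) • minor f := by
    apply exteriorPower.linearMap_ext
    ext v
    simp only [LinearMap.compAlternatingMap_apply, LinearMap.smul_apply, minor_ιMulti, smul_eq_mul]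
    rw [← Matrix.det_permute']
    rfl
  rw [this]; rfl

lemma minor_eq_zero {m r : ℕ} (f : Fin r → Fin m) (hf : ¬ Function.Injective f)
    (x : ⋀[ℂ]^r (Fin m → ℂ)) : minor f x = 0 := by
  have : minor f = 0 := by
    apply exteriorPower.linearMap_ext
    ext v
    simp only [LinearMap.compAlternatingMap_apply, LinearMap.zero_apply, minor_ιMulti]
    simp only [Function.Injective, not_forall] at hf
    obtain ⟨i, j, h, hne⟩ := hf
    exact Matrix.det_zero_of_column_eq hne fun l => by simp [h]
  rw [this]; rfl

/-- The minors with increasing indices are the coordinates in the standard basis; hence the minors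
separate vectors. -/
lemma basisFun_exteriorPower_repr {m r : ℕ} (x : ⋀[ℂ]^r (Fin m → ℂ))
    (s : Set.powersetCard (Fin m) r) :
    ((Pi.basisFun ℂ (Fin m)).exteriorPower r).repr x s =
      minor (Set.powersetCard.ofFinEmbEquiv.symm s) x := by
  rw [exteriorPower.basis_repr_apply]
  have : exteriorPower.ιMultiDual ℂ r (Pi.basisFun ℂ (Fin m)) s =
      minor (Set.powersetCard.ofFinEmbEquiv.symm s) := by
    apply exteriorPower.linearMap_ext
    ext v
    simp [minor_ιMulti]
  rw [this]

lemma signedPerm_mulVec {m : ℕ} (η : Fin m → ℤˣ) (π : Equiv.Perm (Fin m)) (v : Fin m → ℂ)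
    (i : Fin m) :
    ((signedPerm η π : Matrix (Fin m) (Fin m) ℝ).map (algebraMap ℝ ℂ) *ᵥ v) i =
      ((η i : ℤ) : ℂ) * v (π⁻¹ i) := by
  have h : ∀ j, i = π j ↔ j = π⁻¹ i := fun j => by
    rw [Equiv.Perm.eq_inv_iff_eq]; exact eq_comm
  simp [Matrix.mulVec, dotProduct, signedPerm_apply, h, apply_ite]

lemma extPowRep_ιMulti {m r : ℕ} (g : OO m) (v : Fin r → Fin m → ℂ) :
    extPowRep m r g (exteriorPower.ιMulti ℂ r v) = exteriorPower.ιMulti ℂ r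
      fun i => (g : Matrix (Fin m) (Fin m) ℝ).map (algebraMap ℝ ℂ) *ᵥ v i := by
  change exteriorPower.map r _ _ = _
  rw [exteriorPower.map_apply_ιMulti]
  rfl

lemma minor_signedPerm {m r : ℕ} (f : Fin r → Fin m) (η : Fin m → ℤˣ)
    (π : Equiv.Perm (Fin m)) (x : ⋀[ℂ]^r (Fin m → ℂ)) :
    minor f (extPowRep m r (signedPerm η π) x) =
      (∏ j, ((η (f j) : ℤ) : ℂ)) * minor (fun j => π⁻¹ (f j)) x := by
  have : minor f ∘ₗ extPowRep m r (signedPerm η π) =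
      (∏ j, ((η (f j) : ℤ) : ℂ)) • minor (fun j => π⁻¹ (f j)) := by
    apply exteriorPower.linearMap_ext
    ext v
    simp only [LinearMap.compAlternatingMap_apply, LinearMap.smul_apply, LinearMap.comp_apply,
      extPowRep_ιMulti, minor_ιMulti, smul_eq_mul, signedPerm_mulVec]
    rw [← Matrix.det_mul_row]
    rfl
  exact LinearMap.congr_fun this x

/-- The Plücker coordinates of `⋀^q ⊗ ⋀^k`. -/
def minor₂ {m n q k : ℕ} (f : Fin q → Fin m) (g : Fin k → Fin n) :
    (⋀[ℂ]^q (Fin m → ℂ)) ⊗[ℂ] (⋀[ℂ]^k (Fin n → ℂ)) →ₗ[ℂ] ℂ :=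
  LinearMap.mul' ℂ ℂ ∘ₗ TensorProduct.map (minor f) (minor g)

lemma minor₂_tmul {m n q k : ℕ} (f : Fin q → Fin m) (g : Fin k → Fin n)
    (x : ⋀[ℂ]^q (Fin m → ℂ)) (y : ⋀[ℂ]^k (Fin n → ℂ)) :
    minor₂ f g (x ⊗ₜ y) = minor f x * minor g y := by
  simp [minor₂]

lemma minor₂_separates {m n q k : ℕ} (x : (⋀[ℂ]^q (Fin m → ℂ)) ⊗[ℂ] (⋀[ℂ]^k (Fin n → ℂ)))
    (h : ∀ f g, Function.Injective f → Function.Injective g → minor₂ f g x = 0) : x = 0 := by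
  let b := ((Pi.basisFun ℂ (Fin m)).exteriorPower q).tensorProduct
    ((Pi.basisFun ℂ (Fin n)).exteriorPower k)
  apply b.ext_elem
  rintro ⟨s, t⟩
  have : b.coord (s, t) = minor₂ (Set.powersetCard.ofFinEmbEquiv.symm s)
      (Set.powersetCard.ofFinEmbEquiv.symm t) := by
    apply TensorProduct.ext'
    intro x y
    rw [minor₂_tmul, ← basisFun_exteriorPower_repr, ← basisFun_exteriorPower_repr]
    simp [b, mul_comm]
  rw [← Module.Basis.coord_apply, this, map_zero, Finsupp.zero_apply]
  exact h _ _ (Set.powersetCard.ofFinEmbEquiv.symm s).injective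
    (Set.powersetCard.ofFinEmbEquiv.symm t).injective

/-! ### Weight vectors -/

lemma weightVector_sum {m j : ℕ} (h : 2 * j + 1 < m) (s : ℤˣ) (v : Fin m → ℂ) :
    ∑ t, v t * weightVector m j s t = v ⟨2 * j, by omega⟩ +
      ((s : ℤ) : ℂ) * Complex.I * v ⟨2 * j + 1, h⟩ := by
  have h1 : ∀ t : Fin m, v t * weightVector m j s t =
      (if t = ⟨2 * j, by omega⟩ then v t else 0) +
      (if t = ⟨2 * j + 1, h⟩ then ((s : ℤ) : ℂ) * Complex.I * v t else 0) := by
    intro t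
    simp only [weightVector, Fin.ext_iff]
    by_cases h1 : t.val = 2 * j
    · simp [h1]
    · by_cases h2 : t.val = 2 * j + 1
      · simp [h2]; ring
      · simp [h1, h2]
  simp [h1, Finset.sum_add_distrib]

/-- On the coordinates of even index the weight vectors become the standard basis. The sign `s`
enters only at odd indices. -/
lemma minor_hwWedge_even {m r : ℕ} (f : Fin r → Fin m) (hf : ∀ j, (f j).val = 2 * j.val)
    (s : ℤˣ) : minor f (hwWedge m r s) = 1 := by
  rw [hwWedge, minor_ιMulti, ← Matrix.det_one (n := Fin r)]
  congr 1
  ext i j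
  have h2 : ¬ (2 * j.val = 2 * i.val + 1) := by omega
  by_cases h : i = j
  · subst h; simp [weightVector, hf]
  · have : ¬ (j.val = i.val) := fun h' => h (Fin.ext h'.symm)
    simp [weightVector, hf, h, h2, this]

lemma exists_perm_comp {m : ℕ} {β : Type*} (f g : β → Fin m) (hf : Function.Injective f)
    (hg : Function.Injective g) : ∃ π : Equiv.Perm (Fin m), ∀ x, π (f x) = g x := by
  classical
  let e : {x // x ∈ Set.range f} ≃ {x // x ∈ Set.range g} :=
    (Equiv.ofInjective f hf).symm.trans (Equiv.ofInjective g hg)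
  refine ⟨e.extendSubtype, fun x => ?_⟩
  rw [Equiv.extendSubtype_apply_of_mem _ _ ⟨x, rfl⟩]
  have h1 : (⟨f x, ⟨x, rfl⟩⟩ : {x // x ∈ Set.range f}) = Equiv.ofInjective f hf x := rfl
  simp only [e, h1, Equiv.trans_apply, Equiv.symm_apply_apply]
  rfl

lemma exists_signedPerm_comp {m : ℕ} {β : Type*} (f g : β → Fin m) (hf : Function.Injective f)
    (hg : Function.Injective g) : ∃ η π, (∀ x, π (f x) = g x) ∧
      (signedPerm η π : Matrix (Fin m) (Fin m) ℝ).det = 1 := by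
  obtain ⟨π, hπ⟩ := exists_perm_comp f g hf hg
  obtain ⟨τ, hτ⟩ := exists_prod_eq π
  refine ⟨τ, π, hπ, ?_⟩
  rw [det_signedPerm, hτ, Int.units_mul_self]; simp

lemma prod_units_ne_zero {ι : Type*} (s : Finset ι) (η : ι → ℤˣ) :
    ∏ j ∈ s, ((η j : ℤ) : ℂ) ≠ 0 :=
  Finset.prod_ne_zero_iff.2 fun j _ => by simp

/-- The highest weight vector has coordinate `1` at the even indices, and these can be moved to any
injective tuple by a signed permutation matrix of determinant one, so that `Γ = SO(m)` is allowed.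
-/
lemma exists_minor_ne_zero {Γ : Type*} [Group Γ] {m r : ℕ} (hr : 2 * r ≤ m) (φ : Γ →* OO m)
    (hφ : ∀ g : OO m, g.1.det = 1 → ∃ γ, φ γ = g) (s : ℤˣ) (f : Fin r → Fin m)
    (hf : Function.Injective f) : ∃ u ∈ (muOne φ r s).toSubmodule, minor f u ≠ 0 := by
  let f₀ : Fin r → Fin m := fun j => ⟨2 * j.val, by omega⟩
  have hf₀ : Function.Injective f₀ := fun i j h => by
    simp only [f₀, Fin.mk.injEq] at h; omega
  obtain ⟨η, π, hπ, hdet⟩ := exists_signedPerm_comp f₀ f hf₀ hf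
  obtain ⟨γ, hγ⟩ := hφ _ hdet
  refine ⟨extPowRep m r (φ γ) (hwWedge m r s), Submodule.subset_span ⟨γ, _, rfl, rfl⟩, ?_⟩
  have : (fun j => π⁻¹ (f j)) = f₀ := by
    ext1 x
    rw [← hπ, Equiv.Perm.inv_def, Equiv.symm_apply_apply]
  rw [hγ, minor_signedPerm, this, minor_hwWedge_even f₀ fun _ => rfl, mul_one]
  exact prod_units_ne_zero _ _

lemma orthogonal_map_transpose_mul {m : ℕ} (g : OO m) :
    (g.1.map (algebraMap ℝ ℂ))ᵀ * g.1.map (algebraMap ℝ ℂ) = 1 := by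
  rw [← Matrix.transpose_map, ← Matrix.map_mul, (Matrix.mem_orthogonalGroup_iff' _ _).1 g.2]
  simp

/-! ### Complementary minors of maximal isotropic subspaces -/

/-- The columns of `G (1; T)` span a maximal isotropic subspace with coordinate blocks `P` and `Q`.
Since `T² = -1`, the transpose of `G N₀` maps the block column `(P; Q)` to `(2; 0)`, so multiplying
it by `[P 0; Q 1]` gives a block triangular matrix. Its determinant yields `det G · 2^r ∏ t · det P
= 2^r det Q`. -/
lemma det_complementary {r : ℕ} (G : Matrix (Fin r ⊕ Fin r) (Fin r ⊕ Fin r) ℂ) (hG : Gᵀ * G = 1)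
    (t : Fin r → ℂ) (ht : ∀ j, t j * t j = -1) :
    (G.toBlocks₂₁ + G.toBlocks₂₂ * Matrix.diagonal t).det =
      G.det * (∏ j, t j) * (G.toBlocks₁₁ + G.toBlocks₁₂ * Matrix.diagonal t).det := by
  set P := G.toBlocks₁₁ + G.toBlocks₁₂ * Matrix.diagonal t with hP
  set Q := G.toBlocks₂₁ + G.toBlocks₂₂ * Matrix.diagonal t with hQ
  set T := Matrix.diagonal t with hT
  set N₀ : Matrix (Fin r ⊕ Fin r) (Fin r ⊕ Fin r) ℂ := Matrix.fromBlocks 1 1 (-T) T with hN₀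
  have hTT : T * T = -1 := by
    rw [hT, Matrix.diagonal_mul_diagonal]
    ext i j
    by_cases h : i = j
    · subst h; simp [ht]
    · simp [h]
  have hTt : Tᵀ = T := Matrix.diagonal_transpose _
  have e1 : Matrix.fromBlocks P 0 Q 1 =
      G * Matrix.fromBlocks 1 0 T 0 + Matrix.fromBlocks 0 0 0 1 := by
    conv_rhs => rw [← Matrix.fromBlocks_toBlocks G]
    rw [Matrix.fromBlocks_multiply, Matrix.fromBlocks_add]
    simp [P, Q, T]
  have e2 : G * N₀ = Matrix.fromBlocks (G.toBlocks₁₁ - G.toBlocks₁₂ * T) P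
      (G.toBlocks₂₁ - G.toBlocks₂₂ * T) Q := by
    conv_lhs => rw [← Matrix.fromBlocks_toBlocks G]
    rw [hN₀, Matrix.fromBlocks_multiply]
    simp [hP, hQ, sub_eq_add_neg]
  have e3 : (G * N₀)ᵀ * Matrix.fromBlocks P 0 Q 1 =
      Matrix.fromBlocks ((2 : ℂ) • 1) (G.toBlocks₂₁ - G.toBlocks₂₂ * T)ᵀ 0 Qᵀ := by
    rw [e1, Matrix.mul_add]
    have : (G * N₀)ᵀ * (G * Matrix.fromBlocks 1 0 T 0) =
        Matrix.fromBlocks ((2 : ℂ) • 1) 0 0 0 := by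
      rw [Matrix.transpose_mul, Matrix.mul_assoc, ← Matrix.mul_assoc Gᵀ, hG, Matrix.one_mul, hN₀,
        Matrix.fromBlocks_transpose, Matrix.fromBlocks_multiply]
      simp [hTt, hTT, two_smul]
    rw [this, e2, Matrix.fromBlocks_transpose, Matrix.fromBlocks_multiply, Matrix.fromBlocks_add]
    simp
  have e4 := congrArg Matrix.det e3
  rw [Matrix.det_mul, Matrix.det_transpose, Matrix.det_mul, Matrix.det_fromBlocks_zero₁₂,
    Matrix.det_fromBlocks_zero₂₁, hN₀, Matrix.det_fromBlocks_one₁₁, Matrix.det_transpose,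
    Matrix.det_smul, Matrix.det_one, Matrix.mul_one, sub_neg_eq_add, ← two_smul ℂ T,
    Matrix.det_smul, hT, Matrix.det_diagonal, Fintype.card_fin] at e4
  apply mul_left_cancel₀ (pow_ne_zero r (two_ne_zero (α := ℂ)))
  linear_combination -e4

/-- The pairs of coordinates `(2j, 2j+1)`. -/
def pairEquiv {r m : ℕ} (h : r + r = m) : Fin r ⊕ Fin r ≃ Fin m := by
  refine Equiv.ofBijective
    (Sum.elim (fun j => ⟨2 * j.val, by omega⟩) (fun j => ⟨2 * j.val + 1, by omega⟩)) ?_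
  rw [Fintype.bijective_iff_injective_and_card]
  refine ⟨?_, by simp [h]⟩
  rintro (i | i) (j | j) hij <;> simp only [Sum.elim_inl, Sum.elim_inr, Fin.mk.injEq] at hij
  · congr 1; ext; omega
  · omega
  · omega
  · congr 1; ext; omega

lemma prod_last_sign {r : ℕ} (hr : 1 ≤ r) (s : ℤˣ) :
    ∏ j : Fin r, (if j.val + 1 = r then s else 1) = s := by
  obtain ⟨r, rfl⟩ : ∃ n, r = n + 1 := ⟨r - 1, by omega⟩
  rw [Fin.prod_univ_castSucc]
  simp only [Fin.val_castSucc, Fin.val_last, if_true]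
  rw [Finset.prod_eq_one, one_mul]
  intro i _
  rw [if_neg (by omega)]

/-- `det_complementary` is applied to `g` with rows permuted by `π` and coordinates grouped into
even and odd ones. Then `det G` is the sign of `π`, and `∏ t = s i^r` because only the last weight
vector carries `s`. -/
lemma minor_complement_hw {r m : ℕ} (h : r + r = m) (hr : 1 ≤ r) (s : ℤˣ) (g : OO m)
    (hg : g.1.det = 1) (π : Equiv.Perm (Fin m)) :
    minor (fun j => π (pairEquiv h (Sum.inr j))) (extPowRep m r g (hwWedge m r s)) =
      ((Equiv.Perm.sign π : ℤ) : ℂ) * (((s : ℤ) : ℂ) * Complex.I ^ r) *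
      minor (fun j => π (pairEquiv h (Sum.inl j))) (extPowRep m r g (hwWedge m r s)) := by
  let e := pairEquiv h
  let G : Matrix (Fin r ⊕ Fin r) (Fin r ⊕ Fin r) ℂ :=
    (g.1.map (algebraMap ℝ ℂ)).submatrix (e.trans π) e
  have hG : Gᵀ * G = 1 := by
    simp only [G]
    rw [Matrix.transpose_submatrix, Matrix.submatrix_mul_equiv, orthogonal_map_transpose_mul,
      Matrix.submatrix_one_equiv]
  have hdet : G.det = ((Equiv.Perm.sign π : ℤ) : ℂ) := by
    have h1 : G = ((g.1.map (algebraMap ℝ ℂ)).submatrix π id).submatrix e e := rfl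
    rw [h1, Matrix.det_submatrix_equiv_self, Matrix.det_permute, show (g.1.map (algebraMap ℝ ℂ)).det = 1 from
      (RingHom.map_det _ _).symm.trans (by rw [hg, map_one])]
    simp
  let t : Fin r → ℂ := fun j => (((if j.val + 1 = r then s else 1 : ℤˣ) : ℤ) : ℂ) * Complex.I
  have ht : ∀ j, t j * t j = -1 := by
    intro j
    have : ∀ u : ℤˣ, ((u : ℤ) : ℂ) * ((u : ℤ) : ℂ) = 1 := fun u => by
      exact_mod_cast Int.units_coe_mul_self u
    simp only [t]
    rw [mul_mul_mul_comm, this, Complex.I_mul_I, one_mul]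
  have hprod : ∏ j, t j = ((s : ℤ) : ℂ) * Complex.I ^ r := by
    simp only [t]
    rw [Finset.prod_mul_distrib, Finset.prod_const, Finset.card_univ, Fintype.card_fin]
    congr 1
    have := congrArg (fun u : ℤˣ => ((u : ℤ) : ℂ)) (prod_last_sign hr s)
    simpa using this
  have key := det_complementary G hG t ht
  rw [hdet, hprod] at key
  have hent : ∀ (x : Fin r ⊕ Fin r) (i : Fin r),
      (g.1.map (algebraMap ℝ ℂ) *ᵥ weightVector m i (if i.val + 1 = r then s else 1)) (π (e x)) =
      G x (Sum.inl i) + G x (Sum.inr i) * t i := by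
    intro x i
    rw [Matrix.mulVec, dotProduct, weightVector_sum (by omega)]
    simp only [t]
    rw [mul_comm (G x (Sum.inr i))]
    rfl
  have hm : ∀ (x : Fin r → Fin r ⊕ Fin r),
      minor (fun j => π (e (x j))) (extPowRep m r g (hwWedge m r s)) =
      (Matrix.of fun j i => G (x j) (Sum.inl i) + G (x j) (Sum.inr i) * t i).det := by
    intro x
    rw [hwWedge, extPowRep_ιMulti, minor_ιMulti, ← Matrix.det_transpose]
    congr 1
    ext j i
    exact hent _ _
  have h2 := hm Sum.inr
  have h1 := hm Sum.inl
  rw [h1, h2]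
  convert key using 2
  · ext i j
    simp [Matrix.toBlocks₂₁, Matrix.toBlocks₂₂, Matrix.mul_diagonal]
  · congr 1
    ext i j
    simp [Matrix.toBlocks₁₁, Matrix.toBlocks₁₂, Matrix.mul_diagonal]

/-- The sign relating a pair of complementary tuples to the standard pair. -/
def complSign {r m : ℕ} (h : r + r = m) (f f' : Fin r → Fin m) : ℤˣ :=
  open Classical in
  if hπ : ∃ π : Equiv.Perm (Fin m), ∀ x, π (pairEquiv h x) = Sum.elim f f' x
  then Equiv.Perm.sign hπ.choose else 1

/-- The relation is linear and holds on the orbit of the highest weight vector. It is the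
self-duality, with eigenvalue governed by `s`, of one half of the middle exterior power under
`SO(2r)`. -/
lemma minor_complement {Γ : Type*} [Group Γ] {r m : ℕ} (h : r + r = m) (hr : 1 ≤ r)
    (φ : Γ →* OO m) (hφ : ∀ γ, (φ γ).1.det = 1) (s : ℤˣ) (f f' : Fin r → Fin m)
    (hf : Function.Injective (Sum.elim f f')) (u : ⋀[ℂ]^r (Fin m → ℂ))
    (hu : u ∈ (muOne φ r s).toSubmodule) :
    minor f' u = ((complSign h f f' : ℤ) : ℂ) * (((s : ℤ) : ℂ) * Complex.I ^ r) * minor f u := by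
  have hπ : ∃ π : Equiv.Perm (Fin m), ∀ x, π (pairEquiv h x) = Sum.elim f f' x :=
    exists_perm_comp _ _ (pairEquiv h).injective hf
  have h1 := hπ.choose_spec
  rw [complSign, dif_pos hπ]
  set π := hπ.choose
  have hf1 : f = fun j => π (pairEquiv h (Sum.inl j)) := by ext1 j; rw [h1]; rfl
  have hf2 : f' = fun j => π (pairEquiv h (Sum.inr j)) := by ext1 j; rw [h1]; rfl
  rw [hf1, hf2]
  induction hu using Submodule.span_induction with
  | mem x hx =>
    obtain ⟨γ, v, hv, rfl⟩ := hx
    rw [Set.mem_singleton_iff.1 hv]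
    exact minor_complement_hw h hr s (φ γ) (hφ γ) π
  | zero => simp
  | add x y _ _ hx hy => rw [map_add, map_add, hx, hy]; ring
  | smul c x _ hx => rw [map_smul, map_smul, hx]; simp only [smul_eq_mul]; ring

/-! ### Representations of `W(B_a)` on functions of tuples of indices -/

lemma IntUnits.cast_mul_self (u : ℤˣ) : ((u : ℤ) : ℂ) * ((u : ℤ) : ℂ) = 1 := by
  exact_mod_cast Int.units_coe_mul_self u

/-- `W(B_a)` acting on functions of `k`-tuples of indices, the signs entering through the `u`-th
power of the product of the signs at the tuple and the `v`-th power of the product of all signs. -/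
def tupleRep (a k u v : ℕ) : Representation ℂ (WB a) ((Fin k → Fin a) → ℂ) where
  toFun w :=
    { toFun := fun φ f => ((signProd a w : ℤ) : ℂ) ^ v * (∏ j, ((w.left (f j) : ℤ) : ℂ)) ^ u *
        φ fun j => w.right⁻¹ (f j)
      map_add' := fun x y => by ext f; simp only [Pi.add_apply]; ring
      map_smul' := fun c x => by
        ext f; simp only [Pi.smul_apply, smul_eq_mul, RingHom.id_apply]; ring }
  map_one' := by ext; simp
  map_mul' w z := by
    ext φ f
    have hact : ∀ (F : Fin a → ℤˣ) (x : Fin a),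
        (mulAutArrow w.right F : Fin a → ℤˣ) x = F (w.right⁻¹ x) := fun _ _ => rfl
    simp only [LinearMap.comp_apply, LinearMap.single_apply, LinearMap.coe_mk, AddHom.coe_mk,
      Module.End.mul_apply, map_mul, Units.val_mul, Int.cast_mul, SemidirectProduct.mul_left,
      Pi.mul_apply, hact, Finset.prod_mul_distrib, SemidirectProduct.mul_right, mul_inv_rev,
      Equiv.Perm.mul_apply]
    ring

lemma tupleRep_apply {a k u v : ℕ} (w : WB a) (φ : (Fin k → Fin a) → ℂ) (f : Fin k → Fin a) :
    tupleRep a k u v w φ f = ((signProd a w : ℤ) : ℂ) ^ v *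
      (∏ j, ((w.left (f j) : ℤ) : ℂ)) ^ u * φ fun j => w.right⁻¹ (f j) := rfl

/-- Symmetric functions of `k`-tuples vanishing on tuples with a repetition, that is, functions of
`k`-subsets. -/
def symTuples (k a : ℕ) : Submodule ℂ ((Fin k → Fin a) → ℂ) where
  carrier := {φ | (∀ f (σ : Equiv.Perm (Fin k)), φ (f ∘ σ) = φ f) ∧
    ∀ f, ¬ Function.Injective f → φ f = 0}
  add_mem' {x y} hx hy := ⟨fun f σ => by simp [hx.1 f σ, hy.1 f σ],
    fun f hf => by simp [hx.2 f hf, hy.2 f hf]⟩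
  zero_mem' := ⟨fun _ _ => rfl, fun _ _ => rfl⟩
  smul_mem' c x hx := ⟨fun f σ => by simp [hx.1 f σ], fun f hf => by simp [hx.2 f hf]⟩

/-- The functions of `k`-subsets of a set with `2k` elements multiplied by `κ` under passage to
the complement. -/
def complTuples (k a : ℕ) (κ : ℂ) : Submodule ℂ ((Fin k → Fin a) → ℂ) where
  carrier := {φ | φ ∈ symTuples k a ∧ ∀ f f' : Fin k → Fin a,
    Function.Injective (Sum.elim f f') → φ f' = κ * φ f}
  add_mem' {x y} hx hy := ⟨add_mem hx.1 hy.1, fun f f' h => by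
    simp only [Pi.add_apply, hx.2 f f' h, hy.2 f f' h]; ring⟩
  zero_mem' := ⟨zero_mem _, fun _ _ _ => by simp⟩
  smul_mem' c x hx := ⟨Submodule.smul_mem _ c hx.1, fun f f' h => by
    simp only [Pi.smul_apply, smul_eq_mul, hx.2 f f' h]; ring⟩

lemma exists_perm_of_range_eq {k : ℕ} {α : Type*} (f g : Fin k → α) (hf : Function.Injective f)
    (hg : Function.Injective g) (h : Set.range f = Set.range g) :
    ∃ σ : Equiv.Perm (Fin k), f = g ∘ σ := by
  refine ⟨(Equiv.ofInjective f hf).trans ((Equiv.setCongr h).trans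
    (Equiv.ofInjective g hg).symm), ?_⟩
  ext1 x
  simp only [Function.comp_apply, Equiv.trans_apply]
  rw [Equiv.apply_ofInjective_symm hg]
  rfl

/-- The product of the signs at the entries of a tuple. -/
def tupleSign {k a : ℕ} (f : Fin k → Fin a) : (Fin a → ℤˣ) →* ℤˣ where
  toFun ε := ∏ j, ε (f j)
  map_one' := by simp
  map_mul' x y := by simp [Finset.prod_mul_distrib]

lemma tupleSign_apply {k a : ℕ} (f : Fin k → Fin a) (ε : Fin a → ℤˣ) :
    tupleSign f ε = ∏ j, ε (f j) := rfl

/-- The sign change in one coordinate. -/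
def flipSign {a : ℕ} (i : Fin a) : Fin a → ℤˣ := Function.update 1 i (-1)

lemma tupleSign_flipSign {k a : ℕ} (f : Fin k → Fin a) (hf : Function.Injective f) (i : Fin a)
    [Decidable (i ∈ Set.range f)] :
    tupleSign f (flipSign i) = if i ∈ Set.range f then -1 else 1 := by
  rw [tupleSign_apply]
  split_ifs with h
  · obtain ⟨j, rfl⟩ := h
    rw [Finset.prod_eq_single j]
    · simp [flipSign]
    · intro l _ hl
      simp [flipSign, hf.eq_iff, hl]
    · simp
  · apply Finset.prod_eq_one
    intro j _
    have : f j ≠ i := fun h' => h ⟨j, h'⟩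
    simp [flipSign, this]

/-- The even sign changes. -/
def evenSigns (a : ℕ) : Subgroup (Fin a → ℤˣ) := (tupleSign (id : Fin a → Fin a)).ker

lemma flipSign_mul_mem {a : ℕ} (i j : Fin a) : flipSign i * flipSign j ∈ evenSigns a := by
  classical
  rw [evenSigns, MonoidHom.mem_ker, map_mul, tupleSign_flipSign _ Function.injective_id,
    tupleSign_flipSign _ Function.injective_id]
  simp

lemma neg_one_ne_one_units : (-1 : ℤˣ) ≠ 1 := by decide

lemma mem_range_iff_of_tupleSign {k l a b : ℕ} (f : Fin k → Fin a) (g : Fin l → Fin b)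
    (hf : Function.Injective f) (hg : Function.Injective g) (i : Fin a) (j : Fin b)
    (h : tupleSign f (flipSign i) = tupleSign g (flipSign j)) :
    i ∈ Set.range f ↔ j ∈ Set.range g := by
  classical
  rw [tupleSign_flipSign f hf, tupleSign_flipSign g hg] at h
  by_cases h1 : i ∈ Set.range f <;> by_cases h2 : j ∈ Set.range g <;>
    simp [h1, h2, neg_one_ne_one_units.symm] at h ⊢

/-- A product of two sign changes does not detect membership of a single index, only whether the two
sets agree at both places or at neither. This is the source of the alternative "equal or
complementary" for even sign changes. -/
lemma mem_range_iff_of_tupleSign_mul {k l a b : ℕ} (f : Fin k → Fin a) (g : Fin l → Fin b)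
    (hf : Function.Injective f) (hg : Function.Injective g) (i i' : Fin a) (j j' : Fin b)
    (h : tupleSign f (flipSign i * flipSign i') = tupleSign g (flipSign j * flipSign j')) :
    (i ∈ Set.range f ↔ j ∈ Set.range g) ↔ (i' ∈ Set.range f ↔ j' ∈ Set.range g) := by
  classical
  rw [map_mul, map_mul, tupleSign_flipSign f hf, tupleSign_flipSign g hg, tupleSign_flipSign f hf,
    tupleSign_flipSign g hg] at h
  by_cases h1 : i ∈ Set.range f <;> by_cases h2 : j ∈ Set.range g <;>
    by_cases h3 : i' ∈ Set.range f <;> by_cases h4 : j' ∈ Set.range g <;>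
    simp [h1, h2, h3, h4, neg_one_ne_one_units.symm] at h ⊢

lemma range_eq_of_tupleSign {k l a : ℕ} (f : Fin k → Fin a) (g : Fin l → Fin a)
    (hf : Function.Injective f) (hg : Function.Injective g)
    (h : ∀ ε, tupleSign f ε = tupleSign g ε) : Set.range f = Set.range g := by
  ext i
  exact mem_range_iff_of_tupleSign f g hf hg i i (h _)

lemma range_eq_or_of_tupleSign {k l a : ℕ} (f : Fin k → Fin a) (g : Fin l → Fin a)
    (hf : Function.Injective f) (hg : Function.Injective g)
    (h : ∀ ε ∈ evenSigns a, tupleSign f ε = tupleSign g ε) :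
    Set.range f = Set.range g ∨ Set.range f = (Set.range g)ᶜ := by
  have key : ∀ i i', (i ∈ Set.range f ↔ i ∈ Set.range g) ↔
      (i' ∈ Set.range f ↔ i' ∈ Set.range g) := fun i i' =>
    mem_range_iff_of_tupleSign_mul f g hf hg i i' i i' (h _ (flipSign_mul_mem _ _))
  by_cases h0 : ∃ i, i ∈ Set.range f ↔ i ∈ Set.range g
  · obtain ⟨i, hi⟩ := h0
    left; ext i'
    exact (key i i').1 hi
  · push Not at h0
    right; ext i'
    have := h0 i'
    rw [Set.mem_compl_iff]
    tauto

lemma elim_injective_of_range {k l a : ℕ} (f : Fin k → Fin a) (g : Fin l → Fin a)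
    (hf : Function.Injective f) (hg : Function.Injective g) (h : Set.range f = (Set.range g)ᶜ) :
    Function.Injective (Sum.elim g f) := by
  rw [Sum.elim_injective]
  refine ⟨hg, hf, fun i j hij => ?_⟩
  have h1 : f j ∈ (Set.range g)ᶜ := h ▸ ⟨j, rfl⟩
  exact h1 ⟨i, hij⟩

/-- A space `S` of functions of tuples stable under multiplication by the characters `tupleSign`
of a group `G` of sign changes contains `F₀` as soon as its functions are proportional to those of
`F₀` on each set of tuples having the same character, and do not all vanish at a point where a
function in `F₀` does not vanish. -/
lemma le_of_isolating {k a : ℕ} (G : Subgroup (Fin a → ℤˣ))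
    (S F₀ : Submodule ℂ ((Fin k → Fin a) → ℂ))
    (hS : ∀ ε ∈ G, ∀ φ ∈ S, (fun f => ((tupleSign f ε : ℤ) : ℂ) * φ f) ∈ S)
    (hprop : ∀ ψ ∈ F₀, ∀ φ ∈ S, ∀ f₀ f, (∀ ε ∈ G, tupleSign f ε = tupleSign f₀ ε) →
      ψ f * φ f₀ = ψ f₀ * φ f)
    (hne : ∀ ψ ∈ F₀, ∀ f₀, ψ f₀ ≠ 0 → ∃ φ ∈ S, φ f₀ ≠ 0) : F₀ ≤ S := by
  classical
  let T : (Fin k → Fin a) → (G → ℤˣ) := fun f ε => tupleSign f ε.1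
  -- Orthogonality of characters: averaging the sign changes against the character of `f₀` keeps the
  -- values at tuples with this character and annihilates all others.
  have iso : ∀ φ ∈ S, ∀ f₀, (fun f => if T f = T f₀ then φ f else 0) ∈ S := by
    intro φ hφ f₀
    have h1 : (∑ ε : G, ((tupleSign f₀ ε.1 : ℤ) : ℂ) •
        (fun f => ((tupleSign f ε.1 : ℤ) : ℂ) * φ f)) ∈ S :=
      Submodule.sum_mem _ fun ε _ => Submodule.smul_mem _ _ (hS _ ε.2 _ hφ)
    have h2 : (fun f => if T f = T f₀ then φ f else 0) = (Fintype.card G : ℂ)⁻¹ •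
        ∑ ε : G, ((tupleSign f₀ ε.1 : ℤ) : ℂ) • (fun f => ((tupleSign f ε.1 : ℤ) : ℂ) * φ f) := by
      ext f
      have hc : (Fintype.card G : ℂ) ≠ 0 := by simp
      simp only [Pi.smul_apply, Finset.sum_apply, smul_eq_mul, ← mul_assoc, ← Finset.sum_mul]
      split_ifs with h
      · have : ∀ ε : G, ((tupleSign f₀ ε.1 : ℤ) : ℂ) * ((tupleSign f ε.1 : ℤ) : ℂ) = 1 := by
          intro ε
          rw [show tupleSign f ε.1 = tupleSign f₀ ε.1 from congrFun h ε, IntUnits.cast_mul_self]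
        simp [this, Finset.card_univ]
      · let χ : G →* ℂ :=
          { toFun := fun ε => ((tupleSign f₀ ε.1 : ℤ) : ℂ) * ((tupleSign f ε.1 : ℤ) : ℂ)
            map_one' := by simp
            map_mul' := fun x y => by
              simp only [Subgroup.coe_mul, map_mul, Units.val_mul, Int.cast_mul]; ring }
        have hχ : χ ≠ 1 := by
          intro hχ
          apply h
          ext1 ε
          have h3 : ((tupleSign f₀ ε.1 : ℤ) : ℂ) * ((tupleSign f ε.1 : ℤ) : ℂ) = 1 :=
            DFunLike.congr_fun hχ ε
          have h4 : tupleSign f₀ ε.1 * tupleSign f ε.1 = 1 :=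
            Units.ext (Int.cast_injective (α := ℂ) (by rw [Units.val_mul, Int.cast_mul, h3]; simp))
          have h5 := eq_inv_of_mul_eq_one_right h4
          rw [Int.units_inv_eq_self] at h5
          exact h5
        have := sum_hom_units_eq_zero χ hχ
        change ∑ ε : G, ((tupleSign f₀ ε.1 : ℤ) : ℂ) * ((tupleSign f ε.1 : ℤ) : ℂ) = 0 at this
        rw [this]; simp
    rw [h2]
    exact Submodule.smul_mem _ _ h1
  intro ψ hψ
  -- `ψ` is split according to the characters of the tuples. By `hprop` each nonzero piece is a
  -- multiple of an isolated piece of an element of `S`.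
  have hsum : ψ = ∑ t ∈ Finset.univ.image T, (fun f => if T f = t then ψ f else 0) := by
    ext f
    rw [Finset.sum_apply, Finset.sum_ite_eq, if_pos (Finset.mem_image_of_mem _ (Finset.mem_univ _))]
  rw [hsum]
  refine Submodule.sum_mem _ fun t _ => ?_
  by_cases h0 : ∃ f₀, T f₀ = t ∧ ψ f₀ ≠ 0
  · obtain ⟨f₀, rfl, hf₀⟩ := h0
    obtain ⟨φ, hφ, hne'⟩ := hne ψ hψ f₀ hf₀
    have : (fun f => if T f = T f₀ then ψ f else 0) =
        (ψ f₀ / φ f₀) • (fun f => if T f = T f₀ then φ f else 0) := by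
      ext f
      simp only [Pi.smul_apply, smul_eq_mul]
      split_ifs with h
      · have := hprop ψ hψ φ hφ f₀ f (fun ε hε => congrFun h ⟨ε, hε⟩)
        field_simp
        exact this
      · simp
    rw [this]
    exact Submodule.smul_mem _ _ (iso φ hφ f₀)
  · push Not at h0
    have : (fun f => if T f = t then ψ f else 0) = 0 := by
      ext f
      by_cases h : T f = t
      · simp [h0 f h]
      · simp [h]
    rw [this]
    exact zero_mem _

/-- The group of all sign changes distinguishes any two subsets, so `S` contains the indicator
function of each of them. -/
lemma symTuples_le {k a : ℕ} (S : Submodule ℂ ((Fin k → Fin a) → ℂ)) (hS₀ : S ≤ symTuples k a)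
    (hS : ∀ ε, ∀ φ ∈ S, (fun f => ((tupleSign f ε : ℤ) : ℂ) * φ f) ∈ S)
    (hne : ∀ f, Function.Injective f → ∃ φ ∈ S, φ f ≠ 0) : symTuples k a ≤ S := by
  apply le_of_isolating ⊤ S _ (fun ε _ => hS ε)
  · intro ψ hψ φ hφ f₀ f h
    by_cases hf : Function.Injective f
    · by_cases hf₀ : Function.Injective f₀
      · obtain ⟨σ, rfl⟩ := exists_perm_of_range_eq f f₀ hf hf₀
          (range_eq_of_tupleSign f f₀ hf hf₀ fun ε => h ε trivial)
        rw [hψ.1, (hS₀ hφ).1]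
      · rw [(hS₀ hφ).2 _ hf₀, hψ.2 _ hf₀]; simp
    · rw [(hS₀ hφ).2 _ hf, hψ.2 _ hf]; simp
  · intro ψ hψ f₀ h
    apply hne
    by_contra hf
    exact h (hψ.2 _ hf)

/-- The even sign changes distinguish subsets up to complement, and on such a pair the functions of
`complTuples` are already proportional. -/
lemma complTuples_le {k a : ℕ} (κ : ℂ) (S : Submodule ℂ ((Fin k → Fin a) → ℂ))
    (hS₀ : S ≤ complTuples k a κ)
    (hS : ∀ ε ∈ evenSigns a, ∀ φ ∈ S, (fun f => ((tupleSign f ε : ℤ) : ℂ) * φ f) ∈ S)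
    (hne : ∀ f, Function.Injective f → ∃ φ ∈ S, φ f ≠ 0) : complTuples k a κ ≤ S := by
  apply le_of_isolating (evenSigns a) S _ hS
  · intro ψ hψ φ hφ f₀ f h
    by_cases hf : Function.Injective f
    · by_cases hf₀ : Function.Injective f₀
      · rcases range_eq_or_of_tupleSign f f₀ hf hf₀ h with h1 | h1
        · obtain ⟨σ, rfl⟩ := exists_perm_of_range_eq f f₀ hf hf₀ h1
          rw [hψ.1.1, (hS₀ hφ).1.1]
        · have h2 := elim_injective_of_range f f₀ hf hf₀ h1
          rw [hψ.2 _ _ h2, (hS₀ hφ).2 _ _ h2]; ring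
      · rw [(hS₀ hφ).1.2 _ hf₀, hψ.1.2 _ hf₀]; simp
    · rw [(hS₀ hφ).1.2 _ hf, hψ.1.2 _ hf]; simp
  · intro ψ hψ f₀ h
    apply hne
    by_contra hf
    exact h (hψ.1.2 _ hf)

/-! ### The kernel of the map from functions of `r`-subsets to functions of `(r-1)`-subsets -/

/-- The alternating sum over the choices of one element in each of `r` pairs. -/
def pairSum {r : ℕ} {α : Type*} (x : (Fin r → α) → ℂ) (b : Fin r × Bool → α) : ℂ :=
  ∑ e : Fin r → Bool, (∏ j, if e j then -1 else 1) * x fun j => b (j, e j)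

/-- Summing over the choice in the first pair `(i, j)` first: this is the induction step in
`eq_zero_of_pairSum`. -/
lemma pairSum_succ {r : ℕ} {α : Type*} (x : (Fin (r + 1) → α) → ℂ) (i j : α)
    (b : Fin r × Bool → α) :
    pairSum x (fun p => Fin.cons (α := fun _ => α) (if p.2 then j else i)
      (fun m => b (m, p.2)) p.1) =
    pairSum (fun f => x (Fin.cons i f) - x (Fin.cons j f)) b := by
  have hc : ∀ (y : Bool) (e : Fin r → Bool),
      (fun m : Fin (r + 1) => (Fin.cons (α := fun _ => α)
        (if (Fin.cons (α := fun _ => Bool) y e m) then j else i)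
        (fun l => b (l, Fin.cons (α := fun _ => Bool) y e m)) m : α)) =
      Fin.cons (α := fun _ => α) (if y then j else i) (fun l => b (l, e l)) := by
    intro y e
    ext1 m
    refine Fin.cases ?_ (fun m => ?_) m <;> simp
  rw [pairSum, pairSum, ← (Fin.consEquiv fun _ : Fin (r + 1) => Bool).sum_comp,
    Fintype.sum_prod_type, Fintype.sum_bool, ← Finset.sum_add_distrib]
  refine Finset.sum_congr rfl fun e _ => ?_
  simp only [Fin.consEquiv_apply, hc]
  simp only [Fin.prod_univ_succ, Fin.cons_zero, Fin.cons_succ, if_true]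
  simp only [Bool.false_eq_true, if_false]
  ring

/-- Induction on `r`. For `i ≠ j` in `S` the difference `x(i, ·) - x(j, ·)` is a function of
`(r-1)`-subsets of `S ∖ {i, j}` satisfying the same hypotheses, hence zero. So `x` does not change
when one element of a subset is exchanged, and the vanishing sums then force `x = 0`. -/
lemma eq_zero_of_pairSum {α : Type*} [DecidableEq α] (r : ℕ) :
    ∀ (S : Finset α) (x : (Fin r → α) → ℂ), 2 * r ≤ S.card →
      (∀ f (σ : Equiv.Perm (Fin r)), x (f ∘ σ) = x f) → (∀ f, ¬ Function.Injective f → x f = 0) →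
      (∀ f, (∀ j, f j ∈ S) → ∀ m, ∑ l ∈ S, x (Function.update f m l) = 0) →
      (∀ b, Function.Injective b → (∀ p, b p ∈ S) → pairSum x b = 0) →
      ∀ f, (∀ j, f j ∈ S) → x f = 0 := by
  induction r with
  | zero =>
    intro S x _ _ _ _ hb f _
    have := hb (fun p => p.1.elim0) (fun p => p.1.elim0) (fun p => p.1.elim0)
    simp only [pairSum, Finset.univ_eq_empty, Finset.prod_empty, one_mul, Finset.univ_unique,
      Finset.sum_singleton] at this
    rw [← this]; congr 1; exact Subsingleton.elim _ _
  | succ r ih =>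
    intro S x hcard hsym hinj hd hb f hf
    by_cases hfi : Function.Injective f
    swap
    · exact hinj f hfi
    have step : ∀ i ∈ S, ∀ j ∈ S, i ≠ j → ∀ f' : Fin r → α, (∀ m, f' m ∈ S) →
        (∀ m, f' m ≠ i) → (∀ m, f' m ≠ j) → x (Fin.cons i f') = x (Fin.cons j f') := by
      intro i hi j hj hij f' hf'S hf'i hf'j
      have hsub : ∀ l, l ∈ (S.erase i).erase j ↔ l ≠ j ∧ l ≠ i ∧ l ∈ S := fun l => by
        simp [Finset.mem_erase]
      have hj' : j ∈ S.erase i := Finset.mem_erase.2 ⟨hij.symm, hj⟩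
      rw [← sub_eq_zero]
      refine ih ((S.erase i).erase j) (fun f => x (Fin.cons i f) - x (Fin.cons j f)) ?_ ?_ ?_ ?_ ?_
        f' (fun m => (hsub _).2 ⟨hf'j m, hf'i m, hf'S m⟩)
      · rw [Finset.card_erase_of_mem hj', Finset.card_erase_of_mem hi]; omega
      · intro g σ
        have : ∀ l, (Fin.cons l (g ∘ σ) : Fin (r + 1) → α) =
            (Fin.cons l g : Fin (r + 1) → α) ∘ Equiv.Perm.decomposeFin.symm (0, σ) := by
          intro l
          ext1 m
          refine Fin.cases ?_ (fun m => ?_) m <;> simp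
        simp only [this, hsym]
      · intro g hg
        have : ∀ l, ¬ Function.Injective (Fin.cons l g : Fin (r + 1) → α) := fun l h =>
          hg fun u v huv => Fin.succ_injective _ (h (by simpa using huv))
        simp only [hinj _ (this _), sub_zero]
      · intro g hg m
        have hgS : ∀ m, g m ∈ S := fun m => ((hsub _).1 (hg m)).2.2
        have hupd : ∀ u l, (Fin.cons u (Function.update g m l) : Fin (r + 1) → α) =
            Function.update (Fin.cons u g : Fin (r + 1) → α) m.succ l := fun u l =>
          Fin.cons_update (α := fun _ => α) u g m l
        have hsumS : ∀ u ∈ S, ∑ l ∈ S, x (Fin.cons u (Function.update g m l)) = 0 := by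
          intro u hu
          simp only [hupd]
          apply hd
          intro q
          refine Fin.cases ?_ (fun q => ?_) q
          · simpa using hu
          · simpa using hgS q
        have hself : ∀ u, x (Fin.cons u (Function.update g m u)) = 0 := by
          intro u
          apply hinj
          intro h
          have := @h 0 m.succ (by simp)
          exact absurd this (Fin.succ_ne_zero m).symm
        -- The full sums over `S` vanish, so the sums over `S ∖ {i, j}` equal minus these two cross
        -- terms, which coincide by symmetry and cancel in the difference.
        have hcross : x (Fin.cons i (Function.update g m j)) =
            x (Fin.cons j (Function.update g m i)) := by
          rw [← hsym (Fin.cons i (Function.update g m j)) (Equiv.swap 0 m.succ)]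
          congr 1
          ext1 q
          refine Fin.cases ?_ (fun q => ?_) q
          · simp
          · by_cases hq : q = m
            · subst hq; simp [Function.update_of_ne (Fin.succ_ne_zero _).symm]
            · rw [Function.comp_apply, Equiv.swap_apply_of_ne_of_ne (Fin.succ_ne_zero q)
                (fun h => hq (Fin.succ_injective _ h))]
              simp [hq]
        have h1 := hsumS i hi
        have h2 := hsumS j hj
        rw [← Finset.add_sum_erase _ _ hi, ← Finset.add_sum_erase _ _ hj', hself] at h1
        rw [← Finset.add_sum_erase _ _ hi, ← Finset.add_sum_erase _ _ hj', hself] at h2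
        rw [Finset.sum_sub_distrib]
        linear_combination h1 - h2 - hcross
      · intro b hbi hbS
        rw [← pairSum_succ]
        apply hb
        · rintro ⟨p, y⟩ ⟨p', y'⟩ h
          revert h
          refine Fin.cases ?_ (fun p => ?_) p <;> refine Fin.cases ?_ (fun p' => ?_) p'
          · cases y <;> cases y' <;> simp [hij, hij.symm]
          · intro h
            have := (hsub _).1 (hbS (p', y'))
            cases y <;> simp at h <;> simp [← h] at this
          · intro h
            have := (hsub _).1 (hbS (p, y))
            cases y' <;> simp at h <;> simp [h] at this
          · intro h
            simp only [Fin.cons_succ] at h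
            have := hbi h
            simp only [Prod.mk.injEq] at this ⊢
            exact ⟨congrArg _ this.1, this.2⟩
        · rintro ⟨p, y⟩
          refine Fin.cases ?_ (fun p => ?_) p
          · cases y <;> simp [hi, hj]
          · simpa using ((hsub _).1 (hbS (p, y))).2.2
    have hf0 : f = Fin.cons (f 0) (Fin.tail f) := (Fin.cons_self_tail f).symm
    -- Each term is `x f`, or zero if the new entry is a repetition. The term `l = f 0` is not a
    -- repetition, so the sum is a positive multiple of `x f`.
    have hterm : ∀ l ∈ S, x (Function.update f 0 l) =
        if ∃ m, Fin.tail f m = l then 0 else x f := by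
      intro l hl
      have hu : Function.update f 0 l = Fin.cons l (Fin.tail f) := by
        conv_lhs => rw [hf0, Fin.update_cons_zero]
      rw [hu]
      split_ifs with h
      · obtain ⟨m, hm⟩ := h
        apply hinj
        intro h
        have := @h 0 m.succ (by simp [hm])
        exact absurd this (Fin.succ_ne_zero m).symm
      · push Not at h
        by_cases hl0 : l = f 0
        · rw [hl0, ← hf0]
        · conv_rhs => rw [hf0]
          refine step l hl (f 0) (hf 0) hl0 _ (fun m => hf _) h (fun m hm => ?_)
          exact absurd (hfi hm) (Fin.succ_ne_zero m)
    have hsum := hd f hf 0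
    rw [Finset.sum_congr rfl hterm, Finset.sum_ite, Finset.sum_const_zero, zero_add,
      Finset.sum_const, nsmul_eq_mul, mul_eq_zero] at hsum
    refine hsum.resolve_left ?_
    rw [Nat.cast_eq_zero, Finset.card_eq_zero, ← Ne, ← Finset.nonempty_iff_ne_empty]
    refine ⟨f 0, ?_⟩
    rw [Finset.mem_filter]
    refine ⟨hf 0, ?_⟩
    rintro ⟨m, hm⟩
    exact absurd (hfi hm) (Fin.succ_ne_zero m)

/-- The kernel of the map from functions of `r`-subsets to functions of `(r-1)`-subsets. -/
def kerTuples (r a : ℕ) : Submodule ℂ ((Fin r → Fin a) → ℂ) where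
  carrier := {φ | φ ∈ symTuples r a ∧ ∀ f m, ∑ l, φ (Function.update f m l) = 0}
  add_mem' {x y} hx hy := ⟨add_mem hx.1 hy.1, fun f m => by
    simp [Finset.sum_add_distrib, hx.2 f m, hy.2 f m]⟩
  zero_mem' := ⟨zero_mem _, fun _ _ => by simp⟩
  smul_mem' c x hx := ⟨Submodule.smul_mem _ c hx.1, fun f m => by
    simp [← Finset.mul_sum, hx.2 f m]⟩

/-- The sum of the indicator functions of the reorderings of a tuple. -/
def orbitSum {r a : ℕ} (f : Fin r → Fin a) : (Fin r → Fin a) → ℂ :=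
  fun g => ∑ σ : Equiv.Perm (Fin r), if g = f ∘ σ then 1 else 0

/-- The function of `r`-subsets attached to `r` pairs of indices. -/
def pairFun {r a : ℕ} (b : Fin r × Bool → Fin a) : (Fin r → Fin a) → ℂ :=
  fun g => ∑ e : Fin r → Bool, (∏ j, if e j then -1 else 1) * orbitSum (fun j => b (j, e j)) g

lemma orbitSum_comp {r a : ℕ} (f g : Fin r → Fin a) (σ : Equiv.Perm (Fin r)) :
    orbitSum f (g ∘ σ) = orbitSum f g := by
  rw [orbitSum, orbitSum, ← Equiv.sum_comp (Equiv.mulRight σ)]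
  refine Finset.sum_congr rfl fun τ _ => ?_
  have : g ∘ σ = f ∘ (Equiv.mulRight σ τ) ↔ g = f ∘ τ := by
    constructor
    · intro h
      ext1 x
      have := congrFun h (σ⁻¹ x)
      simpa using this
    · rintro rfl; rfl
  simp only [this]

lemma orbitSum_self {r a : ℕ} (f : Fin r → Fin a) (hf : Function.Injective f) :
    orbitSum f f = 1 := by
  rw [orbitSum, Finset.sum_eq_single 1]
  · simp
  · intro σ _ hσ
    rw [if_neg]
    intro h
    apply hσ
    ext1 x
    exact hf (congrFun h x).symm
  · simp

lemma orbitSum_eq_zero {r a : ℕ} (f g : Fin r → Fin a)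
    (h : ¬ ∃ σ : Equiv.Perm (Fin r), g = f ∘ σ) : orbitSum f g = 0 :=
  Finset.sum_eq_zero fun σ _ => if_neg fun h' => h ⟨σ, h'⟩

lemma orbitSum_mem {r a : ℕ} (f : Fin r → Fin a) (hf : Function.Injective f) :
    orbitSum f ∈ symTuples r a :=
  ⟨fun g σ => orbitSum_comp f g σ, fun g hg => orbitSum_eq_zero f g fun ⟨σ, hσ⟩ =>
    hg (hσ ▸ hf.comp σ.injective)⟩

/-- All `r!` reorderings contribute equally, so orthogonality to `pairFun b` means vanishing of
`pairSum x b`. -/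
lemma sum_mul_pairFun {r a : ℕ} (b : Fin r × Bool → Fin a) (x : (Fin r → Fin a) → ℂ)
    (hx : ∀ f (σ : Equiv.Perm (Fin r)), x (f ∘ σ) = x f) :
    ∑ f, x f * pairFun b f = (r.factorial : ℂ) * pairSum x b := by
  simp only [pairFun, pairSum, orbitSum, Finset.mul_sum]
  rw [Finset.sum_comm]
  refine Finset.sum_congr rfl fun e _ => ?_
  rw [Finset.sum_comm]
  have : ∀ σ : Equiv.Perm (Fin r), ∑ f, x f * ((∏ j, if e j then -1 else 1) *
      if f = (fun j => b (j, e j)) ∘ σ then 1 else 0) =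
      (∏ j, if e j then -1 else 1) * x fun j => b (j, e j) := by
    intro σ
    rw [Finset.sum_eq_single ((fun j => b (j, e j)) ∘ σ)]
    · rw [hx]; simp [mul_comm]
    · intro f _ hf; simp [hf]
    · simp
  rw [Finset.sum_congr rfl fun σ _ => this σ]
  simp [Finset.card_univ, Fintype.card_perm]

/-- The component of `x` orthogonal to the span still lies in the kernel, by `hb`, and has vanishing
pair sums; by `eq_zero_of_pairSum` it is zero. The hypothesis `hb` is later supplied by the isotropy
of the highest weight vectors. -/
lemma kerTuples_le_span {r a : ℕ} (h : 2 * r ≤ a)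
    (hb : ∀ b : Fin r × Bool → Fin a, Function.Injective b → pairFun b ∈ kerTuples r a) :
    kerTuples r a ≤ Submodule.span ℂ (pairFun '' {b | Function.Injective b}) := by
  intro x hx
  set H := Submodule.span ℂ (pairFun (r := r) (a := a) '' {b | Function.Injective b}) with hH
  have hHk : H ≤ kerTuples r a := by
    rw [hH, Submodule.span_le]
    rintro _ ⟨b, hb', rfl⟩
    exact hb b hb'
  let E := WithLp.linearEquiv 2 ℂ ((Fin r → Fin a) → ℂ)
  let H' : Submodule ℂ (EuclideanSpace ℂ (Fin r → Fin a)) := H.comap E.toLinearMap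
  obtain ⟨y, hy, z, hz, hxyz⟩ := H'.exists_add_mem_mem_orthogonal (E.symm x)
  have hyH : E y ∈ H := hy
  have hzx : E z = x - E y := by
    rw [eq_sub_iff_add_eq', ← map_add, ← hxyz, LinearEquiv.apply_symm_apply]
  have hzk : E z ∈ kerTuples r a := by rw [hzx]; exact sub_mem hx (hHk hyH)
  have hz0 : E z = 0 := by
    ext f
    refine eq_zero_of_pairSum r Finset.univ (E z) (by simpa using h) hzk.1.1 hzk.1.2
      (fun f _ m => hzk.2 f m) (fun b hbi _ => ?_) f (fun _ => Finset.mem_univ _)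
    have h1 : E.symm (pairFun b) ∈ H' := by
      change E (E.symm (pairFun b)) ∈ H
      rw [LinearEquiv.apply_symm_apply]
      exact Submodule.subset_span ⟨b, hbi, rfl⟩
    have h2 := (Submodule.mem_orthogonal _ _).1 hz _ h1
    -- The functions `pairFun b` are real, so the Hermitian inner product is the bilinear pairing.
    have h3 : ∀ f, starRingEnd ℂ (pairFun b f) = pairFun b f := by
      intro f
      simp [pairFun, orbitSum, map_sum, map_mul, map_prod, apply_ite (starRingEnd ℂ)]
    have h4 : ∑ f, E z f * pairFun b f = 0 := by
      rw [← h2, PiLp.inner_apply]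
      refine Finset.sum_congr rfl fun f _ => ?_
      change _ = E z f * starRingEnd ℂ (pairFun b f)
      rw [h3]
    rw [sum_mul_pairFun b _ hzk.1.1] at h4
    exact (mul_eq_zero.1 h4).resolve_left (by exact_mod_cast r.factorial_ne_zero)
  rw [hz0] at hzx
  rw [sub_eq_zero.1 hzx.symm]
  exact hyH

/-! ### Specht modules of diagrams with at most two rows -/

/-- The inclusion of the Specht module in the space of all tabloids. -/
def spechtVal (n : ℕ) (μ : YoungDiagram) : SpechtSpace n μ →ₗ[ℂ] ((Fin n → ℕ) →₀ ℂ) :=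
  (spechtSubrep n μ).toSubmodule.subtype

lemma spechtVal_injective (n : ℕ) (μ : YoungDiagram) : Function.Injective (spechtVal n μ) :=
  Subtype.val_injective

lemma spechtVal_rep {n : ℕ} {μ : YoungDiagram} (π : Equiv.Perm (Fin n)) (y : SpechtSpace n μ) :
    spechtVal n μ (spechtRep n μ π y) = tabloidRep n π (spechtVal n μ y) := rfl

lemma range_spechtVal (n : ℕ) (μ : YoungDiagram) :
    LinearMap.range (spechtVal n μ) = Submodule.span ℂ
      {x | ∃ (π : Equiv.Perm (Fin n)) (T : Fin n ≃ μ.cells),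
        x = tabloidRep n π (polytabloid μ T)} := by
  refine (Submodule.range_subtype _).trans ?_
  change Submodule.span ℂ _ = _
  congr 1
  ext x
  constructor
  · rintro ⟨π, _, ⟨T, rfl⟩, rfl⟩; exact ⟨π, T, rfl⟩
  · rintro ⟨π, T, rfl⟩; exact ⟨π, _, ⟨T, rfl⟩, rfl⟩

lemma tabloidRep_apply {n : ℕ} (π : Equiv.Perm (Fin n)) (x : (Fin n → ℕ) →₀ ℂ) (t : Fin n → ℕ) :
    tabloidRep n π x t = x fun i => t (π i) := by
  have hinj : Function.Injective (fun (t : Fin n → ℕ) i => t (π⁻¹ i)) := by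
    intro t t' h
    ext i
    have := congrFun h (π i)
    simpa using this
  calc _ = tabloidRep n π x (fun i => t (π (π⁻¹ i))) := by simp
    _ = _ := Finsupp.mapDomain_apply hinj x fun i => t (π i)

lemma mem_twoRow {p q : ℕ} (c : ℕ × ℕ) :
    c ∈ (twoRow p q).cells ↔ (c.1 = 0 ∧ c.2 < max p q) ∨ (c.1 = 1 ∧ c.2 < min p q) := by
  obtain ⟨i, j⟩ := c
  rw [YoungDiagram.mem_cells, twoRow, YoungDiagram.mem_ofRowLens]
  match i with
  | 0 => simp
  | 1 => simp
  | i + 2 => simp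

lemma exists_tableau {p q n : ℕ} (h : p + q = n) : Nonempty (Fin n ≃ (twoRow p q).cells) := by
  have e : Fin (max p q) ⊕ Fin (min p q) ≃ (twoRow p q).cells := by
    refine Equiv.ofBijective (Sum.elim
      (fun j => ⟨(0, j.val), (mem_twoRow _).2 (Or.inl ⟨rfl, j.2⟩)⟩)
      (fun j => ⟨(1, j.val), (mem_twoRow _).2 (Or.inr ⟨rfl, j.2⟩)⟩)) ⟨?_, ?_⟩
    · rintro (i | i) (j | j) hij <;> simp [Fin.ext_iff] at hij ⊢ <;> exact hij
    · rintro ⟨⟨i, j⟩, hc⟩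
      rcases (mem_twoRow _).1 hc with ⟨h1, h2⟩ | ⟨h1, h2⟩
      · obtain rfl : i = 0 := h1
        exact ⟨Sum.inl ⟨j, h2⟩, rfl⟩
      · obtain rfl : i = 1 := h1
        exact ⟨Sum.inr ⟨j, h2⟩, rfl⟩
  exact ⟨(finCongr (by have := max_add_min p q; omega)).trans (finSumFinEquiv.symm.trans e)⟩

/-- The indicator function of the range of a tuple. -/
def rangeTabloid {r n : ℕ} (f : Fin r → Fin n) : Fin n → ℕ :=
  open Classical in fun i => if i ∈ Set.range f then 1 else 0

lemma rangeTabloid_eq_iff {r n : ℕ} (f g : Fin r → Fin n) :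
    rangeTabloid f = rangeTabloid g ↔ Set.range f = Set.range g := by
  constructor
  · intro h
    ext i
    have := congrFun h i
    simp only [rangeTabloid] at this
    by_cases h1 : i ∈ Set.range f <;> by_cases h2 : i ∈ Set.range g <;> simp_all
  · intro h; ext i; simp only [rangeTabloid, h]

/-- The permutation exchanging the members of the pairs selected by `e`. -/
def pairSwap {r n : ℕ} (b : Fin r × Bool ↪ Fin n) (e : Fin r → Bool) : Equiv.Perm (Fin n) :=
  Equiv.Perm.viaFintypeEmbedding
    (Equiv.prodCongrRight fun j => if e j then Equiv.swap false true else 1) b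

lemma pairSwap_apply {r n : ℕ} (b : Fin r × Bool ↪ Fin n) (e : Fin r → Bool) (j : Fin r)
    (x : Bool) : pairSwap b e (b (j, x)) = b (j, xor x (e j)) := by
  rw [pairSwap, Equiv.Perm.viaFintypeEmbedding_apply_image, Equiv.prodCongrRight_apply]
  cases e j <;> cases x <;> simp

lemma pairSwap_apply_of_notMem {r n : ℕ} (b : Fin r × Bool ↪ Fin n) (e : Fin r → Bool)
    (i : Fin n) (hi : i ∉ Set.range b) : pairSwap b e i = i :=
  Equiv.Perm.viaFintypeEmbedding_apply_notMem_range _ _ hi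

lemma pairSwap_inv {r n : ℕ} (b : Fin r × Bool ↪ Fin n) (e : Fin r → Bool) :
    (pairSwap b e)⁻¹ = pairSwap b e := by
  rw [inv_eq_iff_mul_eq_one]
  ext1 i
  rw [Equiv.Perm.mul_apply, Equiv.Perm.one_apply]
  by_cases hi : i ∈ Set.range b
  · obtain ⟨⟨j, x⟩, rfl⟩ := hi
    simp [pairSwap_apply]
  · rw [pairSwap_apply_of_notMem b e i hi, pairSwap_apply_of_notMem b e i hi]

lemma sign_pairSwap {r n : ℕ} (b : Fin r × Bool ↪ Fin n) (e : Fin r → Bool) :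
    ((Equiv.Perm.sign (pairSwap b e) : ℤ) : ℂ) = ∏ j, if e j then -1 else 1 := by
  rw [pairSwap, Equiv.Perm.viaFintypeEmbedding_sign, Equiv.Perm.sign_prodCongrRight]
  push_cast
  refine Finset.prod_congr rfl fun j _ => ?_
  cases e j <;> simp

/-- The pairs of entries in the columns of length two of a tableau. -/
def columnPairs {p r n : ℕ} (h : r ≤ p) (T : Fin n ≃ (twoRow r p).cells) :
    Fin r × Bool ↪ Fin n where
  toFun x := T.symm ⟨(if x.2 then 0 else 1, x.1.val), by
    have := x.1.2
    rw [mem_twoRow]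
    cases x.2 <;> simp <;> omega⟩
  inj' := by
    rintro ⟨i, x⟩ ⟨j, y⟩ hij
    have := T.symm.injective hij
    simp only [Subtype.mk.injEq, Prod.mk.injEq] at this
    refine Prod.ext (Fin.ext this.2) ?_
    cases x <;> cases y <;> simp_all

lemma columnPairs_apply {p r n : ℕ} (h : r ≤ p) (T : Fin n ≃ (twoRow r p).cells) (j : Fin r)
    (x : Bool) : (T (columnPairs h T (j, x))).1 = (if x then 0 else 1, j.val) :=
  congrArg Subtype.val (T.apply_symm_apply _)

lemma mem_range_columnPairs {p r n : ℕ} (h : r ≤ p) (T : Fin n ≃ (twoRow r p).cells) (i : Fin n) :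
    i ∈ Set.range (columnPairs h T) ↔ (T i).1.2 < r := by
  constructor
  · rintro ⟨⟨j, x⟩, rfl⟩
    rw [columnPairs_apply]
    exact j.2
  · intro hi
    have hc := (mem_twoRow _).1 (T i).2
    rcases hc with ⟨h1, -⟩ | ⟨h1, -⟩
    · refine ⟨(⟨_, hi⟩, true), ?_⟩
      apply T.injective
      apply Subtype.ext
      rw [columnPairs_apply]
      exact Prod.ext h1.symm rfl
    · refine ⟨(⟨_, hi⟩, false), ?_⟩
      apply T.injective
      apply Subtype.ext
      rw [columnPairs_apply]
      exact Prod.ext h1.symm rfl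

/-- A column-preserving permutation is a choice, for each column of length two, whether to exchange
its entries. The value `false` marks the second row, so `e` selects the new second row and its sign
is the product of the signs of the exchanges. -/
lemma polytabloid_twoRow {p r n : ℕ} (h : r ≤ p) (T : Fin n ≃ (twoRow r p).cells) :
    polytabloid (twoRow r p) T = ∑ e : Fin r → Bool,
      Finsupp.single (rangeTabloid fun j => columnPairs h T (j, e j))
        (∏ j, if e j then -1 else 1) := by
  set b := columnPairs h T with hb
  have hcol : ∀ j x, (T (b (j, x))).1.2 = j.val := fun j x => by
    rw [hb, columnPairs_apply]
  have hrow : ∀ j x, (T (b (j, x))).1.1 = if x then 0 else 1 := fun j x => by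
    rw [hb, columnPairs_apply]
  have hrow' : ∀ i, i ∉ Set.range b → (T i).1.1 = 0 := by
    intro i hi
    rw [hb, mem_range_columnPairs] at hi
    rcases (mem_twoRow _).1 (T i).2 with ⟨h1, -⟩ | ⟨-, h2⟩
    · exact h1
    · rw [min_eq_left h] at h2; exact absurd h2 hi
  rw [polytabloid]
  symm
  refine Finset.sum_bij (fun e _ => pairSwap b e) ?_ ?_ ?_ ?_
  · intro e _
    rw [Finset.mem_filter]
    refine ⟨Finset.mem_univ _, fun i => ?_⟩
    by_cases hi : i ∈ Set.range b
    · obtain ⟨⟨j, x⟩, rfl⟩ := hi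
      rw [pairSwap_apply, hcol, hcol]
    · rw [pairSwap_apply_of_notMem b e i hi]
  · intro e _ e' _ hee
    ext1 j
    have := congrArg (fun q : Equiv.Perm (Fin n) => q (b (j, false))) hee
    simp only [pairSwap_apply] at this
    have := b.injective this
    simpa using this
  · intro q hq
    have hq := (Finset.mem_filter.1 hq).2
    have hmem : ∀ j x, q (b (j, x)) = b (j, false) ∨ q (b (j, x)) = b (j, true) := by
      intro j x
      have h1 : q (b (j, x)) ∈ Set.range b := by
        rw [hb, mem_range_columnPairs, hq, ← hb, hcol]; exact j.2
      obtain ⟨⟨j', y⟩, hy⟩ := h1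
      have h2 : j' = j := by
        apply Fin.ext
        rw [← hcol j' y, hy, hq, hcol]
      subst h2
      cases y
      · exact Or.inl hy.symm
      · exact Or.inr hy.symm
    refine ⟨fun j => decide (q (b (j, false)) ≠ b (j, false)), Finset.mem_univ _, ?_⟩
    ext1 i
    by_cases hi : i ∈ Set.range b
    · obtain ⟨⟨j, x⟩, rfl⟩ := hi
      rw [pairSwap_apply]
      have hne : b (j, false) ≠ b (j, true) := fun h' => by
        have := b.injective h'
        simp at this
      have hne' : q (b (j, false)) ≠ q (b (j, true)) := fun h' => hne (q.injective h')
      rcases hmem j false with h1 | h1 <;> rcases hmem j true with h2 | h2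
      · exact absurd (h1.trans h2.symm) hne'
      · cases x <;> simp [h1, h2]
      · cases x <;> simp [h1, h2, hne.symm]
      · exact absurd (h1.trans h2.symm) hne'
    · rw [pairSwap_apply_of_notMem _ _ i hi]
      apply T.injective
      have hc := hq i
      have hi' : q i ∉ Set.range b := by
        rw [hb, mem_range_columnPairs, hc, ← mem_range_columnPairs h, ← hb]; exact hi
      exact Subtype.ext (Prod.ext ((hrow' _ hi).trans (hrow' _ hi').symm) hc.symm)
  · intro e _
    rw [sign_pairSwap, pairSwap_inv]
    congr 1
    ext i
    by_cases hi : i ∈ Set.range b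
    · obtain ⟨⟨j, x⟩, rfl⟩ := hi
      rw [pairSwap_apply, hrow, rangeTabloid]
      have : b (j, x) ∈ Set.range (fun j => b (j, e j)) ↔ x = e j := by
        constructor
        · rintro ⟨j', hj'⟩
          have := b.injective hj'
          simp only [Prod.mk.injEq] at this
          rw [← this.2, this.1]
        · rintro rfl; exact ⟨j, rfl⟩
      simp only [this]
      cases x <;> cases e j <;> simp
    · rw [pairSwap_apply_of_notMem _ _ i hi, hrow' i hi, rangeTabloid, if_neg]
      rintro ⟨j, rfl⟩
      exact hi ⟨_, rfl⟩

/-- The values of a combination of tabloids with two rows, as a function of the second row. -/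
def tabloidEval (r n : ℕ) : ((Fin n → ℕ) →₀ ℂ) →ₗ[ℂ] ((Fin r → Fin n) → ℂ) :=
  open Classical in
  { toFun := fun x f => if Function.Injective f then x (rangeTabloid f) else 0
    map_add' := fun x y => by ext f; by_cases h : Function.Injective f <;> simp [h]
    map_smul' := fun c x => by ext f; by_cases h : Function.Injective f <;> simp [h] }

lemma tabloidEval_apply {r n : ℕ} (x : (Fin n → ℕ) →₀ ℂ) (f : Fin r → Fin n)
    (hf : Function.Injective f) : tabloidEval r n x f = x (rangeTabloid f) := if_pos hf

lemma tabloidEval_rep {r n : ℕ} (w : WB n) (x : (Fin n → ℕ) →₀ ℂ) :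
    tabloidEval r n (tabloidRep n w.right x) = tupleRep n r 0 0 w (tabloidEval r n x) := by
  classical
  ext f
  rw [tupleRep_apply, pow_zero, pow_zero, one_mul, one_mul]
  by_cases hf : Function.Injective f
  · rw [tabloidEval_apply _ _ hf, tabloidRep_apply,
      tabloidEval_apply _ (fun j => w.right⁻¹ (f j)) (w.right⁻¹.injective.comp hf)]
    congr 1
    ext i
    simp only [rangeTabloid]
    congr 1
    simp only [Set.mem_range, eq_iff_iff]
    exact exists_congr fun j => by rw [Equiv.Perm.inv_eq_iff_eq]
  · have : ¬ Function.Injective fun j => w.right⁻¹ (f j) := fun h =>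
      hf fun u v huv => h (by simp [huv])
    change ite _ _ _ = ite _ _ _
    rw [if_neg hf, if_neg this]

lemma tabloidEval_polytabloid {p r n : ℕ} (h : r ≤ p) (T : Fin n ≃ (twoRow r p).cells) :
    tabloidEval r n (polytabloid (twoRow r p) T) = pairFun (columnPairs h T) := by
  classical
  ext f
  rw [pairFun]
  set b := columnPairs h T
  have hbe : ∀ e : Fin r → Bool, Function.Injective fun j => b (j, e j) := fun e i j hij => by
    have := b.injective hij
    exact (Prod.mk.inj this).1
  by_cases hf : Function.Injective f
  · rw [tabloidEval_apply _ _ hf, polytabloid_twoRow h, Finsupp.finsetSum_apply]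
    refine Finset.sum_congr rfl fun e _ => ?_
    by_cases hr : Set.range (fun j => b (j, e j)) = Set.range f
    · obtain ⟨σ, hσ⟩ := exists_perm_of_range_eq _ _ hf (hbe e) hr.symm
      rw [(rangeTabloid_eq_iff _ _).2 hr, Finsupp.single_eq_same, hσ, orbitSum_comp,
        orbitSum_self _ (hbe e), mul_one]
    · rw [Finsupp.single_eq_of_ne, orbitSum_eq_zero, mul_zero]
      · rintro ⟨σ, rfl⟩
        exact hr (σ.surjective.range_comp _).symm
      · exact fun h' => hr ((rangeTabloid_eq_iff _ _).1 h'.symm)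
  · change ite _ _ _ = _
    rw [if_neg hf]
    symm
    exact Finset.sum_eq_zero fun e _ => by rw [(orbitSum_mem _ (hbe e)).2 f hf, mul_zero]

lemma tupleRep_orbitSum {a k : ℕ} (w : WB a) (f : Fin k → Fin a) :
    tupleRep a k 0 0 w (orbitSum f) = orbitSum fun j => w.right (f j) := by
  ext g
  rw [tupleRep_apply, pow_zero, pow_zero, one_mul, one_mul, orbitSum, orbitSum]
  refine Finset.sum_congr rfl fun σ _ => ?_
  congr 1
  simp only [funext_iff, Function.comp_apply, Equiv.Perm.inv_eq_iff_eq]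

lemma tupleRep_pairFun {a r : ℕ} (w : WB a) (b : Fin r × Bool → Fin a) :
    tupleRep a r 0 0 w (pairFun b) = pairFun fun x => w.right (b x) := by
  have h1 : ∀ b : Fin r × Bool → Fin a, pairFun b = ∑ e : Fin r → Bool,
      ((∏ j, if e j then -1 else 1 : ℂ)) • orbitSum fun j => b (j, e j) := by
    intro b; ext g; simp [pairFun, Finset.sum_apply]
  rw [h1, h1, map_sum]
  refine Finset.sum_congr rfl fun e _ => ?_
  rw [map_smul, tupleRep_orbitSum]

/-- A tabloid of this shape is determined by its second row, which gives injectivity. For the image,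
any system of `r` disjoint pairs is a permutation of the column pairs of one tableau. -/
lemma specht_twoRow {p r a : ℕ} (h : p + r = a) (hr : r ≤ p) :
    Function.Injective (tabloidEval r a ∘ₗ spechtVal a (twoRow r p)) ∧
    LinearMap.range (tabloidEval r a ∘ₗ spechtVal a (twoRow r p)) =
      Submodule.span ℂ (pairFun '' {b | Function.Injective b}) := by
  classical
  have himage : ∀ (π : Equiv.Perm (Fin a)) (T : Fin a ≃ (twoRow r p).cells),
      tabloidEval r a (tabloidRep a π (polytabloid (twoRow r p) T)) =
        pairFun fun x => π (columnPairs hr T x) := by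
    intro π T
    have := tabloidEval_rep (r := r) (SemidirectProduct.inr π : WB a)
      (polytabloid (twoRow r p) T)
    rw [tabloidEval_polytabloid hr, tupleRep_pairFun] at this
    exact this
  constructor
  · rw [injective_iff_map_eq_zero]
    intro y hy
    apply spechtVal_injective
    rw [map_zero]
    -- `tabloidEval` sees only tabloids with exactly `r` entries in the second row and none below;
    -- polytabloids and their translates are supported there.
    have hsupp : LinearMap.range (spechtVal a (twoRow r p)) ≤ Finsupp.supported ℂ ℂ
        {t | ∃ f : Fin r → Fin a, Function.Injective f ∧ t = rangeTabloid f} := by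
      rw [range_spechtVal, Submodule.span_le]
      rintro _ ⟨π, T, rfl⟩
      rw [polytabloid_twoRow hr, map_sum]
      refine Submodule.sum_mem _ fun e _ => ?_
      set f : Fin r → Fin a := fun j => columnPairs hr T (j, e j) with hf
      have hfi : Function.Injective f := fun i j hij =>
        (Prod.mk.inj ((columnPairs hr T).injective hij)).1
      change Finsupp.mapDomain _ _ ∈ _
      rw [Finsupp.mapDomain_single]
      apply Finsupp.single_mem_supported
      refine ⟨fun j => π (f j), π.injective.comp hfi, ?_⟩
      ext i
      simp only [rangeTabloid]
      congr 1
      simp only [Set.mem_range, eq_iff_iff]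
      exact exists_congr fun j => by rw [Equiv.Perm.eq_inv_iff_eq]
    ext t
    by_contra hne
    obtain ⟨f, hf, rfl⟩ := (Finsupp.mem_supported _ _).1 (hsupp ⟨y, rfl⟩)
      (Finsupp.mem_support_iff.2 hne)
    apply hne
    have := congrFun hy f
    rwa [LinearMap.comp_apply, tabloidEval_apply _ _ hf] at this
  · rw [LinearMap.range_comp, range_spechtVal, Submodule.map_span]
    congr 1
    ext φ
    constructor
    · rintro ⟨_, ⟨π, T, rfl⟩, rfl⟩
      exact ⟨_, π.injective.comp (columnPairs hr T).injective, (himage π T).symm⟩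
    · rintro ⟨b, hb, rfl⟩
      obtain ⟨T⟩ := exists_tableau (show r + p = a by omega)
      obtain ⟨π, hπ⟩ := exists_perm_comp (columnPairs hr T) b (columnPairs hr T).injective hb
      refine ⟨_, ⟨π, T, rfl⟩, ?_⟩
      rw [himage]
      congr 1
      ext1 x
      exact hπ x

/-! ### Specht modules with one row -/

/-- The coordinate of an element of the one-dimensional Specht module with one row. -/
def oneRowCoord (n : ℕ) : SpechtSpace n (oneRow n) →ₗ[ℂ] ℂ :=
  Finsupp.lapply (fun _ => 0) ∘ₗ spechtVal n (oneRow n)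

lemma polytabloid_oneRow {n : ℕ} (T : Fin n ≃ (oneRow n).cells) :
    polytabloid (oneRow n) T = Finsupp.single (fun _ => 0) 1 := by
  have hrow : ∀ c : (oneRow n).cells, c.1.1 = 0 := fun c => by
    rcases (mem_twoRow _).1 c.2 with h | h
    · exact h.1
    · have := h.2; simp at this
  rw [polytabloid, Finset.sum_eq_single 1]
  · simp only [hrow]; simp
  · intro q hq hne
    exfalso
    apply hne
    ext1 i
    apply T.injective
    exact Subtype.ext (Prod.ext ((hrow _).trans (hrow _).symm) ((Finset.mem_filter.1 hq).2 i))
  · intro h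
    exact absurd (Finset.mem_filter.2 ⟨Finset.mem_univ _, fun _ => rfl⟩) h

lemma spechtVal_oneRow {n : ℕ} (y : SpechtSpace n (oneRow n)) :
    spechtVal n (oneRow n) y = Finsupp.single (fun _ => 0) (oneRowCoord n y) := by
  have h : LinearMap.range (spechtVal n (oneRow n)) ≤
      Submodule.span ℂ {Finsupp.single (fun _ => 0) (1 : ℂ)} := by
    rw [range_spechtVal, Submodule.span_le]
    rintro _ ⟨π, T, rfl⟩
    rw [polytabloid_oneRow]
    change Finsupp.mapDomain _ _ ∈ _
    rw [Finsupp.mapDomain_single]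
    exact Submodule.mem_span_singleton_self _
  obtain ⟨c, hc⟩ := Submodule.mem_span_singleton.1 (h ⟨y, rfl⟩)
  have : oneRowCoord n y = c := by
    change spechtVal n (oneRow n) y (fun _ => 0) = c
    rw [← hc]; simp
  rw [this, ← hc]; simp

lemma exists_oneRow (n : ℕ) : ∃ z : SpechtSpace n (oneRow n), oneRowCoord n z = 1 := by
  obtain ⟨T⟩ : Nonempty (Fin n ≃ (oneRow n).cells) := exists_tableau (show n + 0 = n by omega)
  have : polytabloid (oneRow n) T ∈ LinearMap.range (spechtVal n (oneRow n)) := by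
    rw [range_spechtVal]
    exact Submodule.subset_span ⟨1, T, by simp⟩
  obtain ⟨z, hz⟩ := this
  refine ⟨z, ?_⟩
  change spechtVal n (oneRow n) z (fun _ => 0) = 1
  rw [hz, polytabloid_oneRow]; simp

lemma eq_smul_oneRow {n : ℕ} {z : SpechtSpace n (oneRow n)} (hz : oneRowCoord n z = 1)
    (y : SpechtSpace n (oneRow n)) : y = oneRowCoord n y • z := by
  apply spechtVal_injective
  rw [map_smul, spechtVal_oneRow z, hz, spechtVal_oneRow y]; simp

lemma spechtRep_oneRow {n : ℕ} (π : Equiv.Perm (Fin n)) (y : SpechtSpace n (oneRow n)) :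
    spechtRep n (oneRow n) π y = y := by
  apply spechtVal_injective
  rw [spechtVal_rep, spechtVal_oneRow y]
  change Finsupp.mapDomain _ _ = _
  rw [Finsupp.mapDomain_single]

/-! ### Models of the representations of the Weyl groups -/

lemma pairEmb_right {k l n : ℕ} (h : k + l = n) (w : WB k × WB l) (x : Fin k ⊕ Fin l) :
    (pairEmb h w).right ((finSumFinEquiv.trans (finCongr h)) x) =
      (finSumFinEquiv.trans (finCongr h)) (Equiv.Perm.sumCongr w.1.right w.2.right x) := by
  change (finSumFinEquiv.trans (finCongr h)).permCongr _ _ = _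
  rw [Equiv.permCongr_apply, Equiv.symm_apply_apply]

lemma pairEmb_left {k l n : ℕ} (h : k + l = n) (w : WB k × WB l) (x : Fin k ⊕ Fin l) :
    (pairEmb h w).left ((finSumFinEquiv.trans (finCongr h)) x) =
      Sum.elim w.1.left w.2.left x := by
  change Sum.elim w.1.left w.2.left ((finSumFinEquiv.trans (finCongr h)).symm _) = _
  rw [Equiv.symm_apply_apply]

lemma signProd_pairEmb {k l n : ℕ} (h : k + l = n) (w : WB k × WB l) :
    signProd n (pairEmb h w) = signProd k w.1 * signProd l w.2 := by
  change ∏ i, (pairEmb h w).left i = (∏ i, w.1.left i) * ∏ i, w.2.left i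
  rw [← Equiv.prod_comp (finSumFinEquiv.trans (finCongr h))]
  simp only [pairEmb_left, Fintype.prod_sum_type, Sum.elim_inl, Sum.elim_inr]

/-- A permutation preserving the last block also preserves the first one, and the signs are
unrestricted. -/
lemma exists_pairEmb {k l n : ℕ} (h : k + l = n) (g : WB n)
    (hg : ∀ j : Fin l, ∃ j' : Fin l, g.right ((finSumFinEquiv.trans (finCongr h)) (Sum.inr j)) =
      (finSumFinEquiv.trans (finCongr h)) (Sum.inr j')) : ∃ w, pairEmb h w = g := by
  set e := finSumFinEquiv.trans (finCongr h) with he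
  let τ : Equiv.Perm (Fin k ⊕ Fin l) := e.symm.permCongr g.right
  have hτ : ∀ x, e (τ x) = g.right (e x) := fun x => by simp [τ, Equiv.permCongr_apply]
  have hmap : Set.MapsTo τ (Set.range Sum.inl) (Set.range Sum.inl) := by
    rw [Equiv.Perm.perm_mapsTo_inl_iff_mapsTo_inr]
    rintro _ ⟨j, rfl⟩
    obtain ⟨j', hj'⟩ := hg j
    exact ⟨j', e.injective (by rw [hτ, hj'])⟩
  obtain ⟨⟨π₁, π₂⟩, hπ⟩ := Equiv.Perm.mem_sumCongrHom_range_of_perm_mapsTo_inl hmap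
  rw [Equiv.Perm.sumCongrHom_apply] at hπ
  refine ⟨(⟨fun j => g.left (e (Sum.inl j)), π₁⟩, ⟨fun j => g.left (e (Sum.inr j)), π₂⟩), ?_⟩
  apply SemidirectProduct.ext
  · ext1 i
    obtain ⟨x, rfl⟩ := e.surjective i
    rw [he, pairEmb_left]
    rcases x with x | x <;> rfl
  · ext1 i
    obtain ⟨x, rfl⟩ := e.surjective i
    rw [← hτ, he, pairEmb_right]
    congr 1
    exact DFunLike.congr_fun hπ x

lemma exists_pairEmb_left {k l n : ℕ} (h : k + l = n) (g : WB n)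
    (hg : ∀ j : Fin k, ∃ j' : Fin k, g.right ((finSumFinEquiv.trans (finCongr h)) (Sum.inl j)) =
      (finSumFinEquiv.trans (finCongr h)) (Sum.inl j')) : ∃ w, pairEmb h w = g := by
  apply exists_pairEmb
  set e := finSumFinEquiv.trans (finCongr h) with he
  let τ : Equiv.Perm (Fin k ⊕ Fin l) := e.symm.permCongr g.right
  have hτ : ∀ x, e (τ x) = g.right (e x) := fun x => by simp [τ, Equiv.permCongr_apply]
  have hmap : Set.MapsTo τ (Set.range Sum.inl) (Set.range Sum.inl) := by
    rintro _ ⟨j, rfl⟩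
    obtain ⟨j', hj'⟩ := hg j
    exact ⟨j', e.injective (by rw [hτ, hj'])⟩
  rw [Equiv.Perm.perm_mapsTo_inl_iff_mapsTo_inr] at hmap
  intro j
  obtain ⟨j', hj'⟩ := hmap ⟨j, rfl⟩
  exact ⟨j', by rw [hj', hτ]⟩

lemma tupleRep_mem_symTuples {a k u v : ℕ} (w : WB a) (φ : (Fin k → Fin a) → ℂ)
    (hφ : φ ∈ symTuples k a) : tupleRep a k u v w φ ∈ symTuples k a := by
  refine ⟨fun f σ => ?_, fun f hf => ?_⟩
  · rw [tupleRep_apply, tupleRep_apply]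
    have h1 : ∏ j, ((w.left ((f ∘ σ) j) : ℤ) : ℂ) = ∏ j, ((w.left (f j) : ℤ) : ℂ) :=
      Equiv.prod_comp σ fun j => ((w.left (f j) : ℤ) : ℂ)
    rw [h1]
    congr 1
    exact hφ.1 (fun j => w.right⁻¹ (f j)) σ
  · rw [tupleRep_apply, hφ.2, mul_zero]
    exact fun h => hf fun u v huv => h (by simp [huv])

lemma tupleRep_inl {a k v : ℕ} (ε : Fin a → ℤˣ) (φ : (Fin k → Fin a) → ℂ) :
    tupleRep a k 1 v (SemidirectProduct.inl ε) φ =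
      (((∏ i, ε i : ℤˣ) : ℤ) : ℂ) ^ v • fun f => ((tupleSign f ε : ℤ) : ℂ) * φ f := by
  ext f
  rw [tupleRep_apply, pow_one]
  have h1 : signProd a (SemidirectProduct.inl ε) = ∏ i, ε i := rfl
  rw [h1]
  simp [tupleSign_apply, mul_assoc]

/-- `tupleRep` of a sign change differs from multiplication by `tupleSign` only by a global sign,
which does not matter for membership in a subspace. -/
lemma mul_tupleSign_mem {a k v : ℕ} (S : Submodule ℂ ((Fin k → Fin a) → ℂ)) (ε : Fin a → ℤˣ)
    (hS : ∀ φ ∈ S, tupleRep a k 1 v (SemidirectProduct.inl ε) φ ∈ S)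
    (φ : (Fin k → Fin a) → ℂ) (hφ : φ ∈ S) :
    (fun f => ((tupleSign f ε : ℤ) : ℂ) * φ f) ∈ S := by
  have h := hS φ hφ
  rw [tupleRep_inl] at h
  exact (S.smul_mem_iff (pow_ne_zero _ (Int.cast_ne_zero.2 (Units.ne_zero _)))).1 h

lemma pairRep_apply_tmul {k l : ℕ} {μ ν : YoungDiagram} (w : WB k × WB l) (y : SpechtSpace k μ)
    (z : SpechtSpace l ν) : pairRep k l μ ν w (y ⊗ₜ z) =
      ((signProd l w.2 : ℤ) : ℂ) • (spechtRep k μ w.1.right y ⊗ₜ spechtRep l ν w.2.right z) := by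
  change spechtRep k μ w.1.right y ⊗ₜ[ℂ] (((signProd l w.2 : ℤ) : ℂ) • spechtRep l ν w.2.right z) = _
  rw [TensorProduct.tmul_smul]

/-- If the stabilizer of the set of entries of `f₀` is `W(B_p) × W(B_q)` and it acts on the
indicator function of this set as in the definition of `σ((p),(q))`, then this representation is
realized in the space of all functions of `k`-subsets. -/
lemma exists_model_oneRow {p q a k v : ℕ} (h : p + q = a) (f₀ : Fin k → Fin a)
    (hf₀ : Function.Injective f₀)
    (hR : ∀ w : WB p × WB q, tupleRep a k 1 v (pairEmb h w) (orbitSum f₀) =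
      ((signProd q w.2 : ℤ) : ℂ) • orbitSum f₀)
    (hstab : ∀ g : WB a, (∃ σ : Equiv.Perm (Fin k), (fun j => g.right (f₀ j)) = f₀ ∘ σ) →
      ∃ w, pairEmb h w = g) :
    ∃ ψ : Representation.IndV (k := ℂ) (A := PairSpace p q (oneRow p) (oneRow q)) (pairEmb h)
        (pairRep p q (oneRow p) (oneRow q)) →ₗ[ℂ] ((Fin k → Fin a) → ℂ),
      Function.Injective ψ ∧
      (∀ w x, ψ (sigmaRep h (oneRow p) (oneRow q) w x) = tupleRep a k 1 v w (ψ x)) ∧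
      LinearMap.range ψ = symTuples k a := by
  classical
  obtain ⟨z₁, hz₁⟩ := exists_oneRow p
  obtain ⟨z₂, hz₂⟩ := exists_oneRow q
  set R := tupleRep a k 1 v
  set ρ := pairRep p q (oneRow p) (oneRow q) with hρ
  let ev : PairSpace p q (oneRow p) (oneRow q) →ₗ[ℂ] ℂ :=
    LinearMap.mul' ℂ ℂ ∘ₗ TensorProduct.map (oneRowCoord p) (oneRowCoord q)
  have hev : ∀ y z, ev (y ⊗ₜ z) = oneRowCoord p y * oneRowCoord q z := fun y z => by simp [ev]
  have hspan : ∀ x, x = ev x • (z₁ ⊗ₜ[ℂ] z₂) := by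
    intro x
    induction x using TensorProduct.induction_on with
    | zero => simp
    | tmul y z =>
      rw [hev]
      conv_lhs => rw [eq_smul_oneRow hz₁ y, eq_smul_oneRow hz₂ z]
      rw [TensorProduct.smul_tmul_smul]
    | add x y hx hy => rw [map_add, add_smul, ← hx, ← hy]
  have hρx : ∀ w x, ρ w x = ((signProd q w.2 : ℤ) : ℂ) • x := by
    intro w x
    induction x using TensorProduct.induction_on with
    | zero => simp
    | tmul y z => rw [hρ, pairRep_apply_tmul, spechtRep_oneRow, spechtRep_oneRow]
    | add x y hx hy => rw [map_add, smul_add, hx, hy]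
  -- The inducing space is the line spanned by `z₁ ⊗ z₂`; this vector is sent to the indicator
  -- function of the set of entries of `f₀`.
  let l : PairSpace p q (oneRow p) (oneRow q) →ₗ[ℂ] ((Fin k → Fin a) → ℂ) :=
    ev.smulRight (orbitSum f₀)
  obtain ⟨ψ, hψ, hψmk⟩ := exists_ind_lift (pairEmb h) ρ R l (by
    intro w x
    simp only [l, LinearMap.smulRight_apply, map_smul, hρx, hR]
    rw [smul_comm])
  have hl : l (z₁ ⊗ₜ z₂) = orbitSum f₀ := by simp [l, hev, hz₁, hz₂]
  let mk : WB a → Representation.IndV (k := ℂ) (A := PairSpace p q (oneRow p) (oneRow q))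
    (pairEmb h) ρ := fun g => Representation.IndV.mk (pairEmb h) ρ g (z₁ ⊗ₜ z₂)
  have hψ' : ∀ g, ψ (mk g) = R g⁻¹ (orbitSum f₀) := fun g => by rw [hψmk, hl]
  have hind : ∀ g g', Representation.ind (pairEmb h) ρ g (mk g') = mk (g' * g⁻¹) := fun g g' =>
    Representation.ind_mk _ _ _ _ _
  have hmkspan : Submodule.span ℂ (Set.range mk) = ⊤ := by
    rw [eq_top_iff, ← IndV_span, Submodule.span_le]
    rintro _ ⟨g, x, rfl⟩
    rw [hspan x, map_smul]
    exact Submodule.smul_mem _ _ (Submodule.subset_span ⟨g, rfl⟩)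
  have hmk : ∀ w, mk (pairEmb h w)⁻¹ = ((signProd q w.2 : ℤ) : ℂ) • mk 1 := by
    intro w
    have := IndV_mk_mul (pairEmb h) ρ w (pairEmb h w)⁻¹ (z₁ ⊗ₜ z₂)
    rw [mul_inv_cancel, hρx, map_smul] at this
    exact this.symm
  let _ : Fintype (WB a) := Fintype.ofEquiv _ SemidirectProduct.equivProd.symm
  -- An equivariant map in the opposite direction, obtained by summing over the group. On `orbitSum
  -- f₀` only the stabilizer contributes, each element giving `mk 1` because its sign occurs twice.
  -- Hence `θ ∘ ψ` is multiplication by the order `N` of the stabilizer.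
  let θ : ((Fin k → Fin a) → ℂ) →ₗ[ℂ] Representation.IndV (k := ℂ)
      (A := PairSpace p q (oneRow p) (oneRow q)) (pairEmb h) ρ :=
    ∑ g : WB a, (LinearMap.proj f₀ ∘ₗ R g⁻¹).smulRight (mk g⁻¹)
  have hθ : ∀ φ, θ φ = ∑ g : WB a, (R g⁻¹ φ) f₀ • mk g⁻¹ := fun φ => by simp [θ]
  have hθR : ∀ g φ, θ (R g φ) = Representation.ind (pairEmb h) ρ g (θ φ) := by
    intro g φ
    rw [hθ, hθ, map_sum, ← Equiv.sum_comp (Equiv.mulLeft g)]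
    refine Finset.sum_congr rfl fun g' _ => ?_
    rw [map_smul, hind, Equiv.coe_mulLeft, mul_inv_rev, ← Module.End.mul_apply, ← map_mul,
      inv_mul_cancel_right]
  have horb : orbitSum f₀ f₀ = 1 := orbitSum_self f₀ hf₀
  have hθ1 : θ (orbitSum f₀) =
      ((Finset.univ.filter fun g : WB a => ∃ w, pairEmb h w = g).card : ℂ) • mk 1 := by
    rw [hθ, ← Finset.sum_filter_add_sum_filter_not _ (fun g : WB a => ∃ w, pairEmb h w = g)]
    have h1 : ∀ g ∈ Finset.univ.filter (fun g : WB a => ∃ w, pairEmb h w = g),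
        (R g⁻¹ (orbitSum f₀)) f₀ • mk g⁻¹ = mk 1 := by
      intro g hg
      obtain ⟨w, rfl⟩ := (Finset.mem_filter.1 hg).2
      rw [hmk, ← map_inv, hR, Pi.smul_apply, horb, smul_smul, Prod.snd_inv, map_inv,
        Int.units_inv_eq_self, smul_eq_mul, mul_one, IntUnits.cast_mul_self, one_smul]
    have h2 : ∀ g ∈ Finset.univ.filter (fun g : WB a => ¬ ∃ w, pairEmb h w = g),
        (R g⁻¹ (orbitSum f₀)) f₀ • mk g⁻¹ = 0 := by
      intro g hg
      have hg' := (Finset.mem_filter.1 hg).2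
      rw [tupleRep_apply, orbitSum_eq_zero, mul_zero, zero_smul]
      rintro ⟨σ, hσ⟩
      apply hg'
      apply hstab
      refine ⟨σ, ?_⟩
      rw [← hσ]
      ext1 j
      simp
    rw [Finset.sum_congr rfl h1, Finset.sum_eq_zero h2, add_zero, Finset.sum_const,
      ← Nat.cast_smul_eq_nsmul ℂ]
  set N : ℂ := ((Finset.univ.filter fun g : WB a => ∃ w, pairEmb h w = g).card : ℂ) with hN
  have hN0 : N ≠ 0 := by
    rw [hN, Nat.cast_ne_zero, ← Nat.pos_iff_ne_zero, Finset.card_pos]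
    exact ⟨1, Finset.mem_filter.2 ⟨Finset.mem_univ _, 1, map_one _⟩⟩
  have hθψ : ∀ x, θ (ψ x) = N • x := by
    have : θ ∘ₗ ψ = N • LinearMap.id := by
      apply LinearMap.ext_on hmkspan
      rintro _ ⟨g, rfl⟩
      rw [LinearMap.comp_apply, hψ', hθR, hθ1, map_smul, hind, one_mul, inv_inv]
      rfl
    exact fun x => LinearMap.congr_fun this x
  refine ⟨ψ, ?_, hψ, ?_⟩
  · intro x y hxy
    have := hθψ x
    rw [hxy, hθψ] at this
    exact (smul_right_injective _ hN0 this).symm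
  · apply le_antisymm
    · rw [LinearMap.range_eq_map, ← hmkspan, Submodule.map_span, Submodule.span_le]
      rintro _ ⟨_, ⟨g, rfl⟩, rfl⟩
      rw [hψ']
      exact tupleRep_mem_symTuples _ _ (orbitSum_mem f₀ hf₀)
    · have hle : LinearMap.range ψ ≤ symTuples k a := by
        rw [LinearMap.range_eq_map, ← hmkspan, Submodule.map_span, Submodule.span_le]
        rintro _ ⟨_, ⟨g, rfl⟩, rfl⟩
        rw [hψ']
        exact tupleRep_mem_symTuples _ _ (orbitSum_mem f₀ hf₀)
      apply symTuples_le _ hle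
      · intro ε
        apply mul_tupleSign_mem (v := v)
        rintro _ ⟨x, rfl⟩
        exact ⟨_, hψ _ x⟩
      · intro f hf
        obtain ⟨π, hπ⟩ := exists_perm_comp f₀ f hf₀ hf
        refine ⟨_, ⟨mk (SemidirectProduct.inr π)⁻¹, rfl⟩, ?_⟩
        rw [hψ', inv_inv, tupleRep_apply]
        have h1 : (fun j => (SemidirectProduct.inr π : WB a).right⁻¹ (f j)) = f₀ := by
          ext1 j
          rw [← hπ]
          exact π.symm_apply_apply _
        rw [h1, horb, mul_one]
        refine mul_ne_zero (pow_ne_zero _ (by simp)) (pow_ne_zero _ (prod_units_ne_zero _ _))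

lemma tupleRep_orbitSum_stable {a k v : ℕ} (g : WB a) (f₀ : Fin k → Fin a)
    (ρ : Equiv.Perm (Fin k)) (hρ : ∀ j, g.right (f₀ j) = f₀ (ρ j)) (c : ℂ)
    (hc : ((signProd a g : ℤ) : ℂ) ^ v * ∏ j, ((g.left (f₀ j) : ℤ) : ℂ) = c) :
    tupleRep a k 1 v g (orbitSum f₀) = c • orbitSum f₀ := by
  ext f
  rw [tupleRep_apply, pow_one, Pi.smul_apply, smul_eq_mul]
  have h1 : orbitSum f₀ (fun j => g.right⁻¹ (f j)) = orbitSum f₀ f := by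
    rw [orbitSum, orbitSum,
      ← Equiv.sum_comp (Equiv.mulLeft ρ) (fun σ => if f = f₀ ∘ σ then (1 : ℂ) else 0)]
    refine Finset.sum_congr rfl fun σ _ => ?_
    congr 1
    simp only [funext_iff, Function.comp_apply, Equiv.Perm.inv_eq_iff_eq, hρ]
    rfl
  rw [h1]
  by_cases h2 : ∃ σ : Equiv.Perm (Fin k), f = f₀ ∘ σ
  · obtain ⟨σ, rfl⟩ := h2
    rw [← hc]
    congr 2
    exact Equiv.prod_comp σ fun j => ((g.left (f₀ j) : ℤ) : ℂ)
  · rw [orbitSum_eq_zero _ _ h2]; simp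

/-- The base point is the set of the last `k` indices, where the signs occur in the definition of
`σ[(p),(k)]`. -/
lemma exists_model_last {p k a : ℕ} (h : p + k = a) :
    ∃ ψ : Representation.IndV (k := ℂ) (A := PairSpace p k (oneRow p) (oneRow k)) (pairEmb h)
        (pairRep p k (oneRow p) (oneRow k)) →ₗ[ℂ] ((Fin k → Fin a) → ℂ),
      Function.Injective ψ ∧
      (∀ w x, ψ (sigmaRep h (oneRow p) (oneRow k) w x) = tupleRep a k 1 0 w (ψ x)) ∧
      LinearMap.range ψ = symTuples k a := by
  have hinj : Function.Injective fun j : Fin k => (finSumFinEquiv.trans (finCongr h)) (Sum.inr j) :=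
    (finSumFinEquiv.trans (finCongr h)).injective.comp Sum.inr_injective
  refine exists_model_oneRow h _ hinj (fun w => ?_) (fun g ⟨σ, hσ⟩ => ?_)
  · apply tupleRep_orbitSum_stable _ _ w.2.right
    · intro j; rw [pairEmb_right]; rfl
    · simp only [pairEmb_left, Sum.elim_inr, pow_zero, one_mul]
      have : signProd k w.2 = ∏ j, w.2.left j := rfl
      rw [this]; push_cast; rfl
  · exact exists_pairEmb h g fun j => ⟨σ j, congrFun hσ j⟩

/-- Now the base point is the set of the first `k` indices. The product of all signs times the signs
at this set is the product of the signs at the last `p` indices, which is why `v = 1`. -/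
lemma exists_model_first {k p a : ℕ} (h : k + p = a) :
    ∃ ψ : Representation.IndV (k := ℂ) (A := PairSpace k p (oneRow k) (oneRow p)) (pairEmb h)
        (pairRep k p (oneRow k) (oneRow p)) →ₗ[ℂ] ((Fin k → Fin a) → ℂ),
      Function.Injective ψ ∧
      (∀ w x, ψ (sigmaRep h (oneRow k) (oneRow p) w x) = tupleRep a k 1 1 w (ψ x)) ∧
      LinearMap.range ψ = symTuples k a := by
  have hinj : Function.Injective fun j : Fin k => (finSumFinEquiv.trans (finCongr h)) (Sum.inl j) :=
    (finSumFinEquiv.trans (finCongr h)).injective.comp Sum.inl_injective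
  refine exists_model_oneRow h _ hinj (fun w => ?_) (fun g ⟨σ, hσ⟩ => ?_)
  · apply tupleRep_orbitSum_stable _ _ w.1.right
    · intro j; rw [pairEmb_right]; rfl
    · simp only [pairEmb_left, Sum.elim_inl, pow_one, signProd_pairEmb]
      have : ∏ j, ((w.1.left j : ℤ) : ℂ) = ((signProd k w.1 : ℤ) : ℂ) := by
        have h1 : signProd k w.1 = ∏ j, w.1.left j := rfl
        rw [h1]; push_cast; rfl
      rw [this]
      push_cast
      linear_combination ((signProd p w.2 : ℤ) : ℂ) * IntUnits.cast_mul_self (signProd k w.1)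
  · exact exists_pairEmb_left h g fun j => ⟨σ j, congrFun hσ j⟩

/-- The indicator function of the injective tuples. -/
def injFun (k a : ℕ) : (Fin k → Fin a) → ℂ :=
  open Classical in fun f => if Function.Injective f then 1 else 0

lemma injFun_comp {k a : ℕ} (f : Fin k → Fin a) (π : Equiv.Perm (Fin a)) :
    injFun k a (fun j => π (f j)) = injFun k a f := by
  simp only [injFun]
  congr 1
  exact propext (π.injective.of_comp_iff f)

lemma injFun_mem (k a : ℕ) : injFun k a ∈ symTuples k a := by
  refine ⟨fun f σ => ?_, fun f hf => if_neg hf⟩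
  simp only [injFun]
  congr 1
  exact propext (σ.injective_comp f)

/-- The translate by `g` takes at a subset the product of the signs of `g` there. At complementary
subsets these products multiply to `signProd a g`. -/
lemma tupleRep_injFun_mem {k a : ℕ} (h : k + k = a) (g : WB a) :
    tupleRep a k 1 0 g (injFun k a) ∈ complTuples k a ((signProd a g : ℤ) : ℂ) := by
  refine ⟨tupleRep_mem_symTuples _ _ (injFun_mem k a), fun f f' hff' => ?_⟩
  obtain ⟨hf, hf', -⟩ := (Sum.elim_injective).1 hff'
  have hbij : Function.Bijective (Sum.elim f f') := by
    rw [Fintype.bijective_iff_injective_and_card]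
    exact ⟨hff', by simp [h]⟩
  have hprod : ((signProd a g : ℤ) : ℂ) =
      (∏ j, ((g.left (f j) : ℤ) : ℂ)) * ∏ j, ((g.left (f' j) : ℤ) : ℂ) := by
    have h1 : signProd a g = ∏ i, g.left i := rfl
    rw [h1, ← Equiv.prod_comp (Equiv.ofBijective _ hbij)]
    push_cast
    rw [Fintype.prod_sum_type]
    rfl
  have hsq : (∏ j, ((g.left (f j) : ℤ) : ℂ)) * (∏ j, ((g.left (f j) : ℤ) : ℂ)) = 1 := by
    rw [← Finset.prod_mul_distrib]
    exact Finset.prod_eq_one fun j _ => IntUnits.cast_mul_self _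
  rw [tupleRep_apply, tupleRep_apply, hprod, injFun_comp, injFun_comp]
  simp only [injFun, if_pos hf, if_pos hf', pow_zero, pow_one, one_mul, mul_one]
  linear_combination (-(∏ j, ((g.left (f' j) : ℤ) : ℂ))) * hsq

/-- In the model on `k`-subsets the vectors fixed by the conjugate of `S_a` by `δ` are the multiples
of the `δ`-translate of the constant function. Its translates under `W(D_a)` keep the eigenvalue
`signProd δ` under passage to the complement, and even sign changes generate everything with that
eigenvalue. Constituent I is `δ = 1`, constituent II is `δ = lastSign`. -/
lemma exists_model_half {k a : ℕ} (h : k + k = a) (δ : WB a)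
    (τ : Subrepresentation (resTo (WD a) (sigmaRep h (oneRow k) (oneRow k))))
    (hτ : τ = generatedSubrep _ {x | ∀ π : Equiv.Perm (Fin a),
      sigmaRep h (oneRow k) (oneRow k) (δ * SemidirectProduct.inr π * δ⁻¹) x = x}) :
    ∃ ψ : τ.toSubmodule →ₗ[ℂ] ((Fin k → Fin a) → ℂ), Function.Injective ψ ∧
      (∀ (w : WD a) x, ψ (τ.toRepresentation w x) = tupleRep a k 1 0 w (ψ x)) ∧
      LinearMap.range ψ = complTuples k a ((signProd a δ : ℤ) : ℂ) := by
  obtain ⟨ψ, hψ, hψR, hrange⟩ := exists_model_last h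
  set R := tupleRep a k 1 0 with hR
  have hinv : ∀ (w : WB a) φ, R w (R w⁻¹ φ) = φ := fun w φ => by
    rw [← Module.End.mul_apply, ← map_mul]; simp
  have hinv' : ∀ (w : WB a) φ, R w⁻¹ (R w φ) = φ := fun w φ => by
    rw [← Module.End.mul_apply, ← map_mul]; simp
  have hperm : ∀ (π : Equiv.Perm (Fin a)) φ f,
      R (SemidirectProduct.inr π) φ f = φ fun j => π⁻¹ (f j) := by
    intro π φ f
    rw [hR, tupleRep_apply]
    simp
  -- After translation by `δ⁻¹` the function is invariant under `S_a`, which is transitive on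
  -- `k`-subsets, so it is constant on the injective tuples.
  have hconst : ∀ x, (∀ π : Equiv.Perm (Fin a),
      sigmaRep h (oneRow k) (oneRow k) (δ * SemidirectProduct.inr π * δ⁻¹) x = x) →
      ∃ c : ℂ, ψ x = c • R δ (injFun k a) := by
    intro x hx
    set φ := R δ⁻¹ (ψ x) with hφ
    have hφs : φ ∈ symTuples k a :=
      tupleRep_mem_symTuples _ _ (hrange ▸ LinearMap.mem_range_self ψ x)
    have hφπ : ∀ π : Equiv.Perm (Fin a), R (SemidirectProduct.inr π) φ = φ := by
      intro π
      have h1 := congrArg ψ (hx π)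
      rw [hψR, map_mul, map_mul, Module.End.mul_apply, Module.End.mul_apply, ← hφ] at h1
      have h2 := congrArg (R δ⁻¹) h1
      rw [hinv'] at h2
      exact h2
    obtain ⟨f₀, hf₀⟩ : ∃ f₀ : Fin k → Fin a, Function.Injective f₀ :=
      ⟨Fin.castLE (by omega), Fin.castLE_injective _⟩
    refine ⟨φ f₀, ?_⟩
    have hφ1 : φ = φ f₀ • injFun k a := by
      ext f
      by_cases hf : Function.Injective f
      · obtain ⟨π, hπ⟩ := exists_perm_comp f₀ f hf₀ hf
        rw [Pi.smul_apply, injFun, if_pos hf, smul_eq_mul, mul_one]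
        conv_lhs => rw [← hφπ π, hperm]
        congr 1
        ext1 j
        rw [← hπ]; exact π.symm_apply_apply _
      · rw [Pi.smul_apply, injFun, if_neg hf, hφs.2 f hf, smul_zero]
    rw [← map_smul, ← hφ1, hφ, hinv]
  have hgen : ∀ x ∈ τ.toSubmodule, ψ x ∈ complTuples k a ((signProd a δ : ℤ) : ℂ) := by
    intro x hx
    rw [hτ] at hx
    induction hx using Submodule.span_induction with
    | mem x hx =>
      obtain ⟨w, y, hy, rfl⟩ := hx
      obtain ⟨c, hc⟩ := hconst y hy
      change ψ (sigmaRep h (oneRow k) (oneRow k) w y) ∈ _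
      rw [hψR, hc, map_smul, ← Module.End.mul_apply, ← map_mul]
      apply Submodule.smul_mem
      have h1 := tupleRep_injFun_mem h ((w : WB a) * δ)
      have h2 : signProd a (w : WB a) = 1 := w.2
      rwa [map_mul (signProd a), h2, one_mul] at h1
    | zero => rw [map_zero]; exact zero_mem _
    | add x y _ _ hx hy => rw [map_add]; exact add_mem hx hy
    | smul c x _ hx => rw [map_smul]; exact Submodule.smul_mem _ _ hx
  have hequiv : ∀ (w : WD a) (x : τ.toSubmodule),
      (ψ.domRestrict τ.toSubmodule) (τ.toRepresentation w x) =
        R w ((ψ.domRestrict τ.toSubmodule) x) := fun w x => hψR w x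
  refine ⟨ψ.domRestrict τ.toSubmodule, fun x y hxy => Subtype.ext (hψ hxy), hequiv, ?_⟩
  have hle : LinearMap.range (ψ.domRestrict τ.toSubmodule) ≤
      complTuples k a ((signProd a δ : ℤ) : ℂ) := by
    rintro _ ⟨x, rfl⟩
    exact hgen x x.2
  refine le_antisymm hle (complTuples_le _ _ hle ?_ ?_)
  · intro ε hε
    apply mul_tupleSign_mem (v := 0)
    rintro _ ⟨x, rfl⟩
    exact ⟨_, hequiv ⟨SemidirectProduct.inl ε, hε⟩ x⟩
  · intro f hf
    obtain ⟨x, hx⟩ : R δ (injFun k a) ∈ LinearMap.range ψ := by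
      rw [hrange]; exact tupleRep_mem_symTuples _ _ (injFun_mem k a)
    have hxm : x ∈ τ.toSubmodule := by
      rw [hτ]
      refine Submodule.subset_span ⟨1, x, fun π => ?_, by simp⟩
      apply hψ
      rw [hψR, map_mul, map_mul, Module.End.mul_apply, Module.End.mul_apply, hx, hinv']
      congr 1
      ext f
      rw [hperm, injFun_comp]
    refine ⟨_, ⟨⟨x, hxm⟩, rfl⟩, ?_⟩
    rw [LinearMap.domRestrict_apply, hx, hR, tupleRep_apply, injFun_comp, injFun, if_pos hf]
    simp only [pow_zero, pow_one, one_mul, mul_one]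
    exact prod_units_ne_zero _ _

/-- With `l = 0` the map `pairEmb` is surjective and the second tensor factor is a trivial line.
Induction changes nothing, and the representation is the Specht module inflated to `W(B_a)`. -/
lemma exists_model_twoRow {p r a : ℕ} (h : p + r = a) (hr : r ≤ p) :
    ∃ ψ : Representation.IndV (k := ℂ) (A := PairSpace a 0 (twoRow r p) (oneRow 0))
        (pairEmb (Nat.add_zero a)) (pairRep a 0 (twoRow r p) (oneRow 0)) →ₗ[ℂ]
          ((Fin r → Fin a) → ℂ),
      Function.Injective ψ ∧
      (∀ w x, ψ (sigmaRep (Nat.add_zero a) (twoRow r p) (oneRow 0) w x) =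
        tupleRep a r 0 0 w (ψ x)) ∧
      LinearMap.range ψ = Submodule.span ℂ (pairFun '' {b | Function.Injective b}) := by
  obtain ⟨z, hz⟩ := exists_oneRow 0
  obtain ⟨hinj, hrange⟩ := specht_twoRow h hr
  set l₀ := tabloidEval r a ∘ₗ spechtVal a (twoRow r p)
  set ρ := pairRep a 0 (twoRow r p) (oneRow 0) with hρ
  let l : PairSpace a 0 (twoRow r p) (oneRow 0) →ₗ[ℂ] ((Fin r → Fin a) → ℂ) :=
    TensorProduct.lift ((LinearMap.lsmul ℂ ((Fin r → Fin a) → ℂ)).flip.compl₁₂ l₀ (oneRowCoord 0))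
  have hl : ∀ y x, l (y ⊗ₜ x) = oneRowCoord 0 x • l₀ y := fun y x => by simp [l]
  have htmul : ∀ x : PairSpace a 0 (twoRow r p) (oneRow 0), ∃ y, x = y ⊗ₜ z := by
    intro x
    induction x using TensorProduct.induction_on with
    | zero => exact ⟨0, by simp⟩
    | tmul y x =>
      refine ⟨oneRowCoord 0 x • y, ?_⟩
      conv_lhs => rw [eq_smul_oneRow hz x]
      rw [TensorProduct.tmul_smul, TensorProduct.smul_tmul']
    | add x y hx hy =>
      obtain ⟨x', rfl⟩ := hx
      obtain ⟨y', rfl⟩ := hy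
      exact ⟨x' + y', by rw [TensorProduct.add_tmul]⟩
  have hright : ∀ w : WB a × WB 0, (pairEmb (Nat.add_zero a) w).right = w.1.right := by
    intro w
    ext1 i
    exact pairEmb_right (Nat.add_zero a) w (Sum.inl i)
  have hlR : ∀ w x, l (ρ w x) = tupleRep a r 0 0 (pairEmb (Nat.add_zero a) w) (l x) := by
    intro w x
    obtain ⟨y, rfl⟩ := htmul x
    have h1 : signProd 0 w.2 = 1 := by
      change ∏ i : Fin 0, w.2.left i = 1
      simp
    rw [hρ, pairRep_apply_tmul, h1, spechtRep_oneRow, map_smul, hl, hl, map_smul, hz]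
    simp only [Units.val_one, Int.cast_one, one_smul]
    change tabloidEval r a (tabloidRep a w.1.right _) = _
    rw [← hright, tabloidEval_rep]
    rfl
  obtain ⟨ψ, hψ, hψmk⟩ := exists_ind_lift (pairEmb (Nat.add_zero a)) ρ (tupleRep a r 0 0) l hlR
  have hform : ∀ x, ∃ y, x = Representation.IndV.mk (pairEmb (Nat.add_zero a)) ρ 1 (y ⊗ₜ z) := by
    intro x
    have hx : x ∈ Submodule.span ℂ
        {y | ∃ g x, y = Representation.IndV.mk (pairEmb (Nat.add_zero a)) ρ g x} := by
      rw [IndV_span]; trivial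
    suffices hs : x ∈ LinearMap.range
        (Representation.IndV.mk (pairEmb (Nat.add_zero a)) ρ 1) by
      obtain ⟨x', rfl⟩ := hs
      obtain ⟨y, rfl⟩ := htmul x'
      exact ⟨y, rfl⟩
    revert hx
    apply Submodule.span_le.2
    rintro _ ⟨g, x, rfl⟩
    obtain ⟨w, rfl⟩ := exists_pairEmb (Nat.add_zero a) g fun j => j.elim0
    have := IndV_mk_mul (pairEmb (Nat.add_zero a)) ρ w⁻¹ (pairEmb (Nat.add_zero a) w) x
    rw [map_inv, inv_mul_cancel] at this
    rw [← this]
    exact ⟨_, rfl⟩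
  have hψ1 : ∀ y, ψ (Representation.IndV.mk (pairEmb (Nat.add_zero a)) ρ 1 (y ⊗ₜ z)) = l₀ y := by
    intro y
    rw [hψmk, hl, hz, inv_one, map_one, one_smul]; rfl
  refine ⟨ψ, ?_, hψ, ?_⟩
  · intro x x' hxx
    obtain ⟨y, rfl⟩ := hform x
    obtain ⟨y', rfl⟩ := hform x'
    rw [hψ1, hψ1] at hxx
    rw [hinj hxx]
  · rw [← hrange]
    ext φ
    constructor
    · rintro ⟨x, rfl⟩
      obtain ⟨y, rfl⟩ := hform x
      exact ⟨y, (hψ1 y).symm⟩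
    · rintro ⟨y, rfl⟩
      exact ⟨_, hψ1 y⟩

/-! ### Matrix coefficients -/

lemma cast_tupleSign {k a : ℕ} (f : Fin k → Fin a) (ε : Fin a → ℤˣ) :
    ((tupleSign f ε : ℤ) : ℂ) = ∏ j, ((ε (f j) : ℤ) : ℂ) := by
  rw [tupleSign_apply]; push_cast; rfl

/-- Functionals on a representation which behave like the minors on `⋀^r ℂ^m`. -/
structure IsMinorSystem {Γ V : Type*} [Group Γ] [AddCommMonoid V] [Module ℂ V] {m r : ℕ}
    (φ : Γ →* OO m) (ρ : Representation ℂ Γ V) (p : (Fin r → Fin m) → V →ₗ[ℂ] ℂ) : Prop where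
  comp_perm : ∀ f (σ : Equiv.Perm (Fin r)) x,
    p (f ∘ σ) x = ((Equiv.Perm.sign σ : ℤ) : ℂ) * p f x
  eq_zero : ∀ f, ¬ Function.Injective f → ∀ x, p f x = 0
  signedPerm : ∀ γ η π, φ γ = signedPerm η π → ∀ f x,
    p f (ρ γ x) = ((tupleSign f η : ℤ) : ℂ) * p (fun j => π⁻¹ (f j)) x
  separates : ∀ x, (∀ f, Function.Injective f → p f x = 0) → x = 0

/-- Functionals on a representation which behave like products of minors on
`⋀^q ℂ^{a+d} ⊗ ⋀^k ℂ^a`. -/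
structure IsCoeffSystem {Γ V : Type*} [Group Γ] [AddCommMonoid V] [Module ℂ V] {a d q k : ℕ}
    (j : Γ →* KK a d) (ρ : Representation ℂ Γ V)
    (P : (Fin q → Fin (a + d)) → (Fin k → Fin a) → V →ₗ[ℂ] ℂ) : Prop where
  comp_perm : ∀ f g (σ : Equiv.Perm (Fin q)) (τ : Equiv.Perm (Fin k)) x,
    P (f ∘ σ) (g ∘ τ) x =
      ((Equiv.Perm.sign σ : ℤ) : ℂ) * ((Equiv.Perm.sign τ : ℤ) : ℂ) * P f g x
  eq_zero : ∀ f g, ¬ Function.Injective g → ∀ x, P f g x = 0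
  signedPair : ∀ γ η ε π, j γ = signedPair η ε π → ∀ f g x,
    P f g (ρ γ x) = ((tupleSign f η : ℤ) : ℂ) * ((tupleSign g ε : ℤ) : ℂ) *
      P (fun i => (extPerm d π)⁻¹ (f i)) (fun i => π⁻¹ (g i)) x
  separates : ∀ x, (∀ f g, Function.Injective f → Function.Injective g → P f g x = 0) → x = 0

/-- The product of functionals on the two factors of a tensor product. -/
def mulCoeff {V₁ V₂ : Type*} [AddCommMonoid V₁] [Module ℂ V₁] [AddCommMonoid V₂] [Module ℂ V₂]
    (p₁ : V₁ →ₗ[ℂ] ℂ) (p₂ : V₂ →ₗ[ℂ] ℂ) : V₁ ⊗[ℂ] V₂ →ₗ[ℂ] ℂ :=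
  LinearMap.mul' ℂ ℂ ∘ₗ TensorProduct.map p₁ p₂

lemma mulCoeff_tmul {V₁ V₂ : Type*} [AddCommMonoid V₁] [Module ℂ V₁] [AddCommMonoid V₂]
    [Module ℂ V₂] (p₁ : V₁ →ₗ[ℂ] ℂ) (p₂ : V₂ →ₗ[ℂ] ℂ) (x : V₁) (y : V₂) :
    mulCoeff p₁ p₂ (x ⊗ₜ y) = p₁ x * p₂ y := by
  simp [mulCoeff]

lemma mulCoeff_congr {V₁ V₂ : Type*} [AddCommMonoid V₁] [Module ℂ V₁] [AddCommMonoid V₂]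
    [Module ℂ V₂] {p₁ p₁' : V₁ →ₗ[ℂ] ℂ} {p₂ p₂' : V₂ →ₗ[ℂ] ℂ} {C D : ℂ}
    (h₁ : ∀ x, p₁ x = C * p₁' x) (h₂ : ∀ x, p₂ x = D * p₂' x) (v : V₁ ⊗[ℂ] V₂) :
    mulCoeff p₁ p₂ v = C * D * mulCoeff p₁' p₂' v := by
  induction v using TensorProduct.induction_on with
  | zero => simp
  | tmul x y => rw [mulCoeff_tmul, mulCoeff_tmul, h₁, h₂]; ring
  | add x y hx hy => rw [map_add, map_add, hx, hy]; ring

/-- Over a field the tensor product of the two injections into coordinate spaces is again injective.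
-/
lemma mulCoeff_separates {V₁ V₂ ι₁ ι₂ : Type*} [AddCommMonoid V₁] [Module ℂ V₁] [AddCommMonoid V₂]
    [Module ℂ V₂] [Finite ι₁] [Finite ι₂] (p₁ : ι₁ → V₁ →ₗ[ℂ] ℂ) (p₂ : ι₂ → V₂ →ₗ[ℂ] ℂ)
    (h₁ : ∀ x, (∀ i, p₁ i x = 0) → x = 0) (h₂ : ∀ x, (∀ i, p₂ i x = 0) → x = 0)
    (v : V₁ ⊗[ℂ] V₂) (hv : ∀ i j, mulCoeff (p₁ i) (p₂ j) v = 0) : v = 0 := by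
  let _ : AddCommGroup V₁ := Module.addCommMonoidToAddCommGroup ℂ
  let _ : AddCommGroup V₂ := Module.addCommMonoidToAddCommGroup ℂ
  have i₁ : Function.Injective (LinearMap.pi p₁) :=
    (injective_iff_map_eq_zero _).2 fun x hx => h₁ x fun i => congrFun hx i
  have i₂ : Function.Injective (LinearMap.pi p₂) :=
    (injective_iff_map_eq_zero _).2 fun x hx => h₂ x fun i => congrFun hx i
  apply TensorProduct.map_injective_of_flat_flat _ _ i₁ i₂
  rw [map_zero]
  let b := (Pi.basisFun ℂ ι₁).tensorProduct (Pi.basisFun ℂ ι₂)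
  apply b.ext_elem
  rintro ⟨i, j⟩
  have : b.coord (i, j) ∘ₗ TensorProduct.map (LinearMap.pi p₁) (LinearMap.pi p₂) =
      mulCoeff (p₁ i) (p₂ j) := by
    apply TensorProduct.ext'
    intro x y
    rw [mulCoeff_tmul]
    simp [b, mul_comm]
  rw [map_zero, Finsupp.zero_apply, ← hv i j, ← this]
  rfl

lemma isCoeffSystem_extTensor {Γ₁ Γ₂ V₁ V₂ : Type*} [Group Γ₁] [Group Γ₂] [AddCommMonoid V₁]
    [Module ℂ V₁] [AddCommMonoid V₂] [Module ℂ V₂] {a d q k : ℕ} {φ₁ : Γ₁ →* OO (a + d)}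
    {φ₂ : Γ₂ →* OO a} {ρ₁ : Representation ℂ Γ₁ V₁} {ρ₂ : Representation ℂ Γ₂ V₂}
    {p₁ : (Fin q → Fin (a + d)) → V₁ →ₗ[ℂ] ℂ} {p₂ : (Fin k → Fin a) → V₂ →ₗ[ℂ] ℂ}
    (h₁ : IsMinorSystem φ₁ ρ₁ p₁) (h₂ : IsMinorSystem φ₂ ρ₂ p₂) :
    IsCoeffSystem (φ₁.prodMap φ₂) (extTensor ρ₁ ρ₂) fun f g => mulCoeff (p₁ f) (p₂ g) where
  comp_perm f g σ τ x := mulCoeff_congr (h₁.comp_perm f σ) (h₂.comp_perm g τ) x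
  eq_zero f g hg x := by
    rw [mulCoeff_congr (p₁' := p₁ f) (p₂' := p₂ g) (C := 1) (D := 0) (by simp)
      (fun x => by rw [h₂.eq_zero g hg, zero_mul])]
    simp
  signedPair γ η ε π h f g x := by
    induction x using TensorProduct.induction_on with
    | zero => simp
    | tmul x y =>
      have h3 : extTensor ρ₁ ρ₂ γ (x ⊗ₜ y) = (ρ₁ γ.1 x) ⊗ₜ (ρ₂ γ.2 y) := rfl
      rw [h3, mulCoeff_tmul, mulCoeff_tmul, h₁.signedPerm γ.1 _ _ (congrArg Prod.fst h),
        h₂.signedPerm γ.2 _ _ (congrArg Prod.snd h)]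
      ring
    | add x y hx hy => rw [map_add, map_add, map_add, hx, hy]; ring
  separates x hx := by
    refine mulCoeff_separates p₁ p₂ (fun x hx => h₁.separates x fun f _ => hx f)
      (fun x hx => h₂.separates x fun f _ => hx f) x fun f g => ?_
    by_cases hf : Function.Injective f
    · by_cases hg : Function.Injective g
      · exact hx f g hf hg
      · rw [mulCoeff_congr (p₁' := p₁ f) (p₂' := p₂ g) (C := 1) (D := 0) (by simp)
          (fun x => by rw [h₂.eq_zero g hg, zero_mul])]
        simp
    · rw [mulCoeff_congr (p₁' := p₁ f) (p₂' := p₂ g) (C := 0) (D := 1)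
        (fun x => by rw [h₁.eq_zero f hf, zero_mul]) (by simp)]
      simp

/-- A rule completing `k` of the indices `1, …, a` to `q` of the indices `1, …, a + d`, possibly
using the last ones. -/
structure IsCompletion {a d q k : ℕ} (v : ℕ)
    (L : (Fin k → Fin a) → Fin q → Fin (a + d)) : Prop where
  injective : ∀ f, Function.Injective f → Function.Injective (L f)
  comp_perm : ∀ f (σ : Equiv.Perm (Fin k)), ∃ τ : Equiv.Perm (Fin q),
    Equiv.Perm.sign τ = Equiv.Perm.sign σ ∧ L (f ∘ σ) = L f ∘ τ
  extPerm : ∀ f (π : Equiv.Perm (Fin a)), (fun j => extPerm d π (L f j)) = L fun j => π (f j)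
  tupleSign : ∀ f η, tupleSign (L f) η =
    (∏ i, η (Fin.natAdd a i)) ^ v * tupleSign f fun i => η (Fin.castAdd d i)
  unique : ∀ f g, Function.Injective f → Function.Injective g →
    (∀ i, Fin.castAdd d i ∈ Set.range f ↔ i ∈ Set.range g) →
    ∃ σ : Equiv.Perm (Fin q), f = L g ∘ σ

lemma exists_perm_of_range_subset {k : ℕ} {α : Type*} (f f' : Fin k → α)
    (hf : Function.Injective f) (hf' : Function.Injective f') (h : Set.range f' ⊆ Set.range f) :
    ∃ σ : Equiv.Perm (Fin k), f = f' ∘ σ := by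
  refine exists_perm_of_range_eq f f' hf hf'
    (Set.eq_of_subset_of_ncard_le h ?_ (Set.finite_range f)).symm
  rw [Set.ncard_range_of_injective hf, Set.ncard_range_of_injective hf']

lemma isCompletion_castAdd (a d k : ℕ) :
    IsCompletion 0 fun (f : Fin k → Fin a) j => Fin.castAdd d (f j) where
  injective f hf := (Fin.castAdd_injective a d).comp hf
  comp_perm f σ := ⟨σ, rfl, rfl⟩
  extPerm f π := by ext1 j; simp
  tupleSign f η := by simp [tupleSign_apply]
  unique f g hf hg h := by
    refine exists_perm_of_range_subset _ _ hf ((Fin.castAdd_injective a d).comp hg) ?_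
    rintro _ ⟨j, rfl⟩
    exact (h _).2 ⟨j, rfl⟩

lemma append_last_injective {a k : ℕ} (f : Fin k → Fin a) (hf : Function.Injective f) :
    Function.Injective
      (Fin.append (fun j => Fin.castAdd 1 (f j)) fun _ : Fin 1 => Fin.natAdd a 0) := by
  intro i j
  refine Fin.addCases (fun i => ?_) (fun i => ?_) i <;>
    refine Fin.addCases (fun j => ?_) (fun j => ?_) j
  · simp only [Fin.append_left]
    intro h; rw [hf (Fin.castAdd_injective a 1 h)]
  · simp only [Fin.append_left, Fin.append_right]
    intro h
    have := congrArg Fin.val h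
    simp at this; omega
  · simp only [Fin.append_left, Fin.append_right]
    intro h
    have := congrArg Fin.val h
    simp at this; omega
  · intro _; rw [Subsingleton.elim i j]

lemma isCompletion_append_last (a k : ℕ) :
    IsCompletion (d := 1) 1 fun (f : Fin k → Fin a) =>
      Fin.append (fun j => Fin.castAdd 1 (f j)) fun _ : Fin 1 => Fin.natAdd a 0 where
  injective f hf := append_last_injective f hf
  comp_perm f σ := by
    refine ⟨_root_.extPerm 1 σ, sign_extPerm σ, ?_⟩
    ext1 j
    refine Fin.addCases (fun j => ?_) (fun j => ?_) j <;> simp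
  extPerm f π := by
    ext1 j
    refine Fin.addCases (fun j => ?_) (fun j => ?_) j <;> simp
  tupleSign f η := by
    simp only [tupleSign_apply, Fin.prod_univ_add, Fin.append_left, Fin.append_right, pow_one,
      Fin.prod_univ_one]
    rw [mul_comm]
  unique f g hf hg h := by
    refine exists_perm_of_range_subset _ _ hf (append_last_injective g hg) ?_
    rintro _ ⟨j, rfl⟩
    refine Fin.addCases (fun j => ?_) (fun j => ?_) j
    · rw [Fin.append_left]
      exact (h _).2 ⟨j, rfl⟩
    · rw [Fin.append_right]
      -- If the last index were missing, the `k + 1` entries of `f` would lie among the `k` entries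
      -- of `g`.
      by_contra hlast
      have h1 : Set.range f ⊆ Set.range fun j => Fin.castAdd 1 (g j) := by
        rintro _ ⟨i, rfl⟩
        have h2 : ∀ x : Fin (a + 1), x ∈ Set.range f → x ∈ Set.range fun j => Fin.castAdd 1 (g j) := by
          intro x
          refine Fin.addCases (fun x hx => ?_) (fun x hx => ?_) x
          · obtain ⟨j, rfl⟩ := (h x).1 hx
            exact ⟨j, rfl⟩
          · rw [Subsingleton.elim x 0] at hx
            exact absurd hx hlast
        exact h2 _ ⟨i, rfl⟩
      have h2 := Set.ncard_le_ncard h1 (Set.finite_range _)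
      rw [Set.ncard_range_of_injective hf,
        Set.ncard_range_of_injective (f := fun j => Fin.castAdd 1 (g j))
          ((Fin.castAdd_injective a 1).comp hg)] at h2
      simp at h2

/-- The coefficient functions used to identify `V^M`. -/
def coeffMap {V : Type*} [AddCommMonoid V] [Module ℂ V] {a d q k : ℕ}
    (P : (Fin q → Fin (a + d)) → (Fin k → Fin a) → V →ₗ[ℂ] ℂ)
    (L : (Fin k → Fin a) → Fin q → Fin (a + d)) : V →ₗ[ℂ] ((Fin k → Fin a) → ℂ) :=
  LinearMap.pi fun f => P (L f) f

/-! ### Action of the normalizer, of `M` and of sign changes on the coefficient functions -/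

section

variable {Γ V : Type*} [Group Γ] [AddCommMonoid V] [Module ℂ V] {a d q k v : ℕ} {j : Γ →* KK a d}
  {ρ : Representation ℂ Γ V} {P : (Fin q → Fin (a + d)) → (Fin k → Fin a) → V →ₗ[ℂ] ℂ}
  {L : (Fin k → Fin a) → Fin q → Fin (a + d)}

lemma coeffMap_apply (x : V) (f : Fin k → Fin a) : coeffMap P L x f = P (L f) f x := rfl

lemma coeffMap_mem_symTuples (hP : IsCoeffSystem j ρ P) (hL : IsCompletion v L) (x : V) :
    coeffMap P L x ∈ symTuples k a := by
  refine ⟨fun f σ => ?_, fun f hf => hP.eq_zero _ f hf x⟩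
  obtain ⟨τ, hτ, hLτ⟩ := hL.comp_perm f σ
  rw [coeffMap_apply, coeffMap_apply, hLτ, hP.comp_perm, hτ, IntUnits.cast_mul_self, one_mul]

lemma coeffMap_signedPair (hP : IsCoeffSystem j ρ P) (hL : IsCompletion v L) (γ : Γ)
    (η : Fin (a + d) → ℤˣ) (ε : Fin a → ℤˣ) (π : Equiv.Perm (Fin a))
    (h : j γ = signedPair η ε π) (hηε : (∏ i, η i) * ∏ i, ε i = 1) (x : V) :
    coeffMap P L (ρ γ x) =
      tupleRep a k 1 v ⟨fun i => η (Fin.castAdd d i) * ε i, π⟩ (coeffMap P L x) := by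
  ext f
  have h1 : tupleSign f (fun i => η (Fin.castAdd d i) * ε i) =
      tupleSign f (fun i => η (Fin.castAdd d i)) * tupleSign f ε := map_mul (tupleSign f) _ _
  -- Determinant one: the signs at the last `d` indices multiply to the product of all signs of the
  -- Weyl group element. Thus a completion using the last index produces the twist by `signProd`.
  have h2 : signProd a ⟨fun i => η (Fin.castAdd d i) * ε i, π⟩ = ∏ i, η (Fin.natAdd a i) := by
    change ∏ i, η (Fin.castAdd d i) * ε i = _
    rw [Fin.prod_univ_add, mul_right_comm, ← Finset.prod_mul_distrib] at hηε
    rw [← Int.units_inv_eq_self (∏ i, η (Fin.natAdd a i))]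
    exact eq_inv_of_mul_eq_one_left hηε
  have h3 : (fun i => (extPerm d π)⁻¹ (L f i)) = L fun i => π⁻¹ (f i) := by
    rw [extPerm_inv, hL.extPerm]
  rw [coeffMap_apply, hP.signedPair γ η ε π h, h3, hL.tupleSign, tupleRep_apply, coeffMap_apply,
    ← cast_tupleSign f fun i => η (Fin.castAdd d i) * ε i, h1, h2]
  push_cast
  ring

lemma append_one_prod (ε : Fin a → ℤˣ) :
    (∏ i, (Fin.append ε (1 : Fin d → ℤˣ)) i) * ∏ i, ε i = 1 := by
  rw [Fin.prod_univ_add]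
  simp only [Fin.append_left, Fin.append_right, Pi.one_apply, Finset.prod_const_one, mul_one]
  exact Int.units_mul_self _

/-- An element of `M` centralizes `𝔞`: its two equal signs cancel, and it induces the identity of
`W(B_a)`. -/
lemma coeffMap_Mgrp (hd : d ≤ 1) (hP : IsCoeffSystem j ρ P) (hL : IsCompletion v L) (γ : Γ)
    (hγ : j γ ∈ Mgrp a d) (x : V) : coeffMap P L (ρ γ x) = coeffMap P L x := by
  obtain ⟨ε, hε⟩ := (mem_Mgrp_iff hd _).1 hγ
  rw [coeffMap_signedPair hP hL γ _ ε 1 hε (append_one_prod ε)]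
  have : (⟨fun i => Fin.append ε (1 : Fin d → ℤˣ) (Fin.castAdd d i) * ε i, 1⟩ : WB a) = 1 := by
    ext i
    · simp
    · rfl
  rw [this, map_one]
  rfl

/-- The criterion for `V` to carry a given representation of the Weyl group: the `M`-invariant
vectors have to be determined by the coefficients `coeffMap`. -/
lemma carriesWeylRep_of_coeffSystem (hd : d ≤ 1) (hj : Function.Injective j)
    (hs : ∀ g : KK a d, g.1.1.det = 1 → g.2.1.det = 1 → ∃ γ, j γ = g)
    (hP : IsCoeffSystem j ρ P) (hL : IsCompletion v L)
    (W : Subgroup (WB a)) (hW : d = 0 ∧ W = WD a ∨ d = 1 ∧ W = ⊤)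
    {E : Type*} [AddCommGroup E] [Module ℂ E] (σ : Representation ℂ W E)
    (ψ : E →ₗ[ℂ] ((Fin k → Fin a) → ℂ)) (hψ : Function.Injective ψ)
    (hψR : ∀ (w : W) x, ψ (σ w x) = tupleRep a k 1 v w (ψ x))
    (hrange : LinearMap.range ψ = LinearMap.range (coeffMap P L))
    (G : Subgroup (Fin a → ℤˣ)) (hG : ∀ ε ∈ G, ∃ γ, j γ = diagM d ε)
    (hdet : ∀ f g, Function.Injective f → Function.Injective g →
      (∀ ε ∈ G, tupleSign f (Fin.append ε 1) = tupleSign g ε) →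
      ∃ (C : ℂ) (g' : Fin k → Fin a), ∀ x, P f g x = C * P (L g') g' x) :
    CarriesWeylRep j ρ W σ := by
  let _ : AddCommGroup V := Module.addCommMonoidToAddCommGroup ℂ
  refine carriesWeylRep_of_coefficients j ρ W σ (tupleRep a k 1 v)
    (coeffMap P L) ψ (finite_Mgrp_comap hd _ hj)
    (fun γ hγ m hm => conj_mem_Mgrp hd _ hγ m hm) (fun w => exists_induces _ hs w ?_)
    (fun γ hγ => ?_)
    (fun γ hγ x => coeffMap_Mgrp hd hP hL γ hγ x) (fun x hx hx0 => ?_) hψ hψR hrange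
  · rcases hW with ⟨h, rfl⟩ | ⟨h, -⟩
    · exact Or.inl ⟨h, w.2⟩
    · exact Or.inr h
  · obtain ⟨η, ε, π, h⟩ := exists_signedPair_of_normalizesA hd _ hγ
    rw [h, normalizesA_signedPair_iff] at hγ
    have hw : (⟨fun i => η (Fin.castAdd d i) * ε i, π⟩ : WB a) ∈ W := by
      rcases hW with ⟨rfl, rfl⟩ | ⟨-, rfl⟩
      · change ∏ i, η (Fin.castAdd 0 i) * ε i = 1
        rw [Finset.prod_mul_distrib]
        exact hγ
      · trivial
    refine ⟨⟨_, hw⟩, ?_, fun x => coeffMap_signedPair hP hL γ η ε π h hγ x⟩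
    rw [h]; exact inducesOnA_signedPair η ε π
  · refine hP.separates x fun f g hf hg => ?_
    by_contra hne
    -- A nonzero coordinate of an invariant vector must be multiplied by `1` under `M`, so the signs
    -- at `f` and at `g` agree. Then `hdet` reduces the coordinate to one of `coeffMap`, which
    -- vanishes.
    obtain ⟨C, g', hC⟩ := hdet f g hf hg (fun ε hε => by
      obtain ⟨γ, hγ⟩ := hG ε hε
      have h1 := hx γ (by rw [hγ]; exact diagM_mem ε)
      have h2 := hP.signedPair γ _ _ _ hγ f g x
      rw [h1] at h2
      simp only [extPerm_one, inv_one, Equiv.Perm.one_apply] at h2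
      have h3 : ((tupleSign f (Fin.append ε 1) * tupleSign g ε : ℤˣ) : ℤ) = 1 := by
        have h4 := mul_right_cancel₀ hne ((one_mul _).trans h2)
        have h5 : (((tupleSign f (Fin.append ε 1) * tupleSign g ε : ℤˣ) : ℤ) : ℂ) = 1 := by
          rw [Units.val_mul, Int.cast_mul]; exact h4.symm
        exact_mod_cast h5
      have h6 := eq_inv_of_mul_eq_one_left (Units.ext h3)
      rwa [Int.units_inv_eq_self] at h6)
    rw [hC, ← coeffMap_apply, hx0] at hne
    simp at hne

/-- Sign changes in the first factor alone are used. Their determinant may be `-1`, so they need not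
satisfy `NormalizesA`, but they preserve the image of `coeffMap` on all of `V`, and only this image
matters. -/
lemma coeffMap_sign_mul_mem (hP : IsCoeffSystem j ρ P) (hL : IsCompletion v L)
    (η : Fin (a + d) → ℤˣ) (γ : Γ) (hγ : j γ = signedPair η 1 1) (ε : Fin a → ℤˣ)
    (hε : ∀ i, η (Fin.castAdd d i) = ε i) (φ : (Fin k → Fin a) → ℂ)
    (hφ : φ ∈ LinearMap.range (coeffMap P L)) :
    (fun f => ((tupleSign f ε : ℤ) : ℂ) * φ f) ∈ LinearMap.range (coeffMap P L) := by
  obtain ⟨x, rfl⟩ := hφ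
  refine ⟨((((∏ i, η (Fin.natAdd a i)) ^ v : ℤˣ) : ℤ) : ℂ) • ρ γ x, ?_⟩
  rw [map_smul]
  ext f
  rw [Pi.smul_apply, coeffMap_apply, hP.signedPair γ _ _ _ hγ]
  simp only [extPerm_one, inv_one, Equiv.Perm.one_apply, map_one, Units.val_one, Int.cast_one,
    mul_one, smul_eq_mul, hL.tupleSign, hε, Units.val_mul, Int.cast_mul]
  rw [← mul_assoc, ← mul_assoc, IntUnits.cast_mul_self, one_mul]
  rfl

lemma range_coeffMap (hP : IsCoeffSystem j ρ P) (hL : IsCompletion v L)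
    (hε : ∀ ε : Fin a → ℤˣ, ∃ γ η, j γ = signedPair η 1 1 ∧ ∀ i, η (Fin.castAdd d i) = ε i)
    (hne : ∀ f, Function.Injective f → ∃ x, P (L f) f x ≠ 0) :
    LinearMap.range (coeffMap P L) = symTuples k a := by
  have h1 : LinearMap.range (coeffMap P L) ≤ symTuples k a := by
    rintro _ ⟨x, rfl⟩
    exact coeffMap_mem_symTuples hP hL x
  refine le_antisymm h1 (symTuples_le _ h1 (fun ε φ hφ => ?_) fun f hf => ?_)
  · obtain ⟨γ, η, hγ, hη⟩ := hε ε
    exact coeffMap_sign_mul_mem hP hL η γ hγ ε hη φ hφ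
  · obtain ⟨x, hx⟩ := hne f hf
    exact ⟨_, ⟨x, rfl⟩, hx⟩

lemma range_coeffMap_compl (hP : IsCoeffSystem j ρ P) (hL : IsCompletion v L) (κ : ℂ)
    (hκ : ∀ f f' : Fin k → Fin a, Function.Injective (Sum.elim f f') →
      ∀ x, P (L f') f' x = κ * P (L f) f x)
    (hε : ∀ ε ∈ evenSigns a, ∃ γ η, j γ = signedPair η 1 1 ∧ ∀ i, η (Fin.castAdd d i) = ε i)
    (hne : ∀ f, Function.Injective f → ∃ x, P (L f) f x ≠ 0) :
    LinearMap.range (coeffMap P L) = complTuples k a κ := by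
  have h1 : LinearMap.range (coeffMap P L) ≤ complTuples k a κ := by
    rintro _ ⟨x, rfl⟩
    exact ⟨coeffMap_mem_symTuples hP hL x, fun f f' h => hκ f f' h x⟩
  refine le_antisymm h1 (complTuples_le κ _ h1 (fun ε hε' φ hφ => ?_) fun f hf => ?_)
  · obtain ⟨γ, η, hγ, hη⟩ := hε ε hε'
    exact coeffMap_sign_mul_mem hP hL η γ hγ ε hη φ hφ
  · obtain ⟨x, hx⟩ := hne f hf
    exact ⟨_, ⟨x, rfl⟩, hx⟩

lemma isQuasispherical_of_coeffSystem [Module.Finite ℂ V] {ρ : Representation ℂ (KK a d) V}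
    (hd : d ≤ 1) (hP : IsCoeffSystem (MonoidHom.id (KK a d)) ρ P) (hL : IsCompletion v L)
    (f : Fin k → Fin a) (hf : ∃ x, P (L f) f x ≠ 0) : IsQuasispherical ρ := by
  let _ : AddCommGroup V := Module.addCommMonoidToAddCommGroup ℂ
  obtain ⟨x, hx⟩ := hf
  refine isQuasispherical_of_functional ρ (P (L f) f) (fun h => hx (by rw [h]; rfl)) ?_
  intro m hm x
  exact congrFun (coeffMap_Mgrp hd hP hL m hm x) f

end

/-! ### Index tuples with the same signs -/

lemma append_flipSign {a : ℕ} (d : ℕ) (i : Fin a) :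
    Fin.append (flipSign i) (1 : Fin d → ℤˣ) = flipSign (Fin.castAdd d i) := by
  ext1 x
  refine Fin.addCases (fun x => ?_) (fun x => ?_) x
  · simp [flipSign, Function.update_apply]
  · rw [Fin.append_right, flipSign, Function.update_of_ne]
    · rfl
    · intro h
      have := congrArg Fin.val h
      simp at this; omega

lemma append_mul_one {a d : ℕ} (ε ε' : Fin a → ℤˣ) :
    Fin.append (ε * ε') (1 : Fin d → ℤˣ) = Fin.append ε 1 * Fin.append ε' 1 := by
  ext1 x
  refine Fin.addCases (fun x => ?_) (fun x => ?_) x <;> simp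

lemma castAdd_mem_range_iff {a d q k : ℕ} (f : Fin q → Fin (a + d)) (g : Fin k → Fin a)
    (hf : Function.Injective f) (hg : Function.Injective g)
    (h : ∀ ε, tupleSign f (Fin.append ε 1) = tupleSign g ε) (i : Fin a) :
    Fin.castAdd d i ∈ Set.range f ↔ i ∈ Set.range g := by
  apply mem_range_iff_of_tupleSign f g hf hg
  rw [← h, append_flipSign]

lemma castAdd_mem_range_iff_or {a d q k : ℕ} (f : Fin q → Fin (a + d)) (g : Fin k → Fin a)
    (hf : Function.Injective f) (hg : Function.Injective g)
    (h : ∀ ε ∈ evenSigns a, tupleSign f (Fin.append ε 1) = tupleSign g ε) :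
    (∀ i, Fin.castAdd d i ∈ Set.range f ↔ i ∈ Set.range g) ∨
    ∀ i, Fin.castAdd d i ∈ Set.range f ↔ i ∉ Set.range g := by
  have h1 : ∀ i i', (Fin.castAdd d i ∈ Set.range f ↔ i ∈ Set.range g) ↔
      (Fin.castAdd d i' ∈ Set.range f ↔ i' ∈ Set.range g) := by
    intro i i'
    apply mem_range_iff_of_tupleSign_mul f g hf hg
    rw [← h _ (flipSign_mul_mem i i'), append_mul_one, append_flipSign, append_flipSign]
  by_cases hall : ∀ i, Fin.castAdd d i ∈ Set.range f ↔ i ∈ Set.range g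
  · exact Or.inl hall
  · right
    push Not at hall
    obtain ⟨i, hi⟩ := hall
    intro i'
    have h2 := (h1 i i').not.1 (by tauto)
    tauto

lemma exists_complement {a q k : ℕ} (h : q + k = a) (g : Fin k → Fin a)
    (hg : Function.Injective g) : ∃ g' : Fin q → Fin a, Function.Injective (Sum.elim g g') := by
  have e : Fin k ⊕ Fin q ≃ Fin a := (Equiv.sumComm _ _).trans (finSumFinEquiv.trans (finCongr h))
  obtain ⟨π, hπ⟩ := exists_perm_comp (fun x => e (Sum.inl x)) g
    (e.injective.comp Sum.inl_injective) hg
  refine ⟨fun x => π (e (Sum.inr x)), ?_⟩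
  have : Sum.elim g (fun x => π (e (Sum.inr x))) = π ∘ e := by
    ext1 x
    rcases x with x | x
    · exact (hπ x).symm
    · rfl
  rw [this]
  exact π.injective.comp e.injective

/-- The complement of the set of `g` has `q` elements, as many as `f`, so no room is left for the
last `d` indices. -/
lemma exists_castAdd_of_complement {a d q k : ℕ} (h : q + k = a) (f : Fin q → Fin (a + d))
    (g : Fin k → Fin a) (hf : Function.Injective f) (hg : Function.Injective g)
    (hfg : ∀ i, Fin.castAdd d i ∈ Set.range f ↔ i ∉ Set.range g) :
    ∃ (g' : Fin q → Fin a) (σ : Equiv.Perm (Fin q)), Function.Injective (Sum.elim g g') ∧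
      f = (fun j => Fin.castAdd d (g' j)) ∘ σ := by
  obtain ⟨g', hg'⟩ := exists_complement h g hg
  obtain ⟨σ, hσ⟩ := exists_perm_of_range_subset f (fun j => Fin.castAdd d (g' j)) hf
    ((Fin.castAdd_injective a d).comp (hg'.comp Sum.inr_injective)) (by
      rintro _ ⟨j, rfl⟩
      refine (hfg _).2 ?_
      rintro ⟨i, hi⟩
      exact absurd (@hg' (Sum.inl i) (Sum.inr j) hi) (by simp))
  exact ⟨g', σ, hg', hσ⟩

/-! ### Determination of the coefficients of `M`-invariant vectors -/

section

variable {Γ V : Type*} [Group Γ] [AddCommMonoid V] [Module ℂ V] {a d q k v : ℕ} {j : Γ →* KK a d}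
  {ρ : Representation ℂ Γ V} {P : (Fin q → Fin (a + d)) → (Fin k → Fin a) → V →ₗ[ℂ] ℂ}
  {L : (Fin k → Fin a) → Fin q → Fin (a + d)}

lemma coeff_determined (hP : IsCoeffSystem j ρ P) (hL : IsCompletion v L)
    (f : Fin q → Fin (a + d)) (g : Fin k → Fin a) (hf : Function.Injective f)
    (hg : Function.Injective g) (h : ∀ i, Fin.castAdd d i ∈ Set.range f ↔ i ∈ Set.range g) :
    ∃ (C : ℂ) (g' : Fin k → Fin a), ∀ x, P f g x = C * P (L g') g' x := by
  obtain ⟨σ, rfl⟩ := hL.unique f g hf hg h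
  exact ⟨_, g, fun x => hP.comp_perm (L g) g σ 1 x⟩

end

section

variable {Γ₁ Γ₂ V₁ V₂ : Type*} [Group Γ₁] [Group Γ₂] [AddCommMonoid V₁]
    [Module ℂ V₁] [AddCommMonoid V₂] [Module ℂ V₂] {a d q k v : ℕ} {φ₁ : Γ₁ →* OO (a + d)}
    {φ₂ : Γ₂ →* OO a} {ρ₁ : Representation ℂ Γ₁ V₁} {ρ₂ : Representation ℂ Γ₂ V₂}
    {p₁ : (Fin q → Fin (a + d)) → V₁ →ₗ[ℂ] ℂ} {p₂ : (Fin k → Fin a) → V₂ →ₗ[ℂ] ℂ}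
    {L : (Fin k → Fin a) → Fin q → Fin (a + d)}

/-- Invariance under even sign changes allows `f` to be `g` or its complement. In the second case
`f` is complementary to `L g`, and the proportionality `hc` in the first factor brings the
coordinate back to `(L g, g)`. -/
lemma coeff_determined_left (h₁ : IsMinorSystem φ₁ ρ₁ p₁) (h₂ : IsMinorSystem φ₂ ρ₂ p₂)
    (hL : IsCompletion v L)
    (hc : ∀ f f', Function.Injective (Sum.elim f f') → ∃ C : ℂ, ∀ x, p₁ f' x = C * p₁ f x)
    (hLc : ∀ g : Fin k → Fin a, ∀ g' : Fin q → Fin a, Function.Injective (Sum.elim g g') →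
      Function.Injective (Sum.elim (L g) fun j => Fin.castAdd d (g' j)))
    (h : q + k = a) (f : Fin q → Fin (a + d)) (g : Fin k → Fin a) (hf : Function.Injective f)
    (hg : Function.Injective g)
    (hfg : ∀ ε ∈ evenSigns a, tupleSign f (Fin.append ε 1) = tupleSign g ε) :
    ∃ (C : ℂ) (g' : Fin k → Fin a), ∀ x, mulCoeff (p₁ f) (p₂ g) x =
      C * mulCoeff (p₁ (L g')) (p₂ g') x := by
  rcases castAdd_mem_range_iff_or f g hf hg hfg with hfg | hfg
  · exact coeff_determined (isCoeffSystem_extTensor h₁ h₂) hL f g hf hg hfg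
  · obtain ⟨g', σ, hg', rfl⟩ := exists_castAdd_of_complement h f g hf hg hfg
    obtain ⟨C, hC⟩ := hc _ _ (hLc g g' hg')
    exact ⟨_, g, fun x => mulCoeff_congr (D := 1)
      (fun x => by rw [h₁.comp_perm, hC, ← mul_assoc]) (fun x => (one_mul _).symm) x⟩

/-- The same alternative, resolved in the second factor: `g` is replaced by its complement `g'`,
which has the same entries as `f`. -/
lemma coeff_determined_right {p₁ : (Fin k → Fin (a + d)) → V₁ →ₗ[ℂ] ℂ}
    (h₁ : IsMinorSystem φ₁ ρ₁ p₁) (h₂ : IsMinorSystem φ₂ ρ₂ p₂)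
    (hc : ∀ f f', Function.Injective (Sum.elim f f') → ∃ C : ℂ, ∀ x, p₂ f' x = C * p₂ f x)
    (h : k + k = a) (f : Fin k → Fin (a + d)) (g : Fin k → Fin a) (hf : Function.Injective f)
    (hg : Function.Injective g)
    (hfg : ∀ ε ∈ evenSigns a, tupleSign f (Fin.append ε 1) = tupleSign g ε) :
    ∃ (C : ℂ) (g' : Fin k → Fin a), ∀ x, mulCoeff (p₁ f) (p₂ g) x =
      C * mulCoeff (p₁ fun j => Fin.castAdd d (g' j)) (p₂ g') x := by
  rcases castAdd_mem_range_iff_or f g hf hg hfg with hfg | hfg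
  · exact coeff_determined (isCoeffSystem_extTensor h₁ h₂) (isCompletion_castAdd a d k)
      f g hf hg hfg
  · obtain ⟨g', σ, hg', rfl⟩ := exists_castAdd_of_complement h f g hf hg hfg
    obtain ⟨C, hC⟩ := hc g' g (by
      have := hg'.comp (Equiv.sumComm (Fin k) (Fin k)).injective
      convert this using 1
      ext1 x; rcases x with x | x <;> rfl)
    exact ⟨_, g', fun x => mulCoeff_congr (h₁.comp_perm _ σ) hC x⟩

end

lemma sumElim_castAdd_injective {a d q k : ℕ} (g : Fin k → Fin a) (g' : Fin q → Fin a)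
    (h : Function.Injective (Sum.elim g g')) :
    Function.Injective (Sum.elim (fun j => Fin.castAdd d (g j)) fun j => Fin.castAdd d (g' j)) := by
  have := (Fin.castAdd_injective a d).comp h
  convert this using 1
  ext1 x; rcases x with x | x <;> rfl

lemma sumElim_append_injective {a q k : ℕ} (g : Fin k → Fin a) (g' : Fin q → Fin a)
    (h : Function.Injective (Sum.elim g g')) :
    Function.Injective (Sum.elim
      (Fin.append (fun j => Fin.castAdd 1 (g j)) fun _ : Fin 1 => Fin.natAdd a 0)
      fun j => Fin.castAdd 1 (g' j)) := by
  refine (append_last_injective g (h.comp Sum.inl_injective)).sumElim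
    ((Fin.castAdd_injective a 1).comp (h.comp Sum.inr_injective)) fun i j => ?_
  refine Fin.addCases (fun i => ?_) (fun i => ?_) i
  · rw [Fin.append_left]
    intro hij
    exact absurd (@h (Sum.inl i) (Sum.inr j) (Fin.castAdd_injective a 1 hij)) (by simp)
  · rw [Fin.append_right]
    intro hij
    have := congrArg Fin.val hij
    simp at this; omega

/-! ### Elements of `SO(a+d) × SO(a)` -/

section

variable {Γ : Type*} [Group Γ] {a d : ℕ} {j : Γ →* KK a d}

lemma exists_diagM (hs : ∀ g : KK a d, g.1.1.det = 1 → g.2.1.det = 1 → ∃ γ, j γ = g)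
    (ε : Fin a → ℤˣ) (hε : ε ∈ evenSigns a) : ∃ γ, j γ = diagM d ε := by
  have hε' : ∏ i, ε i = 1 := hε
  refine hs _ ?_ ?_
  · change (signedPerm _ _ : OO (a + d)).1.det = 1
    rw [det_signedPerm, Fin.prod_univ_add]
    simp [hε']
  · change (signedPerm _ _ : OO a).1.det = 1
    rw [det_signedPerm]
    simp [hε']

lemma exists_signedPair_left
    (hs : ∀ g : KK a d, g.1.1.det = 1 → g.2.1.det = 1 → ∃ γ, j γ = g) (η : Fin (a + d) → ℤˣ)
    (hη : ∏ i, η i = 1) : ∃ γ, j γ = signedPair η 1 1 := by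
  refine hs _ ?_ ?_
  · change (signedPerm _ _ : OO (a + d)).1.det = 1
    rw [det_signedPerm]
    simp [hη]
  · change (signedPerm _ _ : OO a).1.det = 1
    rw [det_signedPerm]
    simp

lemma exists_signedPair_even
    (hs : ∀ g : KK a d, g.1.1.det = 1 → g.2.1.det = 1 → ∃ γ, j γ = g) (ε : Fin a → ℤˣ)
    (hε : ε ∈ evenSigns a) :
    ∃ γ η, j γ = signedPair η 1 1 ∧ ∀ i, η (Fin.castAdd d i) = ε i := by
  obtain ⟨γ, hγ⟩ := exists_signedPair_left hs (Fin.append ε 1) (by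
    have hε' : ∏ i, ε i = 1 := hε
    rw [Fin.prod_univ_add]
    simp [hε'])
  exact ⟨γ, _, hγ, fun i => Fin.append_left _ _ _⟩

/-- The extra coordinate absorbs the product of the signs, so `SO(a+1)` realizes all sign changes of
the first `a` coordinates. -/
lemma exists_signedPair_odd {j : Γ →* KK a 1}
    (hs : ∀ g : KK a 1, g.1.1.det = 1 → g.2.1.det = 1 → ∃ γ, j γ = g) (ε : Fin a → ℤˣ) :
    ∃ γ η, j γ = signedPair η 1 1 ∧ ∀ i, η (Fin.castAdd 1 i) = ε i := by
  obtain ⟨γ, hγ⟩ := exists_signedPair_left hs (Fin.append ε fun _ => ∏ i, ε i) (by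
    rw [Fin.prod_univ_add]
    simp only [Fin.append_left, Fin.append_right, Fin.prod_univ_one]
    exact Int.units_mul_self _)
  exact ⟨γ, _, hγ, fun i => Fin.append_left _ _ _⟩

end

/-! ### The minors on `μ(1^r, 0^l)` -/

/-- The restriction of a minor to the representation `μ(1^r, 0^l)`. -/
def muMinor {Γ : Type*} [Group Γ] {m : ℕ} (φ : Γ →* OO m) (r : ℕ) (s : ℤˣ) (f : Fin r → Fin m) :
    (muOne φ r s).toSubmodule →ₗ[ℂ] ℂ :=
  minor f ∘ₗ (muOne φ r s).toSubmodule.subtype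

lemma isMinorSystem_muMinor {Γ : Type*} [Group Γ] {m : ℕ} (φ : Γ →* OO m) (r : ℕ) (s : ℤˣ) :
    IsMinorSystem (V := (muOne φ r s).toSubmodule) φ (muOne φ r s).toRepresentation
      (muMinor φ r s) where
  comp_perm f σ x := minor_comp_perm f σ x
  eq_zero f hf x := minor_eq_zero f hf x
  signedPerm γ η π h f x := by
    have h1 : muMinor φ r s f ((muOne φ r s).toRepresentation γ x) =
      minor f (extPowRep m r (φ γ) x) := rfl
    rw [h1, h, minor_signedPerm, cast_tupleSign]
    rfl
  separates x hx := by
    have h1 : (x : ⋀[ℂ]^r (Fin m → ℂ)) = 0 := by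
      apply ((Pi.basisFun ℂ (Fin m)).exteriorPower r).ext_elem
      intro t
      rw [basisFun_exteriorPower_repr, map_zero, Finsupp.zero_apply]
      exact hx _ (Set.powersetCard.ofFinEmbEquiv.symm t).injective
    exact Subtype.ext h1

lemma muMinor_complement {Γ : Type*} [Group Γ] {r m : ℕ} (h : r + r = m) (hr : 1 ≤ r)
    (φ : Γ →* OO m) (hφ : ∀ γ, (φ γ).1.det = 1) (s : ℤˣ) (f f' : Fin r → Fin m)
    (hf : Function.Injective (Sum.elim f f')) (x : (muOne φ r s).toSubmodule) :
    muMinor φ r s f' x = ((complSign h f f' : ℤ) : ℂ) * (((s : ℤ) : ℂ) * Complex.I ^ r) *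
      muMinor φ r s f x :=
  minor_complement h hr φ hφ s f f' hf x x.2

lemma exists_muMinor_ne_zero {Γ : Type*} [Group Γ] {m r : ℕ} (hr : 2 * r ≤ m) (φ : Γ →* OO m)
    (hφ : ∀ g : OO m, g.1.det = 1 → ∃ γ, φ γ = g) (s : ℤˣ) (f : Fin r → Fin m)
    (hf : Function.Injective f) : ∃ x, muMinor φ r s f x ≠ 0 := by
  obtain ⟨u, hu, h⟩ := exists_minor_ne_zero hr φ hφ s f hf
  exact ⟨⟨u, hu⟩, h⟩

lemma exists_mulCoeff_ne_zero {V₁ V₂ : Type*} [AddCommMonoid V₁] [Module ℂ V₁] [AddCommMonoid V₂]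
    [Module ℂ V₂] {p₁ : V₁ →ₗ[ℂ] ℂ} {p₂ : V₂ →ₗ[ℂ] ℂ} (h₁ : ∃ x, p₁ x ≠ 0) (h₂ : ∃ x, p₂ x ≠ 0) :
    ∃ x, mulCoeff p₁ p₂ x ≠ 0 := by
  obtain ⟨x, hx⟩ := h₁
  obtain ⟨y, hy⟩ := h₂
  exact ⟨x ⊗ₜ y, by rw [mulCoeff_tmul]; exact mul_ne_zero hx hy⟩

/-- The products of minors on `μ(1^q, 0) ⊗ μ(1^k, 0)`. -/
def muCoeff {Γ₁ Γ₂ : Type*} [Group Γ₁] [Group Γ₂] {m n : ℕ} (φ₁ : Γ₁ →* OO m) (φ₂ : Γ₂ →* OO n)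
    (q k : ℕ) (s t : ℤˣ) (f : Fin q → Fin m) (g : Fin k → Fin n) :
    (muOne φ₁ q s).toSubmodule ⊗[ℂ] (muOne φ₂ k t).toSubmodule →ₗ[ℂ] ℂ :=
  mulCoeff (V₁ := (muOne φ₁ q s).toSubmodule) (V₂ := (muOne φ₂ k t).toSubmodule)
    (muMinor φ₁ q s f) (muMinor φ₂ k t g)

lemma isCoeffSystem_muCoeff {Γ₁ Γ₂ : Type*} [Group Γ₁] [Group Γ₂] {a d : ℕ}
    (φ₁ : Γ₁ →* OO (a + d)) (φ₂ : Γ₂ →* OO a) (q k : ℕ) (s t : ℤˣ) :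
    IsCoeffSystem (V := (muOne φ₁ q s).toSubmodule ⊗[ℂ] (muOne φ₂ k t).toSubmodule)
      (φ₁.prodMap φ₂) (extTensor (muOne φ₁ q s).toRepresentation (muOne φ₂ k t).toRepresentation)
      (muCoeff φ₁ φ₂ q k s t) :=
  isCoeffSystem_extTensor (isMinorSystem_muMinor φ₁ q s) (isMinorSystem_muMinor φ₂ k t)

lemma exists_muCoeff_ne_zero {Γ₁ Γ₂ : Type*} [Group Γ₁] [Group Γ₂] {a d q k v : ℕ}
    {φ₁ : Γ₁ →* OO (a + d)} {φ₂ : Γ₂ →* OO a} (hq : 2 * q ≤ a + d) (hk : 2 * k ≤ a)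
    (hs₁ : ∀ g : OO (a + d), g.1.det = 1 → ∃ γ, φ₁ γ = g)
    (hs₂ : ∀ g : OO a, g.1.det = 1 → ∃ γ, φ₂ γ = g) (s t : ℤˣ)
    {L : (Fin k → Fin a) → Fin q → Fin (a + d)} (hL : IsCompletion v L) (f : Fin k → Fin a)
    (hf : Function.Injective f) : ∃ x, muCoeff φ₁ φ₂ q k s t (L f) f x ≠ 0 :=
  exists_mulCoeff_ne_zero (V₁ := (muOne φ₁ q s).toSubmodule) (V₂ := (muOne φ₂ k t).toSubmodule)
    (exists_muMinor_ne_zero hq _ hs₁ s _ (hL.injective f hf))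
    (exists_muMinor_ne_zero hk _ hs₂ t _ hf)

/-! ### The representations `μ(1^q, 0) ⊗ μ(1^k, 0)` -/

lemma relevantO_carriesWeylRep {a d q k v : ℕ} (hd : d ≤ 1)
    {L : (Fin k → Fin a) → Fin q → Fin (a + d)} (hL : IsCompletion v L) (hq : 2 * q ≤ a + d)
    (hk : 2 * k ≤ a) (W : Subgroup (WB a)) (hW : d = 0 ∧ W = WD a ∨ d = 1 ∧ W = ⊤)
    {E : Type*} [AddCommGroup E] [Module ℂ E] (σ : Representation ℂ (WB a) E)
    (hσ : ∃ ψ : E →ₗ[ℂ] ((Fin k → Fin a) → ℂ), Function.Injective ψ ∧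
      (∀ w x, ψ (σ w x) = tupleRep a k 1 v w (ψ x)) ∧ LinearMap.range ψ = symTuples k a) :
    IsQuasispherical (relevantO a d q k) ∧
    CarriesWeylRep (MonoidHom.id (KK a d)) (relevantO a d q k) W (resTo W σ) := by
  obtain ⟨ψ, hψ, hψR, hrange⟩ := hσ
  have hP : IsCoeffSystem (MonoidHom.id (KK a d)) (relevantO a d q k)
      (muCoeff (MonoidHom.id _) (MonoidHom.id _) q k 1 1) :=
    isCoeffSystem_muCoeff (MonoidHom.id _) (MonoidHom.id _) q k 1 1
  have hne := exists_muCoeff_ne_zero hq hk (φ₁ := MonoidHom.id _) (φ₂ := MonoidHom.id _)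
    (fun g _ => ⟨g, rfl⟩) (fun g _ => ⟨g, rfl⟩) 1 1 hL
  constructor
  · exact isQuasispherical_of_coeffSystem hd hP hL (Fin.castLE (by omega))
      (hne _ (Fin.castLE_injective _))
  · refine carriesWeylRep_of_coeffSystem hd Function.injective_id (fun g _ _ => ⟨g, rfl⟩) hP hL
      W hW _ ψ hψ (fun w x => hψR w x) ?_ ⊤ (fun ε _ => ⟨_, rfl⟩) fun f g hf hg h => ?_
    · rw [hrange, range_coeffMap hP hL (fun ε => ⟨_, Fin.append ε 1, rfl, fun i => by simp⟩) hne]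
    · exact coeff_determined hP hL f g hf hg
        (castAdd_mem_range_iff f g hf hg fun ε => h ε (Subgroup.mem_top ε))

/-! ### Representations of `SO(a+d) × SO(a)` in middle degree -/

lemma exists_soIncl {a d : ℕ} (g : KK a d) (h₁ : g.1.1.det = 1) (h₂ : g.2.1.det = 1) :
    ∃ γ, soIncl a d γ = g :=
  ⟨(⟨g.1, h₁⟩, ⟨g.2, h₂⟩), rfl⟩

lemma soIncl_injective (a d : ℕ) : Function.Injective (soIncl a d) := fun x y h => by
  have h' := Prod.ext_iff.1 h
  exact Prod.ext (Subtype.ext h'.1) (Subtype.ext h'.2)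

lemma exists_subtype_SOsub {m : ℕ} (g : OO m) (h : g.1.det = 1) :
    ∃ γ, (SOsub m).subtype γ = g := ⟨⟨g, h⟩, rfl⟩

/-- For `d = 1` the image is still the space of all functions of `k`-subsets, by the sign changes of
`SO(a+1)`. Only the determination of invariant vectors needs the weaker condition on even signs. -/
lemma muOneSO_carriesWeylRep {a q k v : ℕ} {s t : ℤˣ}
    {L : (Fin k → Fin a) → Fin q → Fin (a + 1)} (hL : IsCompletion v L) (hq : 2 * q ≤ a + 1)
    (hk : 2 * k ≤ a)
    (hdet : ∀ f g, Function.Injective f → Function.Injective g →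
      (∀ ε ∈ evenSigns a, tupleSign f (Fin.append ε 1) = tupleSign g ε) →
      ∃ (C : ℂ) (g' : Fin k → Fin a), ∀ x,
        muCoeff (SOsub (a + 1)).subtype (SOsub a).subtype q k s t f g x =
        C * muCoeff (SOsub (a + 1)).subtype (SOsub a).subtype q k s t (L g') g' x)
    {E : Type*} [AddCommGroup E] [Module ℂ E] (σ : Representation ℂ (WB a) E)
    (hσ : ∃ ψ : E →ₗ[ℂ] ((Fin k → Fin a) → ℂ), Function.Injective ψ ∧
      (∀ w x, ψ (σ w x) = tupleRep a k 1 v w (ψ x)) ∧ LinearMap.range ψ = symTuples k a) :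
    CarriesWeylRep (soIncl a 1) (extTensor (muOneSO (a + 1) q s) (muOneSO a k t)) ⊤
      (resTo ⊤ σ) := by
  obtain ⟨ψ, hψ, hψR, hrange⟩ := hσ
  have hP : IsCoeffSystem (soIncl a 1) (extTensor (muOneSO (a + 1) q s) (muOneSO a k t))
      (muCoeff (SOsub (a + 1)).subtype (SOsub a).subtype q k s t) :=
    isCoeffSystem_muCoeff (SOsub (a + 1)).subtype (SOsub a).subtype q k s t
  refine carriesWeylRep_of_coeffSystem le_rfl (soIncl_injective a 1) exists_soIncl hP hL
      ⊤ (Or.inr ⟨rfl, rfl⟩) _ ψ hψ (fun w x => hψR w x) ?_ (evenSigns a)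
      (exists_diagM exists_soIncl) hdet
  rw [hrange, range_coeffMap hP hL (exists_signedPair_odd exists_soIncl)
    (exists_muCoeff_ne_zero hq hk exists_subtype_SOsub exists_subtype_SOsub s t hL)]

/-- The first minor changes by `± s i^k` under passage to the complement and the second by `± t
i^k`, with the same permutation sign; the product of the two factors is `s t (-1)^k`. -/
lemma muOneSO_half_carriesWeylRep {a k : ℕ} (h : k + k = a) (hk : 1 ≤ k) (s t : ℤˣ)
    {E : Type*} [AddCommGroup E] [Module ℂ E] (σ : Representation ℂ (WD a) E)
    (hσ : ∃ ψ : E →ₗ[ℂ] ((Fin k → Fin a) → ℂ), Function.Injective ψ ∧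
      (∀ (w : WD a) x, ψ (σ w x) = tupleRep a k 1 0 w (ψ x)) ∧
      LinearMap.range ψ = complTuples k a ((s * t * (-1) ^ k : ℤˣ) : ℤ)) :
    CarriesWeylRep (soIncl a 0) (extTensor (muOneSO (a + 0) k s) (muOneSO a k t)) (WD a) σ := by
  obtain ⟨ψ, hψ, hψR, hrange⟩ := hσ
  have hP : IsCoeffSystem (soIncl a 0) (extTensor (muOneSO (a + 0) k s) (muOneSO a k t))
      (muCoeff (SOsub (a + 0)).subtype (SOsub a).subtype k k s t) :=
    isCoeffSystem_muCoeff (SOsub (a + 0)).subtype (SOsub a).subtype k k s t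
  have hL := isCompletion_castAdd a 0 k
  refine carriesWeylRep_of_coeffSystem zero_le_one (soIncl_injective a 0) exists_soIncl hP hL
    (WD a) (Or.inl ⟨rfl, rfl⟩) _ ψ hψ hψR ?_ (evenSigns a)
    (exists_diagM exists_soIncl)
    (coeff_determined_left (isMinorSystem_muMinor (SOsub (a + 0)).subtype k s)
      (isMinorSystem_muMinor (SOsub a).subtype k t) hL
      (fun f f' hf => ⟨_, muMinor_complement h hk _ (fun γ => γ.2) s f f' hf⟩)
      (fun g g' => sumElim_castAdd_injective g g') h)
  rw [hrange, range_coeffMap_compl hP hL _ (fun f f' hf x => ?_)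
    (exists_signedPair_even exists_soIncl) (exists_muCoeff_ne_zero (by omega) (by omega)
      exists_subtype_SOsub exists_subtype_SOsub s t hL)]
  rw [muCoeff, mulCoeff_congr (V₁ := (muOne (SOsub (a + 0)).subtype k s).toSubmodule)
    (V₂ := (muOne (SOsub a).subtype k t).toSubmodule)
    (muMinor_complement h hk _ (fun γ => γ.2) s (fun j => Fin.castAdd 0 (f j)) _
      (sumElim_castAdd_injective f f' hf))
    (muMinor_complement h hk _ (fun γ => γ.2) t f f' hf)]
  congr 1
  have h3 : complSign h (fun j => Fin.castAdd 0 (f j)) (fun j => Fin.castAdd 0 (f' j)) =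
    complSign h f f' := rfl
  rw [h3]
  have h4 : Complex.I ^ k * Complex.I ^ k = (-1) ^ k := by rw [← mul_pow, Complex.I_mul_I]
  push_cast
  rw [← h4]
  linear_combination (((s : ℤ) : ℂ) * Complex.I ^ k * (((t : ℤ) : ℂ) * Complex.I ^ k)) *
    IntUnits.cast_mul_self (complSign h f f')

lemma sigmaI_carriesWeylRep {a k : ℕ} (h : k + k = a) (hk : 1 ≤ k) (s t : ℤˣ)
    (hst : s * t = (-1) ^ k) :
    CarriesWeylRep (soIncl a 0) (extTensor (muOneSO (a + 0) k s) (muOneSO a k t)) (WD a)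
      (sigmaI h).toRepresentation := by
  refine muOneSO_half_carriesWeylRep h hk s t _ ?_
  have := exists_model_half h 1 (sigmaI h) (by simp [sigmaI])
  rwa [map_one, ← Int.units_mul_self ((-1) ^ k), ← congrArg (· * (-1) ^ k) hst] at this

lemma sigmaII_carriesWeylRep {a k : ℕ} (h : k + k = a) (hk : 1 ≤ k) (s t : ℤˣ)
    (hst : s * t = -(-1) ^ k) :
    CarriesWeylRep (soIncl a 0) (extTensor (muOneSO (a + 0) k s) (muOneSO a k t)) (WD a)
      (sigmaII h).toRepresentation := by
  refine muOneSO_half_carriesWeylRep h hk s t _ ?_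
  have h1 : signProd a (lastSign a) = s * t * (-1) ^ k := by
    rw [hst, neg_mul, Int.units_mul_self]
    change ∏ i : Fin a, (if i.val + 1 = a then (-1 : ℤˣ) else 1) = -1
    rw [Finset.prod_eq_single (⟨a - 1, by omega⟩ : Fin a)]
    · rw [if_pos (by change a - 1 + 1 = a; omega)]
    · intro i _ hi
      rw [if_neg]
      intro h'
      exact hi (Fin.ext (by change i.val = a - 1; omega))
    · simp
  have := exists_model_half h (lastSign a) (sigmaII h) rfl
  rwa [h1] at this

/-- Here `SO(a)` is the factor of even size, so complementary minors are related in the second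
factor. -/
lemma muOneSO_even_carriesWeylRep {a k : ℕ} (h : k + k = a) (hk : 1 ≤ k) (t : ℤˣ) :
    CarriesWeylRep (soIncl a 1) (extTensor (muOneSO (a + 1) k 1) (muOneSO a k t)) ⊤
      (resTo ⊤ (sigmaRep h (oneRow k) (oneRow k))) :=
  muOneSO_carriesWeylRep (isCompletion_castAdd a 1 k) (by omega) (by omega)
    (coeff_determined_right (isMinorSystem_muMinor (SOsub (a + 1)).subtype k 1)
      (isMinorSystem_muMinor (SOsub a).subtype k t)
      (fun f f' hf => ⟨_, muMinor_complement h hk _ (fun γ => γ.2) t f f' hf⟩) h)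
    _ (exists_model_last h)

/-- Here `a + 1 = 2(k + 1)`, so the relation between complementary minors comes from the first
factor. -/
lemma muOneSO_odd_carriesWeylRep {a k : ℕ} (h : k + (k + 1) = a) (s : ℤˣ) :
    CarriesWeylRep (soIncl a 1) (extTensor (muOneSO (a + 1) (k + 1) s) (muOneSO a k 1)) ⊤
      (resTo ⊤ (sigmaRep h (oneRow k) (oneRow (k + 1)))) :=
  muOneSO_carriesWeylRep (isCompletion_append_last a k) (by omega) (by omega)
    (coeff_determined_left (isMinorSystem_muMinor (SOsub (a + 1)).subtype (k + 1) s)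
      (isMinorSystem_muMinor (SOsub a).subtype k 1) (isCompletion_append_last a k)
      (fun f f' hf => ⟨_, muMinor_complement (by omega) (by omega) _ (fun γ => γ.2) s f f' hf⟩)
      sumElim_append_injective (by omega))
    _ (exists_model_first h)

/-! ### Squares of minors of the highest weight vector -/

lemma weightVector_even {m j : ℕ} (s : ℤˣ) (t : Fin m) (h : t.val = 2 * j) :
    weightVector m j s t = 1 := if_pos h

lemma weightVector_odd {m j : ℕ} (s : ℤˣ) (t : Fin m) (h : t.val = 2 * j + 1) :
    weightVector m j s t = ((s : ℤ) : ℂ) * Complex.I := by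
  rw [weightVector, if_neg (by omega), if_pos h]

lemma weightVector_eq_zero {m j : ℕ} (s : ℤˣ) (t : Fin m) (h : t.val ≠ 2 * j)
    (h' : t.val ≠ 2 * j + 1) : weightVector m j s t = 0 := by
  rw [weightVector, if_neg h, if_neg h']

/-- The weight vectors span an isotropic subspace for the bilinear form: `1 + (± i)² = 0`, and
distinct pairs of coordinates are disjoint. -/
lemma weightVector_dot {m r : ℕ} (hr : 2 * r ≤ m) (s : ℤˣ) (i j : Fin r) :
    ∑ t, weightVector m i (if i.val + 1 = r then s else 1) t *
      weightVector m j (if j.val + 1 = r then s else 1) t = 0 := by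
  rw [weightVector_sum (by omega)]
  by_cases hij : i = j
  · subst hij
    rw [weightVector_even _ _ rfl, weightVector_odd _ _ rfl]
    have h1 := IntUnits.cast_mul_self (if i.val + 1 = r then s else 1)
    linear_combination h1 * Complex.I * Complex.I + Complex.I_mul_I
  · have hij' : i.val ≠ j.val := fun h => hij (Fin.ext h)
    rw [weightVector_eq_zero _ _ (by simp; omega) (by simp; omega),
      weightVector_eq_zero _ _ (by simp; omega) (by simp; omega)]
    ring

lemma orthogonal_mulVec_dot {m : ℕ} (g : OO m) (v w : Fin m → ℂ) :
    ∑ t, (g.1.map (algebraMap ℝ ℂ) *ᵥ v) t * (g.1.map (algebraMap ℝ ℂ) *ᵥ w) t =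
      ∑ t, v t * w t := by
  change (g.1.map (algebraMap ℝ ℂ) *ᵥ v) ⬝ᵥ (g.1.map (algebraMap ℝ ℂ) *ᵥ w) = v ⬝ᵥ w
  rw [Matrix.dotProduct_mulVec, ← Matrix.mulVec_transpose, Matrix.mulVec_mulVec,
    orthogonal_map_transpose_mul, Matrix.one_mulVec]

lemma minor_update_ιMulti {m r : ℕ} (f : Fin r → Fin m) (i : Fin r) (l : Fin m)
    (w : Fin r → Fin m → ℂ) :
    minor (Function.update f i l) (exteriorPower.ιMulti ℂ r w) =
      ∑ a, (Matrix.of fun a b => w a (f b)).adjugate i a * w a l := by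
  have h1 : (Matrix.of fun a b => w a (Function.update f i l b)) =
      (Matrix.of fun a b => w a (f b)).updateCol i fun a => w a l := by
    ext a b
    by_cases hb : b = i
    · subst hb; simp
    · simp [hb]
  rw [minor_ιMulti, h1, ← Matrix.cramer_apply, Matrix.cramer_eq_adjugate_mulVec]
  rfl

/-- By Cramer's rule the minor is linear in the varying coordinate `l`, with cofactors independent
of `l`. The sum of squares is then a combination of the products of rows, which vanish by isotropy.
-/
lemma sum_minor_update_sq {m r : ℕ} (f : Fin r → Fin m) (i : Fin r) (w : Fin r → Fin m → ℂ)
    (hw : ∀ a b, ∑ t, w a t * w b t = 0) :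
    ∑ l, minor (Function.update f i l) (exteriorPower.ιMulti ℂ r w) *
      minor (Function.update f i l) (exteriorPower.ιMulti ℂ r w) = 0 := by
  simp only [minor_update_ιMulti, Finset.sum_mul_sum]
  rw [Finset.sum_comm]
  refine Finset.sum_eq_zero fun a _ => ?_
  rw [Finset.sum_comm]
  refine Finset.sum_eq_zero fun b _ => ?_
  set M := (Matrix.of fun a b => w a (f b)).adjugate
  calc _ = ∑ l, M i a * M i b * (w a l * w b l) := Finset.sum_congr rfl fun l _ => by ring
    _ = 0 := by rw [← Finset.mul_sum, hw, mul_zero]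

lemma extPowRep_hwWedge {m r : ℕ} (g : OO m) (s : ℤˣ) :
    extPowRep m r g (hwWedge m r s) = exteriorPower.ιMulti ℂ r fun j : Fin r =>
      g.1.map (algebraMap ℝ ℂ) *ᵥ weightVector m j (if j.val + 1 = r then s else 1) :=
  extPowRep_ιMulti g _

/-- The pairs of coordinates `2j, 2j+1` of the highest weight vector. -/
def hwPairs {m r : ℕ} (hr : 2 * r ≤ m) (x : Fin r × Bool) : Fin m :=
  ⟨2 * x.1.val + if x.2 then 1 else 0, by
    have := x.1.isLt
    split_ifs <;> omega⟩

lemma hwPairs_injective {m r : ℕ} (hr : 2 * r ≤ m) : Function.Injective (hwPairs hr) := by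
  rintro ⟨i, x⟩ ⟨j, y⟩ h
  simp only [hwPairs, Fin.mk.injEq] at h
  have hij : i = j := Fin.ext (by split_ifs at h <;> omega)
  subst hij
  cases x <;> cases y <;> simp at h ⊢

lemma minor_hwPairs_sq {m r : ℕ} (hr : 2 * r ≤ m) (s : ℤˣ) (e : Fin r → Bool) :
    minor (fun j => hwPairs hr (j, e j)) (hwWedge m r s) *
      minor (fun j => hwPairs hr (j, e j)) (hwWedge m r s) = ∏ j, if e j then -1 else 1 := by
  have h1 : (Matrix.of fun i j : Fin r => weightVector m i (if i.val + 1 = r then s else 1)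
      (hwPairs hr (j, e j))) = Matrix.diagonal fun j => if e j then
        (((if j.val + 1 = r then s else 1 : ℤˣ) : ℤ) : ℂ) * Complex.I else 1 := by
    ext i j
    by_cases hij : i = j
    · subst hij
      rw [Matrix.diagonal_apply_eq, Matrix.of_apply]
      cases h : e i <;> simp [weightVector, hwPairs]
    · have hij' : i.val ≠ j.val := fun h => hij (Fin.ext h)
      rw [Matrix.diagonal_apply_ne _ hij, Matrix.of_apply]
      apply weightVector_eq_zero <;> simp only [hwPairs] <;> split_ifs <;> omega
  rw [hwWedge, minor_ιMulti, h1, Matrix.det_diagonal, ← Finset.prod_mul_distrib]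
  refine Finset.prod_congr rfl fun j _ => ?_
  split_ifs with h2 h3
  · have h4 := IntUnits.cast_mul_self s
    linear_combination h4 * Complex.I * Complex.I + Complex.I_mul_I
  · simp
  · simp

lemma exists_of_minor_hwWedge_ne_zero {m r : ℕ} (hr : 2 * r ≤ m) (s : ℤˣ) (f : Fin r → Fin m)
    (h : minor f (hwWedge m r s) ≠ 0) :
    ∃ (e : Fin r → Bool) (σ : Equiv.Perm (Fin r)), f = (fun j => hwPairs hr (j, e j)) ∘ σ := by
  rw [hwWedge, minor_ιMulti, Matrix.det_apply] at h
  obtain ⟨σ, -, hσ⟩ := Finset.exists_ne_zero_of_sum_ne_zero h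
  have h1 : ∀ j, weightVector m (σ j) (if (σ j).val + 1 = r then s else 1) (f j) ≠ 0 := by
    intro j hj
    apply hσ
    rw [Finset.prod_eq_zero (Finset.mem_univ j) hj, smul_zero]
  refine ⟨fun j => decide ((f (σ⁻¹ j)).val = 2 * j.val + 1), σ, ?_⟩
  ext1 j
  apply Fin.ext
  have h2 := h1 j
  have hσj : σ⁻¹ (σ j) = j := by rw [Equiv.Perm.inv_def, Equiv.symm_apply_apply]
  simp only [Function.comp_apply, hwPairs, hσj, decide_eq_true_eq]
  simp only [weightVector] at h2
  split_ifs at h2 ⊢ <;> first | omega | exact absurd rfl h2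

/-- A nonzero minor must take one index from each pair `2j, 2j+1`. It is then, up to sign, a product
of factors `1` and `± i`, whose square is the coefficient of the corresponding tabloid in a
polytabloid. -/
lemma minor_hwWedge_sq {m r : ℕ} (hr : 2 * r ≤ m) (s : ℤˣ) (f : Fin r → Fin m) :
    minor f (hwWedge m r s) * minor f (hwWedge m r s) = pairFun (hwPairs hr) f := by
  have hinj : ∀ e : Fin r → Bool, Function.Injective fun j => hwPairs hr (j, e j) :=
    fun e i j h => congrArg Prod.fst (hwPairs_injective hr h)
  by_cases h : ∃ (e : Fin r → Bool) (σ : Equiv.Perm (Fin r)),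
      f = (fun j => hwPairs hr (j, e j)) ∘ σ
  · obtain ⟨e, σ, rfl⟩ := h
    rw [pairFun, Finset.sum_eq_single e]
    · rw [orbitSum_comp, orbitSum_self _ (hinj e), mul_one, ← minor_hwPairs_sq hr s e,
        minor_comp_perm]
      linear_combination (minor (fun j => hwPairs hr (j, e j)) (hwWedge m r s) *
        minor (fun j => hwPairs hr (j, e j)) (hwWedge m r s)) *
        IntUnits.cast_mul_self (Equiv.Perm.sign σ)
    · intro e' _ he'
      rw [orbitSum_eq_zero, mul_zero]
      rintro ⟨τ, hτ⟩
      apply he'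
      ext1 j
      obtain ⟨i, rfl⟩ := τ.surjective j
      have h2 := Prod.ext_iff.1 (hwPairs_injective hr (congrFun hτ i))
      exact (h2.2.symm.trans (congrArg e h2.1))
    · simp
  · rw [pairFun, Finset.sum_eq_zero]
    · by_contra hne
      exact h (exists_of_minor_hwWedge_ne_zero hr s f (left_ne_zero_of_mul hne))
    · intro e _
      rw [orbitSum_eq_zero, mul_zero]
      exact fun ⟨σ, hσ⟩ => h ⟨e, σ, hσ⟩

/-! ### The representations `μ(2^r, 0)` -/

section

variable {Γ : Type*} [Group Γ] {m r : ℕ} {φ : Γ →* OO m} {s : ℤˣ}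

lemma minor₂_rep (γ : Γ) (f g : Fin r → Fin m)
    (x : (⋀[ℂ]^r (Fin m → ℂ)) ⊗[ℂ] (⋀[ℂ]^r (Fin m → ℂ))) (η : Fin m → ℤˣ)
    (π : Equiv.Perm (Fin m)) (h : φ γ = signedPerm η π) :
    minor₂ f g (Representation.tprod ((extPowRep m r).comp φ) ((extPowRep m r).comp φ) γ x) =
      ((tupleSign f η : ℤ) : ℂ) * ((tupleSign g η : ℤ) : ℂ) *
        minor₂ (fun j => π⁻¹ (f j)) (fun j => π⁻¹ (g j)) x := by
  induction x using TensorProduct.induction_on with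
  | zero => simp
  | tmul x y =>
    have h3 : Representation.tprod ((extPowRep m r).comp φ) ((extPowRep m r).comp φ) γ (x ⊗ₜ y) =
      (extPowRep m r (φ γ) x) ⊗ₜ (extPowRep m r (φ γ) y) := rfl
    rw [h3, minor₂_tmul, minor₂_tmul, h, minor_signedPerm, minor_signedPerm, cast_tupleSign,
      cast_tupleSign]
    ring
  | add x y hx hy => rw [map_add, map_add, map_add, hx, hy]; ring

lemma muTwo_induction {p : (⋀[ℂ]^r (Fin m → ℂ)) ⊗[ℂ] (⋀[ℂ]^r (Fin m → ℂ)) →ₗ[ℂ] ℂ}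
    (hp : ∀ γ, p (extPowRep m r (φ γ) (hwWedge m r s) ⊗ₜ extPowRep m r (φ γ) (hwWedge m r s)) = 0)
    (x : (⋀[ℂ]^r (Fin m → ℂ)) ⊗[ℂ] (⋀[ℂ]^r (Fin m → ℂ))) (hx : x ∈ (muTwo φ r s).toSubmodule) :
    p x = 0 := by
  induction hx using Submodule.span_induction with
  | mem x hx =>
    obtain ⟨γ, v, hv, rfl⟩ := hx
    rw [Set.mem_singleton_iff.1 hv]
    exact hp γ
  | zero => exact map_zero p
  | add x y _ _ hx hy => rw [map_add, hx, hy, add_zero]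
  | smul c x _ hx => rw [map_smul, hx, smul_zero]

lemma sum_minor₂_update (hr : 2 * r ≤ m) (f : Fin r → Fin m) (i : Fin r)
    (x : (⋀[ℂ]^r (Fin m → ℂ)) ⊗[ℂ] (⋀[ℂ]^r (Fin m → ℂ))) (hx : x ∈ (muTwo φ r s).toSubmodule) :
    ∑ l, minor₂ (Function.update f i l) (Function.update f i l) x = 0 := by
  have := muTwo_induction (p := ∑ l, minor₂ (Function.update f i l) (Function.update f i l))
    (fun γ => by
      rw [LinearMap.sum_apply]
      simp only [minor₂_tmul, extPowRep_hwWedge]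
      apply sum_minor_update_sq
      intro a b
      rw [orthogonal_mulVec_dot, weightVector_dot hr]) x hx
  rwa [LinearMap.sum_apply] at this

/-- Only the first of the two minors is moved to the complement; `minor_complement` applies to it on
each translate of the highest weight vector. -/
lemma minor₂_complement (h : r + r = m) (hr : 1 ≤ r) (hφ : ∀ γ, (φ γ).1.det = 1)
    (f f' : Fin r → Fin m) (hf : Function.Injective (Sum.elim f f')) : ∃ C : ℂ,
    ∀ x ∈ (muTwo φ r s).toSubmodule, minor₂ f' f x = C * minor₂ f f x := by
  refine ⟨((complSign h f f' : ℤ) : ℂ) * (((s : ℤ) : ℂ) * Complex.I ^ r), fun x hx => ?_⟩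
  have := muTwo_induction (p := minor₂ f' f - (((complSign h f f' : ℤ) : ℂ) *
    (((s : ℤ) : ℂ) * Complex.I ^ r)) • minor₂ f f) (fun γ => by
      have h1 := minor_complement h hr φ hφ s f f' hf (extPowRep m r (φ γ) (hwWedge m r s))
        (Submodule.subset_span ⟨γ, _, rfl, rfl⟩)
      rw [LinearMap.sub_apply, LinearMap.smul_apply, minor₂_tmul, minor₂_tmul, h1, smul_eq_mul]
      ring) x hx
  exact sub_eq_zero.1 this

end

/-! ### Coefficients on `μ(0) ⊗ μ(2^r, 0)` -/

/-- Functionals on a representation which behave like the products of two minors on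
`⋀^r ℂ^m ⊗ ⋀^r ℂ^m`. -/
structure IsSquareSystem {Γ V : Type*} [Group Γ] [AddCommMonoid V] [Module ℂ V] {m r : ℕ}
    (φ : Γ →* OO m) (ρ : Representation ℂ Γ V)
    (p : (Fin r → Fin m) → (Fin r → Fin m) → V →ₗ[ℂ] ℂ) : Prop where
  comp_perm : ∀ f g (σ τ : Equiv.Perm (Fin r)) x, p (f ∘ σ) (g ∘ τ) x =
    ((Equiv.Perm.sign σ : ℤ) : ℂ) * ((Equiv.Perm.sign τ : ℤ) : ℂ) * p f g x
  eq_zero : ∀ f g, ¬ Function.Injective g → ∀ x, p f g x = 0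
  signedPerm : ∀ γ η π, φ γ = signedPerm η π → ∀ f g x,
    p f g (ρ γ x) = ((tupleSign f η : ℤ) : ℂ) * ((tupleSign g η : ℤ) : ℂ) *
      p (fun j => π⁻¹ (f j)) (fun j => π⁻¹ (g j)) x
  separates : ∀ x, (∀ f g, Function.Injective f → Function.Injective g → p f g x = 0) → x = 0
  sum_update : ∀ f i x, ∑ l, p (Function.update f i l) (Function.update f i l) x = 0
  exists_hw : ∀ hr : 2 * r ≤ m, ∃ x, ∀ f, p f f x = pairFun (hwPairs hr) f

lemma exists_tmul_eq {V : Type*} [AddCommMonoid V] [Module ℂ V] (x : ℂ ⊗[ℂ] V) :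
    ∃ y, x = (1 : ℂ) ⊗ₜ y :=
  ⟨TensorProduct.lid ℂ V x, ((TensorProduct.lid ℂ V).symm_apply_apply x).symm⟩

/-- The coefficient functions used to identify `V^M`. -/
def sqMap {V : Type*} [AddCommMonoid V] [Module ℂ V] {m r : ℕ}
    (p : (Fin r → Fin m) → (Fin r → Fin m) → V →ₗ[ℂ] ℂ) :
    ℂ ⊗[ℂ] V →ₗ[ℂ] ((Fin r → Fin m) → ℂ) :=
  LinearMap.pi fun f => p f f ∘ₗ (TensorProduct.lid ℂ V).toLinearMap

lemma sqMap_tmul {V : Type*} [AddCommMonoid V] [Module ℂ V] {m r : ℕ}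
    (p : (Fin r → Fin m) → (Fin r → Fin m) → V →ₗ[ℂ] ℂ) (x : V) (f : Fin r → Fin m) :
    sqMap p ((1 : ℂ) ⊗ₜ x) f = p f f x := by
  simp [sqMap]

lemma extTensor_trivial_tmul {Γ₁ Γ₂ V : Type*} [Group Γ₁] [Group Γ₂] [AddCommMonoid V]
    [Module ℂ V] (ρ : Representation ℂ Γ₂ V) (γ : Γ₁ × Γ₂) (x : V) :
    extTensor (Representation.trivial ℂ Γ₁ ℂ) ρ γ ((1 : ℂ) ⊗ₜ x) = (1 : ℂ) ⊗ₜ (ρ γ.2 x) := rfl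

section

variable {Γ₁ Γ₂ V : Type*} [Group Γ₁] [Group Γ₂] [AddCommMonoid V] [Module ℂ V] {a d r : ℕ}
  {φ₁ : Γ₁ →* OO (a + d)} {φ₂ : Γ₂ →* OO a} {ρ : Representation ℂ Γ₂ V}
  {p : (Fin r → Fin a) → (Fin r → Fin a) → V →ₗ[ℂ] ℂ}

/-- Each sign occurs twice in a product of a minor with itself, so the sign changes act trivially on
these functions. -/
lemma sqMap_rep (hp : IsSquareSystem φ₂ ρ p) (γ : Γ₁ × Γ₂) (ε : Fin a → ℤˣ)
    (π : Equiv.Perm (Fin a)) (h : φ₂ γ.2 = signedPerm ε π) (w : WB a) (hw : w.right = π)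
    (x : ℂ ⊗[ℂ] V) : sqMap p (extTensor (Representation.trivial ℂ Γ₁ ℂ) ρ γ x) =
      tupleRep a r 0 0 w (sqMap p x) := by
  obtain ⟨y, rfl⟩ := exists_tmul_eq x
  ext f
  rw [extTensor_trivial_tmul, sqMap_tmul, hp.signedPerm γ.2 ε π h, IntUnits.cast_mul_self,
    tupleRep_apply, sqMap_tmul, hw]
  simp

lemma sqMap_Mgrp (hd : d ≤ 1) (hp : IsSquareSystem φ₂ ρ p) (γ : Γ₁ × Γ₂)
    (hγ : (φ₁.prodMap φ₂) γ ∈ Mgrp a d) (x : ℂ ⊗[ℂ] V) :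
    sqMap p (extTensor (Representation.trivial ℂ Γ₁ ℂ) ρ γ x) = sqMap p x := by
  obtain ⟨ε, hε⟩ := (mem_Mgrp_iff hd _).1 hγ
  rw [sqMap_rep hp γ ε 1 (congrArg Prod.snd hε) 1 rfl, map_one]
  rfl

lemma sqMap_mem_kerTuples (hp : IsSquareSystem φ₂ ρ p) (x : ℂ ⊗[ℂ] V) :
    sqMap p x ∈ kerTuples r a := by
  obtain ⟨y, rfl⟩ := exists_tmul_eq x
  refine ⟨⟨fun f σ => ?_, fun f hf => ?_⟩, fun f i => ?_⟩
  · rw [sqMap_tmul, sqMap_tmul, hp.comp_perm, IntUnits.cast_mul_self, one_mul]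
  · rw [sqMap_tmul, hp.eq_zero f f hf]
  · simp only [sqMap_tmul]
    exact hp.sum_update f i y

/-- The highest weight vector yields one system of pairs, and a signed permutation matrix of
determinant one carries it to any other. -/
lemma pairFun_mem_range_sqMap (hp : IsSquareSystem φ₂ ρ p) (hr : 2 * r ≤ a)
    (hs₂ : ∀ g : OO a, g.1.det = 1 → ∃ γ, φ₂ γ = g)
    (b : Fin r × Bool → Fin a) (hb : Function.Injective b) :
    pairFun b ∈ LinearMap.range (sqMap p) := by
  obtain ⟨η, π, hπ, hdet⟩ := exists_signedPerm_comp (hwPairs hr) b (hwPairs_injective hr) hb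
  obtain ⟨γ, hγ⟩ := hs₂ _ hdet
  obtain ⟨x, hx⟩ := hp.exists_hw hr
  refine ⟨(1 : ℂ) ⊗ₜ ρ γ x, ?_⟩
  have h1 : pairFun b = tupleRep a r 0 0 (SemidirectProduct.inr π) (pairFun (hwPairs hr)) := by
    rw [tupleRep_pairFun]
    congr 1
    ext1 x
    exact (hπ x).symm
  ext f
  rw [sqMap_tmul, hp.signedPerm γ η π hγ, IntUnits.cast_mul_self, one_mul, hx, h1, tupleRep_apply]
  simp

/-- The image lies between the span of the functions `pairFun b` and the kernel, and the inclusion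
of the former in the latter is what `kerTuples_le_span` requires to identify them. -/
lemma range_sqMap (hp : IsSquareSystem φ₂ ρ p) (hr : 2 * r ≤ a)
    (hs₂ : ∀ g : OO a, g.1.det = 1 → ∃ γ, φ₂ γ = g) :
    LinearMap.range (sqMap p) =
      Submodule.span ℂ (pairFun '' {b : Fin r × Bool → Fin a | Function.Injective b}) := by
  have h1 : LinearMap.range (sqMap p) ≤ kerTuples r a := by
    rintro _ ⟨x, rfl⟩
    exact sqMap_mem_kerTuples hp x
  refine le_antisymm (h1.trans (kerTuples_le_span hr fun b hb =>
    h1 (pairFun_mem_range_sqMap hp hr hs₂ b hb))) ?_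
  rw [Submodule.span_le]
  rintro _ ⟨b, hb, rfl⟩
  exact pairFun_mem_range_sqMap hp hr hs₂ b hb

lemma carriesWeylRep_of_squareSystem (hd : d ≤ 1) (hp : IsSquareSystem φ₂ ρ p) {n : ℕ}
    (h : n + r = a) (hr : r ≤ n) (hj : Function.Injective (φ₁.prodMap φ₂))
    (hs : ∀ g : KK a d, g.1.1.det = 1 → g.2.1.det = 1 → ∃ γ, (φ₁.prodMap φ₂) γ = g)
    (hs₂ : ∀ g : OO a, g.1.det = 1 → ∃ γ, φ₂ γ = g)
    (W : Subgroup (WB a)) (hW : d = 0 ∧ W = WD a ∨ d = 1 ∧ W = ⊤)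
    (G : Subgroup (Fin a → ℤˣ)) (hG : ∀ ε ∈ G, ∃ γ, (φ₁.prodMap φ₂) γ = diagM d ε)
    (hdet : ∀ f g : Fin r → Fin a, Function.Injective f → Function.Injective g →
      (∀ ε ∈ G, tupleSign f ε = tupleSign g ε) → ∃ C : ℂ, ∀ x, p f g x = C * p g g x) :
    CarriesWeylRep (φ₁.prodMap φ₂) (extTensor (Representation.trivial ℂ Γ₁ ℂ) ρ) W
      (resTo W (sigmaRep (Nat.add_zero a) (twoRow r n) (oneRow 0))) := by
  let _ : AddCommGroup (ℂ ⊗[ℂ] V) := Module.addCommMonoidToAddCommGroup ℂ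
  obtain ⟨ψ, hψ, hψR, hrange⟩ := exists_model_twoRow h hr
  refine carriesWeylRep_of_coefficients (φ₁.prodMap φ₂) _ W _ (tupleRep a r 0 0)
    (sqMap p) ψ (finite_Mgrp_comap hd _ hj)
    (fun γ hγ m hm => conj_mem_Mgrp hd _ hγ m hm)
    (fun w => exists_induces _ hs w ?_) (fun γ hγ => ?_)
    (fun γ hγ x => sqMap_Mgrp hd hp γ hγ x) (fun x hx hx0 => ?_) hψ (fun w x => hψR w x)
    (hrange.trans (range_sqMap hp (by omega) hs₂).symm)
  · rcases hW with ⟨h, rfl⟩ | ⟨h, -⟩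
    · exact Or.inl ⟨h, w.2⟩
    · exact Or.inr h
  · obtain ⟨η, ε, π, h⟩ := exists_signedPair_of_normalizesA hd _ hγ
    rw [h, normalizesA_signedPair_iff] at hγ
    have hw : (⟨fun i => η (Fin.castAdd d i) * ε i, π⟩ : WB a) ∈ W := by
      rcases hW with ⟨rfl, rfl⟩ | ⟨-, rfl⟩
      · change ∏ i, η (Fin.castAdd 0 i) * ε i = 1
        rw [Finset.prod_mul_distrib]
        exact hγ
      · trivial
    refine ⟨⟨_, hw⟩, ?_, fun x => sqMap_rep hp γ ε π (congrArg Prod.snd h) _ rfl x⟩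
    rw [h]; exact inducesOnA_signedPair η ε π
  · obtain ⟨y, rfl⟩ := exists_tmul_eq x
    have h0 : y = 0 := hp.separates y fun f g hf hg => by
      by_contra hne
      obtain ⟨C, hC⟩ := hdet f g hf hg (fun ε hε => by
        obtain ⟨γ, hγ⟩ := hG ε hε
        have h1 := hx γ (by rw [hγ]; exact diagM_mem ε)
        rw [extTensor_trivial_tmul] at h1
        have h1 : ρ γ.2 y = y := by
          have := congrArg (TensorProduct.lid ℂ V) h1
          simpa using this
        have h2 := hp.signedPerm γ.2 _ _ (congrArg Prod.snd hγ) f g y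
        rw [h1] at h2
        simp only [inv_one, Equiv.Perm.one_apply] at h2
        have h3 : ((tupleSign f ε * tupleSign g ε : ℤˣ) : ℤ) = 1 := by
          have h4 := mul_right_cancel₀ hne ((one_mul _).trans h2)
          have h5 : (((tupleSign f ε * tupleSign g ε : ℤˣ) : ℤ) : ℂ) = 1 := by
            rw [Units.val_mul, Int.cast_mul]; exact h4.symm
          exact_mod_cast h5
        have h6 := eq_inv_of_mul_eq_one_left (Units.ext h3)
        rwa [Int.units_inv_eq_self] at h6)
      apply hne
      have h1 := congrFun hx0 g
      rw [sqMap_tmul] at h1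
      rw [hC, h1]
      exact mul_zero C
    rw [h0, TensorProduct.tmul_zero]

lemma coeff_determined_square (hp : IsSquareSystem φ₂ ρ p) (f g : Fin r → Fin a)
    (hf : Function.Injective f) (hg : Function.Injective g) (h : Set.range f = Set.range g) :
    ∃ C : ℂ, ∀ x, p f g x = C * p g g x := by
  obtain ⟨σ, rfl⟩ := exists_perm_of_range_eq f g hf hg h
  exact ⟨_, fun x => hp.comp_perm g g σ 1 x⟩

lemma isQuasispherical_of_squareSystem (hd : d ≤ 1)
    {ρ : Representation ℂ (OO a) V} (hp : IsSquareSystem (MonoidHom.id _) ρ p) (hr : 2 * r ≤ a) :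
    IsQuasispherical (a := a) (d := d)
      (extTensor (Representation.trivial ℂ (OO (a + d)) ℂ) ρ) := by
  let _ : AddCommGroup (ℂ ⊗[ℂ] V) := Module.addCommMonoidToAddCommGroup ℂ
  have hV : Module.Finite ℂ V := by
    let _ : AddCommGroup V := Module.addCommMonoidToAddCommGroup ℂ
    refine Module.Finite.of_injective (LinearMap.pi fun x : (Fin r → Fin a) × (Fin r → Fin a) =>
      p x.1 x.2) ((injective_iff_map_eq_zero _).2 fun x hx => ?_)
    exact hp.separates x fun f g _ _ => congrFun hx (f, g)
  have : Module.Finite ℂ (ℂ ⊗[ℂ] V) := inferInstance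
  obtain ⟨x, hx⟩ := hp.exists_hw hr
  -- The even coordinates, where the minor of the highest weight vector is `1`.
  let f : Fin r → Fin a := fun j => hwPairs hr (j, false)
  refine isQuasispherical_of_functional _ (LinearMap.proj f ∘ₗ sqMap p) ?_ ?_
  · intro h0
    have h1 := LinearMap.congr_fun h0 ((1 : ℂ) ⊗ₜ x)
    rw [LinearMap.comp_apply, LinearMap.proj_apply, sqMap_tmul, hx, ← minor_hwWedge_sq hr 1,
      minor_hwWedge_even f (fun j => rfl)] at h1
    simp at h1
  · intro k hk x
    exact congrFun (sqMap_Mgrp (φ₁ := MonoidHom.id _) hd hp k hk x) f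

end

/-! ### The products of minors on `μ(2^r, 0)` -/

section

variable {a r : ℕ}

lemma minor₂_comp_perm (f g : Fin r → Fin a) (σ τ : Equiv.Perm (Fin r))
    (x : (⋀[ℂ]^r (Fin a → ℂ)) ⊗[ℂ] (⋀[ℂ]^r (Fin a → ℂ))) :
    minor₂ (f ∘ σ) (g ∘ τ) x =
      ((Equiv.Perm.sign σ : ℤ) : ℂ) * ((Equiv.Perm.sign τ : ℤ) : ℂ) * minor₂ f g x :=
  mulCoeff_congr (minor_comp_perm f σ) (minor_comp_perm g τ) x

lemma minor₂_eq_zero (f g : Fin r → Fin a) (hg : ¬ Function.Injective g)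
    (x : (⋀[ℂ]^r (Fin a → ℂ)) ⊗[ℂ] (⋀[ℂ]^r (Fin a → ℂ))) : minor₂ f g x = 0 := by
  have := mulCoeff_congr (p₁ := minor f) (p₁' := minor f) (p₂ := minor g) (p₂' := minor g)
    (C := 1) (D := 0) (by simp) (fun y => by rw [minor_eq_zero g hg, zero_mul]) x
  rw [mul_zero, zero_mul] at this
  exact this

end

/-- The restriction to `μ(2^r, 0)` of a product of minors. -/
def muSquare {Γ : Type*} [Group Γ] {m : ℕ} (φ : Γ →* OO m) (r : ℕ) (s : ℤˣ)
    (f g : Fin r → Fin m) : (muTwo φ r s).toSubmodule →ₗ[ℂ] ℂ :=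
  minor₂ f g ∘ₗ (muTwo φ r s).toSubmodule.subtype

lemma isSquareSystem_muSquare {Γ : Type*} [Group Γ] {m r : ℕ} (hr : 2 * r ≤ m) (φ : Γ →* OO m)
    (s : ℤˣ) : IsSquareSystem (V := (muTwo φ r s).toSubmodule) φ (muTwo φ r s).toRepresentation
      (muSquare φ r s) where
  comp_perm f g σ τ x := minor₂_comp_perm f g σ τ x
  eq_zero f g hg x := minor₂_eq_zero f g hg x
  signedPerm γ η π h f g x := minor₂_rep γ f g x η π h
  separates x hx := by
    have h : (x : (⋀[ℂ]^r (Fin m → ℂ)) ⊗[ℂ] (⋀[ℂ]^r (Fin m → ℂ))) = 0 := minor₂_separates _ hx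
    exact Subtype.ext h
  sum_update f i x := sum_minor₂_update hr f i x x.2
  exists_hw hr := by
    have hmem : hwWedge m r s ⊗ₜ hwWedge m r s ∈ (muTwo φ r s).toSubmodule :=
      Submodule.subset_span ⟨1, _, rfl, by rw [map_one]; rfl⟩
    refine ⟨⟨_, hmem⟩, fun f => ?_⟩
    rw [← minor_hwWedge_sq hr s]
    exact minor₂_tmul f f _ _

lemma relevantE_carriesWeylRep {a d r n : ℕ} (hd : d ≤ 1) (h : n + r = a) (hr : r ≤ n)
    (W : Subgroup (WB a)) (hW : d = 0 ∧ W = WD a ∨ d = 1 ∧ W = ⊤) :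
    IsQuasispherical (relevantE a d r) ∧
    CarriesWeylRep (MonoidHom.id (KK a d)) (relevantE a d r) W
      (resTo W (sigmaRep (Nat.add_zero a) (twoRow r n) (oneRow 0))) := by
  have hp := isSquareSystem_muSquare (r := r) (by omega) (MonoidHom.id (OO a)) 1
  constructor
  · exact isQuasispherical_of_squareSystem hd hp (by omega)
  · exact carriesWeylRep_of_squareSystem (φ₁ := MonoidHom.id _) hd hp h hr
      Function.injective_id (fun g _ _ => ⟨g, rfl⟩) (fun g _ => ⟨g, rfl⟩) W hW
      ⊤ (fun ε _ => ⟨diagM d ε, rfl⟩) (fun f g hf hg hfg => coeff_determined_square hp f g hf hg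
          (range_eq_of_tupleSign f g hf hg fun ε => hfg ε (Subgroup.mem_top ε)))

/-- Even sign changes also leave the coordinates with `f` complementary to `g`; in middle degree
these are multiples of the diagonal ones by `minor₂_complement`. -/
lemma muTwoSO_carriesWeylRep {a k : ℕ} (h : k + k = a) (hk : 1 ≤ k) (s : ℤˣ) :
    CarriesWeylRep (soIncl a 0)
      (extTensor (Representation.trivial ℂ (SOsub (a + 0)) ℂ) (muTwoSO a k s)) (WD a)
      (resTo (WD a) (sigmaRep (Nat.add_zero a) (twoRow k k) (oneRow 0))) := by
  have hp := isSquareSystem_muSquare (r := k) (by omega) (SOsub a).subtype s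
  refine carriesWeylRep_of_squareSystem (φ₁ := (SOsub (a + 0)).subtype) zero_le_one hp h
    le_rfl (soIncl_injective a 0) exists_soIncl exists_subtype_SOsub
    (WD a) (Or.inl ⟨rfl, rfl⟩) (evenSigns a) (exists_diagM (j := soIncl a 0) exists_soIncl)
    (fun f g hf hg hfg => ?_)
  rcases range_eq_or_of_tupleSign f g hf hg hfg with hfg | hfg
  · exact coeff_determined_square hp f g hf hg hfg
  · obtain ⟨C, hC⟩ := minor₂_complement (φ := (SOsub a).subtype) (s := s) h hk (fun γ => γ.2) g f
      (elim_injective_of_range f g hf hg hfg)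
    exact ⟨C, fun x => hC x x.2⟩

end

/-- The bounds by integer parts are expressed through sums: `r ≤ [a/2]` is `p + r = a` with `r ≤ p`,
and `k + 1 ≤ [(a+1)/2]` is `k + p = a` with `k + 1 ≤ p`. -/
theorem mainTheorem10 (a : ℕ) :
    -- O(a,a), Weyl group of type D_a
    (∀ p r : ℕ, p + r = a → r ≤ p →
      IsQuasispherical (relevantE a 0 r) ∧
      CarriesWeylRep (MonoidHom.id (KK a 0)) (relevantE a 0 r) (WD a)
        (resTo (WD a) (sigmaRep (Nat.add_zero a) (twoRow r p) (oneRow 0)))) ∧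
    (∀ (p k : ℕ) (h : p + k = a), k ≤ p →
      IsQuasispherical (relevantO a 0 k k) ∧
      CarriesWeylRep (MonoidHom.id (KK a 0)) (relevantO a 0 k k) (WD a)
        (resTo (WD a) (sigmaRep h (oneRow p) (oneRow k)))) ∧
    -- the representations of SO(a) × SO(a) when a = 2k
    (∀ (k : ℕ) (h : k + k = a), 1 ≤ k →
      (∀ s : ℤˣ, CarriesWeylRep (soIncl a 0)
        (extTensor (Representation.trivial ℂ (SOsub (a + 0)) ℂ) (muTwoSO a k s)) (WD a)
        (resTo (WD a) (sigmaRep (Nat.add_zero a) (twoRow k k) (oneRow 0)))) ∧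
      (∀ s t : ℤˣ, s * t = (-1) ^ k →
        CarriesWeylRep (soIncl a 0) (extTensor (muOneSO (a + 0) k s) (muOneSO a k t)) (WD a)
          (sigmaI h).toRepresentation) ∧
      (∀ s t : ℤˣ, s * t = -(-1) ^ k →
        CarriesWeylRep (soIncl a 0) (extTensor (muOneSO (a + 0) k s) (muOneSO a k t)) (WD a)
          (sigmaII h).toRepresentation)) ∧
    -- O(a+1,a), Weyl group of type B_a
    (∀ p r : ℕ, p + r = a → r ≤ p →
      IsQuasispherical (relevantE a 1 r) ∧
      CarriesWeylRep (MonoidHom.id (KK a 1)) (relevantE a 1 r) ⊤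
        (resTo ⊤ (sigmaRep (Nat.add_zero a) (twoRow r p) (oneRow 0)))) ∧
    (∀ (p k : ℕ) (h : p + k = a), k ≤ p →
      IsQuasispherical (relevantO a 1 k k) ∧
      CarriesWeylRep (MonoidHom.id (KK a 1)) (relevantO a 1 k k) ⊤
        (resTo ⊤ (sigmaRep h (oneRow p) (oneRow k)))) ∧
    (∀ (k p : ℕ) (h : k + p = a), k + 1 ≤ p →
      IsQuasispherical (relevantO a 1 (k + 1) k) ∧
      CarriesWeylRep (MonoidHom.id (KK a 1)) (relevantO a 1 (k + 1) k) ⊤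
        (resTo ⊤ (sigmaRep h (oneRow k) (oneRow p)))) ∧
    -- the representations of SO(a+1) × SO(a) when a = 2k
    (∀ (k : ℕ) (h : k + k = a), 1 ≤ k → ∀ s : ℤˣ,
      CarriesWeylRep (soIncl a 1) (extTensor (muOneSO (a + 1) k 1) (muOneSO a k s)) ⊤
        (resTo ⊤ (sigmaRep h (oneRow k) (oneRow k)))) ∧
    -- the representations of SO(a+1) × SO(a) when a = 2k+1
    (∀ (k : ℕ) (h : k + (k + 1) = a), ∀ s : ℤˣ,
      CarriesWeylRep (soIncl a 1) (extTensor (muOneSO (a + 1) (k + 1) s) (muOneSO a k 1)) ⊤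
        (resTo ⊤ (sigmaRep h (oneRow k) (oneRow (k + 1))))) := by
  refine ⟨fun p r h hr => ?_, fun p k h hk => ?_, fun k h hk => ⟨?_, ?_, ?_⟩, fun p r h hr => ?_,
    fun p k h hk => ?_, fun k p h hk => ?_, ?_, ?_⟩
  · exact relevantE_carriesWeylRep zero_le_one h hr _ (Or.inl ⟨rfl, rfl⟩)
  · exact relevantO_carriesWeylRep zero_le_one (isCompletion_castAdd a 0 k) (by omega) (by omega)
      _ (Or.inl ⟨rfl, rfl⟩) _ (exists_model_last h)
  · exact muTwoSO_carriesWeylRep h hk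
  · exact sigmaI_carriesWeylRep h hk
  · exact sigmaII_carriesWeylRep h hk
  · exact relevantE_carriesWeylRep le_rfl h hr _ (Or.inr ⟨rfl, rfl⟩)
  · exact relevantO_carriesWeylRep le_rfl (isCompletion_castAdd a 1 k) (by omega) (by omega)
      _ (Or.inr ⟨rfl, rfl⟩) _ (exists_model_last h)
  · exact relevantO_carriesWeylRep le_rfl (isCompletion_append_last a k) (by omega) (by omega)
      _ (Or.inr ⟨rfl, rfl⟩) _ (exists_model_first h)
  · exact fun k h hk s => muOneSO_even_carriesWeylRep h hk s
  · exact fun k h s => muOneSO_odd_carriesWeylRep h s
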